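/- Let $\Gamma=(V,E,(w_v)_{v\in V})$ be a finite tree with integer weights $w_v$, and let $W$ be its linking matrix: $W_{vv}=w_v$, $W_{vv'}=1$ if $\{v,v'\}\in E$, and all other entries $0$. Assume that $W$ is negative definite, that $\det W=\pm1$, and that $w_i\le -2$ for every vertex $i$ of degree $1$. Let $k$ be a positive integer. Notation. Let $V_d$ (resp. $V_{\ge d}$) be the set of vertices of degree $d$ (resp. $\ge d$); $\mathbf e(z)=e^{2\pi\sqrt{-1}z}$ and $\zeta_n=\mathbf e(1/n)$ for a nonzero integer $n$. For $v\in V_{\ge2}$ let $\overline v=\{i\in V_1:\{i,v\}\in E\}$, $M_v=\prod_{i\in\overline v}w_i$, $$G_v(q)=(q^{M_v}-q^{-M_v})^{2-\deg v}\prod_{i\in\overline v}\left(q^{M_v/w_i}-q^{-M_v/w_i}\right),$$ let $\mathcal S_v$ be the set of the numbers $\frac{\deg v}2-1+\sum_{i\in\overline v}\frac{l_i}{2w_i}$ with $l\in\{\pm1\}^{\overline v}$, and let $\varepsilon_v$ take the value $\prod_{i\in\overline v} l_i$ at any number congruent modulo $\mathbb Z$ to the number of $\mathcal S_v$ given by $l$,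 and the value $0$ elsewhere. Put $\mathcal S=\prod_{v\in V_{\ge2}}\mathcal S_v$ and $\varepsilon(\alpha)=\prod_{v\in V_{\ge 2}}\varepsilon_v(\alpha_v)$. Let $S$ be the $V_{\ge2}\times V_{\ge2}$ block of $-W^{-1}$, $Q(x)={}^t x S x$, and $$P(x)=\prod_{v\in V_{\ge3}}\frac{(x_v+\deg v-3)\cdots(x_v+1)}{(\deg v-3)!}=\sum_m p_m x^m .$$ Vectors indexed by $V_{\ge3}$ are extended by $0$ to $V_{\ge2}$. Put $f_1(x)=\exp(-\sum_{v\in V_{\ge2}}x_v)$, and for $t\in\mathbb R_{>0}^{V_{\ge3}}$ $$F(f_1;t)=\sum_{\alpha\in\mathcal S}\varepsilon(\alpha)\sum_{n\in\mathbb Z_{\ge0}^{V_{\ge3}}}\mathbf e\left(\tfrac1kQ(n+\alpha)\right)P(n)\,f_1\big((t_v(n_v+\alpha_v))_v\big).$$ Let $$C=\frac{(-1)^{|V_1|}\,\mathbf e(|V_{\ge2}|/8)}{\sqrt{2k}^{\,|V_{\ge2}|}\prod_{i\in V_1}\sqrt{|w_i|}} .$$ For $n\in\mathbb Z^{V_{\ge3}}$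 let $c_n$ be the coefficient of $f^{(n)}(0)\prod_v t_v^{n_v}$ in the asymptotic expansion of $F(f;t)$ as $t\to+0$, that is, $$c_n=\sum_m p_m\prod_{v\in V_{\ge 3}}k^{m_v+n_v}\sum_{\alpha\in\mathcal S}\varepsilon(\alpha)\sum_{\lambda\in\{0,\dots,k-1\}^{V_{\ge3}}}\mathbf e\left(\tfrac1kQ(\lambda+\alpha)\right)\prod_{v\in V_{\ge3}}\left(-\mathbb B_{m_v,n_v}\left(\tfrac{\alpha_v}k,\tfrac{\lambda_v}k\right)\right),$$ $$\mathbb B_{m,n}(a,b)=m!\sum_{\substack{0\le j\le m\\ n+j+1\ge0}}\frac{B_{n+j+1}(a+b)}{(n+j+1)!}\binom{n+j}{j}\frac{(-a)^{m-j}}{(m-j)!},\qquad \binom xj=\frac{x(x-1)\cdots(x-j+1)}{j!},$$ where $B_j(x)$ denotes the $j$-th Bernoulli polynomial. Proposition. The inner series defining $F(f_1;t)$ converge absolutely for $t\in\mathbb R_{>0}^{V_{\ge3}}$, and $F(f_1;t)$ is given there by the finite sum (a rational function in exponentials of the $t_v$) $$F(f_1;t)=C\sum_{\mu\in\mathbb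 Z^{V_{\ge2}}/2kS(\mathbb Z^{V_{\ge2}})}\mathbf e\left(-\tfrac1{4k}{}^t\mu S^{-1}\mu\right)\prod_{v\in V_{\ge2}}G_v\left(\zeta_{2kM_v}^{\mu_v}e^{-t_v/2M_v}\right),$$ by which it is extended to complex $t$. Moreover: (i) For each $v\in V_{\ge3}$, the function $F(f_1;t)$ is meromorphic in $t_v$ at $t_v=0$ and $$\operatorname{ord}_{t_v=0}F(f_1;t)\ge\min\{0,|\overline v|+2-\deg v\},$$ for all fixed complex values of the other variables $t_u$ ($u\in V_{\ge 3}$, $u\ne v$) with $e^{kt_u}\ne1$. (ii) If $|\overline v|+2-\deg v>0$ for every $v\in V_{\ge3}$, then $F(f_1;t)$ extends holomorphically to a neighbourhood of $t=0$, with value $$F(f_1;0)=c_0=C\sum_{\mu\in(\mathbb Z\smallsetminus k\mathbb Z)^{V_{\ge2}}/2kS(\mathbb Z^{V_{\ge2}})}\mathbf e\left(-\tfrac1{4k}{}^t\mu S^{-1}\mu\right)\prod_{v\in V_{\ge2}}G_v\left(\zeta_{2kM_v}^{\mu_v}\right),$$ and the weighted Gauss sums of negative degree vanish: $c_n=0$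 for every $n\in\mathbb Z^{V_{\ge3}}$ with $n_v\le-1$ for some $v$. -/

import Mathlib

open Complex Filter Topology

noncomputable section

namespace Plumbing

/-- `e(z) = exp (2 π i z)`. -/
def e (z : ℂ) : ℂ := Complex.exp (2 * Real.pi * Complex.I * z)

/-- `ζ_n = exp (2 π i / n)`, for a nonzero integer `n` of either sign. -/
def zeta (n : ℤ) : ℂ := e (1 / (n : ℂ))

/-- The polynomial `𝔹_{m,n}(a, b)` (for `m ≥ 0`, `n ∈ ℤ`) in terms of Bernoulli polynomials;
the sum is over those `0 ≤ j ≤ m` for which `n + j + 1 ≥ 0`, and `Ring.choose` is the generalised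
binomial coefficient `x (x - 1) ⋯ (x - j + 1) / j!`. It describes the Euler--Maclaurin expansion
`∑_{r ≥ 0} (b + r)^m f(τ (a + b + r)) ~ - ∑_n 𝔹_{m,n}(a, b) f^{(n)}(0) τ^n` as `τ → +0`. -/
def bbB (m : ℕ) (n : ℤ) (a b : ℚ) : ℚ :=
  (m.factorial : ℚ) * ∑ j ∈ Finset.range (m + 1),
    if 0 ≤ n + j + 1 then
      (Polynomial.bernoulli (n + j + 1).toNat).eval (a + b) / ((n + j + 1).toNat.factorial : ℚ)
        * (Ring.choose (n + j) j : ℤ) * ((-a) ^ (m - j) / ((m - j).factorial : ℚ))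
    else 0

section Graph

variable {V : Type*} [Fintype V] [DecidableEq V] (G : SimpleGraph V) [DecidableRel G.Adj]
  (w : V → ℤ)

/-- The linking matrix: the weights on the diagonal, `1` for every edge, `0` elsewhere. -/
def linkingMatrix : Matrix V V ℤ := Matrix.diagonal w + G.adjMatrix ℤ

/-- The vertices of degree one. -/
abbrev V1 : Type _ := {v : V // G.degree v = 1}

/-- The vertices of degree at least two. -/
abbrev V2 : Type _ := {v : V // 2 ≤ G.degree v}

/-- The vertices of degree at least three. -/
abbrev V3 : Type _ := {v : V // 3 ≤ G.degree v}

/-- `v̄`: the vertices of degree one adjacent to `v`. -/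
def leaves (v : V) : Finset V := (G.neighborFinset v).filter fun i => G.degree i = 1

/-- `M_v = ∏_{i ∈ v̄} w_i`. -/
def M (v : V) : ℤ := ∏ i ∈ leaves G v, w i

/-- `S`: the block of `-W⁻¹` indexed by the vertices of degree at least two. When `det W = ±1` the
inverse over `ℤ` is the genuine inverse. -/
def S : Matrix (V2 G) (V2 G) ℤ :=
  (-(linkingMatrix G w)⁻¹).submatrix Subtype.val Subtype.val

/-- `S` with rational entries. -/
def SQ : Matrix (V2 G) (V2 G) ℚ := (S G w).map (Int.cast : ℤ → ℚ)

/-- The quadratic form `Q(x) = ᵗx S x`. -/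
def Q (x : V2 G → ℚ) : ℚ := x ⬝ᵥ (SQ G w).mulVec x

/-- Extension by zero from the vertices of degree at least three to those of degree at least
two. -/
def ext0 {R : Type*} [Zero R] (x : V3 G → R) : V2 G → R :=
  fun v => if h : 3 ≤ G.degree v.1 then x ⟨v.1, h⟩ else 0

/-- A vertex of degree at least three, seen as a vertex of degree at least two. -/
def V3.toV2 (v : V3 G) : V2 G := ⟨v.1, le_trans (by norm_num) v.2⟩

/-- `deg(v)/2 - 1 + ∑_{i ∈ v̄} l_i / (2 w_i)` for signs `l_i`. -/
def point (v : V) (l : leaves G v → ℤˣ) : ℚ :=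
  (G.degree v : ℚ) / 2 - 1 + ∑ i : leaves G v, ((l i : ℤ) : ℚ) / (2 * (w i.1 : ℚ))

/-- The finite set `𝒮_v` of all these numbers. -/
def calSv (v : V) : Finset ℚ := Finset.univ.image (point G w v)

open Classical in
/-- `ε_v`: the product of the signs at a number congruent modulo `ℤ` to one of `𝒮_v`, and `0` at
all other numbers. -/
def epsv (v : V) (α : ℚ) : ℤ :=
  if h : ∃ l : leaves G v → ℤˣ, ∃ z : ℤ, α = point G w v l + z then
    ∏ i : leaves G v, ((h.choose i : ℤˣ) : ℤ)
  else 0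

/-- `𝒮 = ∏_v 𝒮_v`, over the vertices of degree at least two. -/
def calS : Finset (V2 G → ℚ) := Fintype.piFinset fun v => calSv G w v.1

/-- `ε(α) = ∏_v ε_v(α_v)`. -/
def eps (α : V2 G → ℚ) : ℤ := ∏ v : V2 G, epsv G w v.1 (α v)

/-- The polynomial
`P(x) = ∏_{deg v ≥ 3} (x_v + deg v - 3) ⋯ (x_v + 1) / (deg v - 3)!`
(a vertex of degree three contributes the factor `1`). -/
def P : MvPolynomial (V3 G) ℚ :=
  ∏ v : V3 G, (MvPolynomial.C (1 / ((G.degree v.1 - 3).factorial : ℚ)) *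
    ∏ j ∈ Finset.Icc 1 (G.degree v.1 - 3),
      (MvPolynomial.X v + MvPolynomial.C (j : ℚ)))

/-- The term `e(Q(n + α) / k) P(n) f(t (n + α))`, where `n` and `t` are extended by zero to the
vertices of degree two. -/
def term (k : ℕ) (f : (V2 G → ℝ) → ℂ) (t : V3 G → ℝ) (α : V2 G → ℚ) (n : V3 G → ℕ) : ℂ :=
  e ((Q G w (fun v => ext0 G (fun u => (n u : ℚ)) v + α v) : ℚ) / (k : ℂ)) *
    ((MvPolynomial.eval (fun u => (n u : ℚ)) (P G) : ℚ) : ℂ) *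
    f (fun v => ext0 G t v * (ext0 G (fun u => (n u : ℝ)) v + (α v : ℝ)))

/-- The series `F(f; t) = ∑_{α ∈ 𝒮} ε(α) ∑_{n ≥ 0} e(Q(n + α) / k) P(n) f(t (n + α))`. -/
def seriesF (k : ℕ) (f : (V2 G → ℝ) → ℂ) (t : V3 G → ℝ) : ℂ :=
  ∑ α ∈ calS G w, (eps G w α : ℂ) * ∑' n : V3 G → ℕ, term G w k f t α n

/-- `f₁(x) = exp (-∑ x_v)`. -/
def f1 (x : V2 G → ℝ) : ℂ := Complex.exp (-((∑ v, x v : ℝ) : ℂ))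

/-- The rational function
`G_v(q) = (q^{M_v} - q^{-M_v})^{2 - deg v} ∏_{i ∈ v̄} (q^{M_v / w_i} - q^{-M_v / w_i})`. -/
def Gv (v : V) (q : ℂ) : ℂ :=
  (q ^ M G w v - q ^ (-M G w v)) ^ ((2 : ℤ) - G.degree v) *
    ∏ i ∈ leaves G v, (q ^ (M G w v / w i) - q ^ (-(M G w v / w i)))

/-- The lattice `2 k S (ℤ^{V_{≥2}})`. -/
def lattice (k : ℕ) : AddSubgroup (V2 G → ℤ) :=
  (((2 * k : ℤ) • (S G w).mulVecLin).range).toAddSubgroup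

/-- The Gaussian weight `e(-ᵗμ S⁻¹ μ / (4 k))`. -/
def gaussWeight (k : ℕ) (μ : V2 G → ℤ) : ℂ :=
  e (-(((fun v => (μ v : ℚ)) ⬝ᵥ (SQ G w)⁻¹.mulVec (fun v => (μ v : ℚ)) : ℚ) : ℂ) / (4 * k))

/-- The constant
`(-1)^{|V_1|} e(|V_{≥2}| / 8) / (√(2k)^{|V_{≥2}|} ∏_{i ∈ V_1} √|w_i|)`. -/
def prefactor (k : ℕ) : ℂ :=
  (-1) ^ Fintype.card (V1 G) * e ((Fintype.card (V2 G) : ℂ) / 8) /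
    (((Real.sqrt (2 * k) : ℝ) : ℂ) ^ Fintype.card (V2 G) *
      ∏ i : V1 G, ((Real.sqrt |(w i.1 : ℝ)| : ℝ) : ℂ))

/-- The rational function (in exponentials of the `t_v`) `F(f₁; t)`. The summand depends only on
the class of `μ`, so any representative may be used. -/
def ratF (k : ℕ) (t : V3 G → ℂ) : ℂ :=
  prefactor G w k * ∑ᶠ x : (V2 G → ℤ) ⧸ lattice G w k,
    gaussWeight G w k x.out *
      ∏ v : V2 G, Gv G w v.1
        (zeta (2 * k * M G w v.1) ^ (x.out v) *
          Complex.exp (-(ext0 G t v) / (2 * (M G w v.1 : ℂ))))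

open Classical in
/-- The weighted Gauss sum over `(ℤ ∖ kℤ)^{V_{≥2}} / 2kS(ℤ^{V_{≥2}})`, with its constant. -/
def weightedGaussSum (k : ℕ) : ℂ :=
  prefactor G w k * ∑ᶠ x : (V2 G → ℤ) ⧸ lattice G w k,
    if ∀ v, ¬ (k : ℤ) ∣ x.out v then
      gaussWeight G w k x.out * ∏ v : V2 G, Gv G w v.1 (zeta (2 * k * M G w v.1) ^ (x.out v))
    else 0

/-- The coefficient `c_n` of `f^{(n)}(0) ∏ t_v^{n_v}` in the asymptotic expansion of `F(f; t)`. -/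
def coeff (k : ℕ) (n : V3 G → ℤ) : ℂ :=
  ∑ m ∈ (P G).support, (((P G).coeff m : ℚ) : ℂ) * (∏ v : V3 G, (k : ℂ) ^ ((m v : ℤ) + n v)) *
    ∑ α ∈ calS G w, (eps G w α : ℂ) * ∑ l : V3 G → Fin k,
      e ((Q G w (fun v => ext0 G (fun u => ((l u : ℕ) : ℚ)) v + α v) : ℚ) / (k : ℂ)) *
        ∏ v : V3 G,
          ((-bbB (m v) (n v) (α (V3.toV2 G v) / k) (((l v : ℕ) : ℚ) / k) : ℚ) : ℂ)

end Graph

end Plumbing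

end

/-!
Why the theorem is true.

*The lattice.* Two leaves at the same vertex have coprime weights, because `det W = ±1`
(`isCoprime_leaves`). Consequently `S` is the diagonal matrix of the `M_v` times a unimodular
matrix, and `2kS(ℤ^{V_{≥2}})` is the box `∏ 2kM_v ℤ` (`lattice_eq`). The inverse of `S` is, up to
sign, the Schur complement of the leaves in the linking matrix (`Rmat`). Hence the Gaussian weight
is the product of a function of `μ` modulo `2k` (`edgeWeight`) and of one factor for each leaf
(`gaussWeight_eq_mul`).

*The constant `C`* is `(-1)^{|V_1|}` divided by the quadratic Gauss sum `𝒢` of the weights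
`e(-ᵗμ S⁻¹ μ / 4k)` (`prefactor_mul_qsum`). Here `|𝒢|²` is the index of the lattice by orthogonality
of characters (`qsum_gaussWeight_mul_conj`), and the phase of `𝒢` is given by Milgram's formula
(`exists_pos_qsum_gaussFun`). The latter is reduced by a rational diagonalisation to rank one, where
it follows by comparing the asymptotics of the two sides of the theta transformation at a cusp
(`gauss_sum_one_dim`).

*The series.* Completing the square in `𝒢` expands `e(Q(n + α) / k)` into characters of `n + α`
(`e_Q_mul_qsum`). The sum over `n` becomes a product of geometric series and the signed sum over
`α ∈ 𝒮` a product of differences of exponentials; these are the factors `G_v`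
(`sum_calSv_exp_mul`, `hasSum_term_mul_qsum`, `seriesF_eq_ratF`).

*Orders.* Fix the class `b` of `μ` modulo `2k`. What remains of the sum over `μ` factorises over the
vertices and, by the Chinese remainder theorem, over the leaves (`qsum_gaussWeight_mul_prod`,
`localSum_vertexFactor`), so that `F(f₁; t) = C ∑_b edgeWeight(b) ∏_v localK(b_v, t_v)` (`ratF_eq`).
For `k ∤ b_v` the local function at `v` is holomorphic at `0`. For `k ∣ b_v` the contribution of
each leaf vanishes at `0`, being odd in `b_v` there, whence the order is at least `|v̄| + 2 - deg v`
(`localK_eq_zpow_mul`, `meromorphicOrderAt_ratF`).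

*The value at `0`.* If these bounds are positive, the terms with `k ∣ b_v` vanish at `t = 0` for
each `v` of degree at least three. They also vanish if `v` has degree two and a leaf. If `v` has degree
two and no leaf, they cancel: changing the signs of `b` on one of the two branches of the tree at
`v` preserves `edgeWeight` and multiplies the product of local functions by `-1`
(`qsum_edgeWeight_mul_localK_eq`, `prod_branch_sign`). What is left is the sum over
`(ℤ ∖ kℤ)^{V_{≥2}}` (`exists_analyticAt_ratF`).

*The coefficients.* The numbers `-𝔹_{m,n}(a, b)` are the Laurent coefficients, in `-s`, of
`∑_r (b + r)^m exp(-s (a + b + r))` (`exists_hasLaurent_bbB`). So `c_n` is the sum over `μ` above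
with each factor `G_v`, `deg v ≥ 3`, replaced by its Laurent coefficient of degree `n_v`
(`hasLaurent_vertexFactor`, `coeff_mul_qsum`), and it reduces modulo `2k` in the same way. The
resulting local coefficients are the Laurent coefficients of `localK`, which has a removable
singularity. They vanish in negative degree, and in degree `0` they are the values of `localK` at
`0` (`localSum_vertexCoeff`).
-/

set_option linter.unusedSectionVars false

noncomputable section

namespace Plumbing

/-! ### The one-dimensional quadratic Gauss sum -/

theorem e_add (x y : ℂ) : e (x + y) = e x * e y := by
  simp only [e, mul_add, Complex.exp_add]

theorem e_zero : e 0 = 1 := by simp [e]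

theorem e_int (n : ℤ) : e n = 1 := by
  rw [e, Complex.exp_eq_one_iff]
  exact ⟨n, by ring⟩

theorem e_neg (x : ℂ) : e (-x) = (e x)⁻¹ := by
  simp only [e, mul_neg, Complex.exp_neg]

theorem e_ne_zero (x : ℂ) : e x ≠ 0 := Complex.exp_ne_zero _

theorem e_add_int (x : ℂ) (n : ℤ) : e (x + n) = e x := by
  rw [e_add, e_int, mul_one]

theorem e_zpow (x : ℂ) (n : ℤ) : e x ^ n = e (n * x) := by
  rw [e, e, ← Complex.exp_int_mul]; congr 1; ring

theorem e_sum {ι : Type*} (s : Finset ι) (f : ι → ℂ) : e (∑ i ∈ s, f i) = ∏ i ∈ s, e (f i) := by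
  simp only [e, Finset.mul_sum, Complex.exp_sum]

theorem e_eq_one_iff (q : ℚ) : e (q : ℂ) = 1 ↔ ∃ n : ℤ, q = n := by
  rw [e, Complex.exp_eq_one_iff]
  have h : (2 * (Real.pi : ℂ) * I) ≠ 0 := Complex.two_pi_I_ne_zero
  refine exists_congr fun n => ⟨fun hn => ?_, fun hn => by rw [hn]; push_cast; ring⟩
  have : (q : ℂ) = n := mul_left_cancel₀ h (by rw [hn]; ring)
  exact_mod_cast this

theorem norm_e_ratCast (q : ℚ) : ‖e (q : ℂ)‖ = 1 := by
  rw [e, show 2 * (Real.pi : ℂ) * I * q = ((2 * Real.pi * q : ℝ) : ℂ) * I by push_cast; ring]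
  exact Complex.norm_exp_ofReal_mul_I _

/-- The majorant for the Gaussian sums over `ℤ`. -/
theorem summable_exp_neg_pi_mul_int_sq :
    Summable fun n : ℤ => Real.exp (-Real.pi * (n : ℝ) ^ 2) := by
  have h := (summable_jacobiTheta₂_term_iff 0 I).2 (by simp)
  refine h.norm.congr fun n => ?_
  rw [norm_jacobiTheta₂_term]
  simp

/-- A Gaussian sum over `ℤ` is dominated by its central term as the exponent grows. -/
theorem tendsto_tsum_gaussian {α : Type*} {l : Filter α} (A : α → ℂ)
    (hA : Tendsto (fun x => (A x).re) l atTop) (y : ℝ) :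
    Tendsto (fun x => ∑' n : ℤ,
      cexp (-Real.pi * A x * (n : ℂ) ^ 2 + 2 * Real.pi * (I * y) * n)) l (𝓝 1) := by
  have h1 : (1 : ℂ) = ∑' n : ℤ, if n = 0 then (1 : ℂ) else 0 := by
    rw [tsum_ite_eq]
  rw [h1]
  have hnorm : ∀ (x : α) (n : ℤ), ‖cexp (-Real.pi * A x * (n : ℂ) ^ 2 +
      2 * Real.pi * (I * y) * n)‖ = Real.exp (-Real.pi * (A x).re * (n : ℝ) ^ 2) := by
    intro x n
    rw [Complex.norm_exp]
    congr 1
    have : (n : ℂ) ^ 2 = (((n : ℝ) ^ 2 : ℝ) : ℂ) := by push_cast; rfl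
    rw [this]
    simp [-ofReal_pow]
  refine tendsto_tsum_of_dominated_convergence summable_exp_neg_pi_mul_int_sq ?_ ?_
  · intro n
    by_cases hn : n = 0
    · simpa [hn] using tendsto_const_nhds
    · rw [if_neg hn, tendsto_zero_iff_norm_tendsto_zero]
      simp only [hnorm]
      refine Real.tendsto_exp_atBot.comp ?_
      have hn2 : 0 < (n : ℝ) ^ 2 := by positivity
      have : Tendsto (fun x => (Real.pi * (n : ℝ) ^ 2) * (A x).re) l atTop :=
        hA.const_mul_atTop (by positivity)
      refine (tendsto_neg_atTop_atBot.comp this).congr fun x => ?_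
      simp only [Function.comp]; ring
  · filter_upwards [hA.eventually_ge_atTop 1] with x hx n
    rw [hnorm]
    apply Real.exp_le_exp.2
    have : 0 ≤ Real.pi * (n : ℝ) ^ 2 := by positivity
    nlinarith

/-- Splitting a sum over `ℤ` into the residue classes modulo `N`. -/
theorem tsum_int_eq_sum_residues {f : ℤ → ℂ} (hf : Summable f) (N : ℕ) (hN : 0 < N) :
    ∑' n, f n = ∑ μ ∈ Finset.range N, ∑' m : ℤ, f (N * m + μ) := by
  have : NeZero N := ⟨hN.ne'⟩
  have hE : ∀ p : ℤ × Fin N, (Int.divModEquiv N).symm p = N * p.1 + p.2 := by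
    intro p
    simp [Int.divModEquiv, mul_comm]
  rw [← (Int.divModEquiv N).symm.tsum_eq f, ← (Equiv.prodComm _ _).tsum_eq, Summable.tsum_prod,
    tsum_fintype, ← Fin.sum_univ_eq_sum_range (fun μ => ∑' m : ℤ, f (N * m + μ))]
  · simp [hE]
  · exact (Equiv.summable_iff (Equiv.prodComm (Fin N) ℤ)).2
      ((Equiv.summable_iff (Int.divModEquiv N).symm).2 hf)

theorem ofReal_mul_cpow_half {r : ℝ} (hr : 0 < r) {x : ℂ} (hx : x ≠ 0) :
    ((r : ℂ) * x) ^ (1 / 2 : ℂ) = (Real.sqrt r : ℂ) * x ^ (1 / 2 : ℂ) := by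
  rw [Complex.cpow_def_of_ne_zero (mul_ne_zero (ofReal_ne_zero.2 hr.ne') hx),
    Complex.cpow_def_of_ne_zero hx, Complex.log_ofReal_mul hr hx, add_mul, Complex.exp_add,
    Real.sqrt_eq_rpow, Complex.ofReal_cpow hr.le, Complex.cpow_def_of_ne_zero
    (ofReal_ne_zero.2 hr.ne'), Complex.ofReal_log hr.le]
  simp

theorem summable_gaussian {a : ℂ} (ha : 0 < a.re) :
    Summable fun n : ℤ => cexp (-Real.pi * a * (n : ℂ) ^ 2) := by
  have h := (summable_jacobiTheta₂_term_iff 0 (I * a)).2 (by simpa using ha)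
  refine h.congr fun n => ?_
  rw [jacobiTheta₂_term]
  congr 1
  linear_combination Real.pi * (n : ℂ) ^ 2 * a * I_sq

/-- A Gaussian sum over a residue class grows like the Gaussian integral. -/
theorem tendsto_sqrt_mul_tsum_residue (N : ℕ) (hN : 0 < N) (μ : ℕ) :
    Tendsto (fun ε : ℝ => (Real.sqrt ε : ℂ) *
      ∑' m : ℤ, cexp (-Real.pi * ε * ((N * m + μ : ℤ) : ℂ) ^ 2)) (𝓝[>] 0) (𝓝 (1 / N)) := by
  have hN' : (N : ℂ) ≠ 0 := by exact_mod_cast hN.ne'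
  have hA : Tendsto (fun ε : ℝ => ((((ε * N ^ 2)⁻¹ : ℝ)) : ℂ).re) (𝓝[>] 0) atTop := by
    simp only [ofReal_re]
    refine Tendsto.inv_tendsto_nhdsGT_zero ?_
    refine tendsto_nhdsWithin_iff.2 ⟨?_, ?_⟩
    · have : Tendsto (fun ε : ℝ => ε * (N : ℝ) ^ 2) (𝓝 0) (𝓝 (0 * (N : ℝ) ^ 2)) :=
        tendsto_id.mul_const _
      rw [zero_mul] at this
      exact this.mono_left nhdsWithin_le_nhds
    · filter_upwards [self_mem_nhdsWithin] with ε hε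
      have : 0 < ε := hε
      simp only [Set.mem_Ioi]; positivity
  have h1 := (tendsto_tsum_gaussian _ hA (-(μ / N : ℝ))).const_mul (1 / (N : ℂ))
  rw [mul_one] at h1
  refine h1.congr' ?_
  filter_upwards [self_mem_nhdsWithin] with ε hε
  have hε : 0 < ε := hε
  have hε' : (ε : ℂ) ≠ 0 := ofReal_ne_zero.2 hε.ne'
  have hpos : 0 < (ε * N ^ 2)⁻¹ := by positivity
  rw [Complex.tsum_exp_neg_quadratic (by rw [ofReal_re]; exact hpos), ← mul_assoc, ← mul_assoc]
  congr 1
  · have : (((ε * N ^ 2)⁻¹ : ℝ) : ℂ) ^ (1 / 2 : ℂ) = ((Real.sqrt ((ε * N ^ 2)⁻¹) : ℝ) : ℂ) := by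
      have := ofReal_mul_cpow_half hpos one_ne_zero
      simpa using this
    rw [this, Real.sqrt_inv, Real.sqrt_mul hε.le, Real.sqrt_sq (by positivity)]
    have : (Real.sqrt ε : ℂ) ≠ 0 := ofReal_ne_zero.2 (Real.sqrt_pos.2 hε).ne'
    push_cast
    field_simp
  · refine tsum_congr fun m => ?_
    rw [ofReal_neg, ofReal_div, ofReal_natCast, ofReal_natCast]
    congr 1
    have hI : (m : ℂ) + I * I * -(μ / N) = m + μ / N := by linear_combination (-(μ / N : ℂ)) * I_sq
    rw [hI]
    push_cast
    field_simp

/-- The quadratic Gauss sum `∑ e(-μ² / 4a)` over a full period, up to a positive factor. -/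
theorem gauss_sum_one_dim (a : ℕ) (ha : 0 < a) (N : ℕ) (hN : 0 < N) (haN : 2 * a ∣ N) :
    ∃ c : ℝ, 0 < c ∧
      ∑ μ ∈ Finset.range N, e (-((μ : ℂ) ^ 2 / (4 * a))) = c * e (-1 / 8) := by
  have ha' : (a : ℂ) ≠ 0 := by exact_mod_cast ha.ne'
  have hN' : (N : ℂ) ≠ 0 := by exact_mod_cast hN.ne'
  -- the theta value at `-1 / 2a + i ε`, multiplied by `√ε`
  set Θ : ℝ → ℂ := fun ε => (Real.sqrt ε : ℂ) *
    ∑' n : ℤ, cexp (-Real.pi * (ε + I / (2 * a)) * (n : ℂ) ^ 2) with hΘ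
  have hL : Tendsto Θ (𝓝[>] 0)
      (𝓝 (∑ μ ∈ Finset.range N, e (-((μ : ℂ) ^ 2 / (4 * a))) * (1 / N))) := by
    have := tendsto_finsetSum (Finset.range N) fun μ _ =>
      (tendsto_sqrt_mul_tsum_residue N hN μ).const_mul (e (-((μ : ℂ) ^ 2 / (4 * a))))
    refine this.congr' ?_
    filter_upwards [self_mem_nhdsWithin] with ε hε
    have hε : 0 < ε := hε
    have hs : Summable fun n : ℤ => cexp (-Real.pi * (ε + I / (2 * a)) * (n : ℂ) ^ 2) := by
      refine summable_gaussian ?_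
      have : (I / (2 * a : ℂ)).re = 0 := by
        rw [show I / (2 * a : ℂ) = ((1 / (2 * a) : ℝ) : ℂ) * I by push_cast; ring]
        simp
      simp [this, hε]
    simp only [hΘ]
    rw [tsum_int_eq_sum_residues hs N hN, Finset.mul_sum]
    refine Finset.sum_congr rfl fun μ _ => ?_
    rw [mul_left_comm, ← tsum_mul_left]
    congr 1
    refine tsum_congr fun m => ?_
    obtain ⟨d, rfl⟩ := haN
    -- modulo integers, the quadratic phase depends only on the residue class
    have : e (-((μ : ℂ) ^ 2 / (4 * a))) =
        e (-((μ : ℂ) ^ 2 / (4 * a)) + ((-(a * d ^ 2 * m ^ 2 + d * m * μ) : ℤ) : ℂ)) :=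
      (e_add_int _ _).symm
    rw [this, e, ← Complex.exp_add]
    congr 1
    push_cast
    field_simp
    ring
  have hR : Tendsto Θ (𝓝[>] 0) (𝓝 (1 / (I / (2 * a)) ^ (1 / 2 : ℂ) * (1 / (2 * a)))) := by
    have hre0 : (I / (2 * a : ℂ)).re = 0 := by
      rw [show I / (2 * a : ℂ) = ((1 / (2 * a) : ℝ) : ℂ) * I by push_cast; ring]
      simp
    have hne : ∀ ε : ℝ, (1 - 2 * a * I * ε : ℂ) ≠ 0 := by
      intro ε h
      have := congrArg Complex.re h
      simp at this
    set x : ℝ → ℂ := fun ε => 4 * a ^ 2 / (1 - 2 * a * I * ε) with hx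
    have hx0 : ∀ ε, x ε ≠ 0 := fun ε => div_ne_zero (by simp [ha']) (hne ε)
    have hval : ∀ ε : ℝ, 0 < ε → Θ ε = 1 / (ε + I / (2 * a)) ^ (1 / 2 : ℂ) *
        (1 / x ε ^ (1 / 2 : ℂ) * ∑' n : ℤ, cexp (-Real.pi * (1 / (ε * x ε)) * (n : ℂ) ^ 2 +
          2 * Real.pi * (I * (0 : ℝ)) * n)) := by
      intro ε hε
      have hα : 0 < ((ε : ℂ) + I / (2 * a)).re := by simp [hre0, hε]
      have hα0 : (ε : ℂ) + I / (2 * a) ≠ 0 := fun h => by rw [h] at hα; simp at hα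
      have hβ : 0 < ((ε : ℂ) * x ε).re := by
        rw [Complex.re_ofReal_mul]
        refine mul_pos hε ?_
        change 0 < (4 * a ^ 2 / (1 - 2 * a * I * ε) : ℂ).re
        rw [div_eq_mul_inv, show (4 * a ^ 2 : ℂ) = ((4 * a ^ 2 : ℝ) : ℂ) by push_cast; ring,
          Complex.re_ofReal_mul, Complex.inv_re]
        refine mul_pos (by positivity) (div_pos (by simp) (Complex.normSq_pos.2 (hne ε)))
      have e1 := Complex.tsum_exp_neg_quadratic hα 0
      have e2 := Complex.tsum_exp_neg_quadratic hβ 0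
      have hsq : (Real.sqrt ε : ℂ) ≠ 0 := ofReal_ne_zero.2 (Real.sqrt_pos.2 hε).ne'
      simp only [mul_zero, zero_mul, add_zero, ofReal_zero] at e1 e2 ⊢
      -- the inverse of `ε + i / 2a` differs from `ε x` by an even imaginary integer
      have e3 : ∑' n : ℤ, cexp (-Real.pi / (ε + I / (2 * a)) * (n : ℂ) ^ 2) =
          ∑' n : ℤ, cexp (-Real.pi * (ε * x ε) * (n : ℂ) ^ 2) := by
        refine tsum_congr fun n => ?_
        rw [Complex.exp_eq_exp_iff_exists_int]
        refine ⟨a * n ^ 2, ?_⟩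
        have hxm : x ε * (1 - 2 * a * I * ε) = 4 * a ^ 2 := div_mul_cancel₀ _ (hne ε)
        have hinv : ((ε : ℂ) + I / (2 * a))⁻¹ = ε * x ε - 2 * a * I := by
          have h2 : I / (2 * a : ℂ) * (2 * a) = I := div_mul_cancel₀ _ (by simp [ha'])
          have h3 : (ε : ℂ) = -(I / (2 * a)) * (2 * a * I * ε) := by
            linear_combination (I * ε) * h2 + ε * I_sq
          refine inv_eq_of_mul_eq_one_right ?_
          linear_combination (ε * x ε) * h3 + (ε * (I / (2 * a))) * hxm - I_sq +
            (2 * a * ε - I) * h2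
        rw [div_eq_mul_inv, hinv]
        push_cast
        ring
      simp only [hΘ]
      rw [e1, e3, e2, ofReal_mul_cpow_half hε (hx0 ε)]
      have hxc : x ε ^ (1 / 2 : ℂ) ≠ 0 := by simp [Complex.cpow_eq_zero_iff, hx0 ε]
      have hac : ((ε : ℂ) + I / (2 * a)) ^ (1 / 2 : ℂ) ≠ 0 := by
        simp [Complex.cpow_eq_zero_iff, hα0]
      have e4 : ∑' n : ℤ, cexp (-Real.pi / (ε * x ε) * (n : ℂ) ^ 2) =
          ∑' n : ℤ, cexp (-Real.pi * (1 / (ε * x ε)) * (n : ℂ) ^ 2) := by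
        refine tsum_congr fun n => ?_
        rw [mul_one_div]
      rw [e4]
      field_simp
    have hxl : Tendsto x (𝓝[>] 0) (𝓝 (4 * a ^ 2)) := by
      have hc : ContinuousAt x 0 := by
        simp only [hx]
        refine ContinuousAt.div continuousAt_const (by fun_prop) (hne 0)
      have : Tendsto x (𝓝 0) (𝓝 (x 0)) := hc
      simp only [hx, ofReal_zero, mul_zero, sub_zero, div_one] at this
      exact this.mono_left nhdsWithin_le_nhds
    have h1 : Tendsto (fun ε : ℝ => 1 / ((ε : ℂ) + I / (2 * a)) ^ (1 / 2 : ℂ)) (𝓝[>] 0)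
        (𝓝 (1 / (I / (2 * a)) ^ (1 / 2 : ℂ))) := by
      have h0 : (I / (2 * a : ℂ)) ≠ 0 := by simp [ha']
      refine Tendsto.div tendsto_const_nhds ?_ (by simp [Complex.cpow_eq_zero_iff, ha'])
      have hs : (I / (2 * a : ℂ)) ∈ slitPlane := by
        refine Or.inr ?_
        rw [show I / (2 * a : ℂ) = ((1 / (2 * a) : ℝ) : ℂ) * I by push_cast; ring]
        simp [ha.ne']
      have hc := (continuousAt_cpow_const (b := (1 / 2 : ℂ)) hs).tendsto
      refine hc.comp ?_
      have : Tendsto (fun ε : ℝ => (ε : ℂ) + I / (2 * a)) (𝓝 0) (𝓝 ((0 : ℝ) + I / (2 * a))) :=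
        (Complex.continuous_ofReal.tendsto 0).add_const _
      rw [ofReal_zero, zero_add] at this
      exact this.mono_left nhdsWithin_le_nhds
    have h2 : Tendsto (fun ε : ℝ => 1 / x ε ^ (1 / 2 : ℂ)) (𝓝[>] 0) (𝓝 (1 / (2 * a))) := by
      have hp : (0 : ℝ) < 4 * a ^ 2 := by positivity
      have hsq : Real.sqrt (4 * a ^ 2) = 2 * a := by
        rw [show (4 : ℝ) * a ^ 2 = (2 * a) ^ 2 by ring, Real.sqrt_sq (by positivity)]
      have h4 : (4 * a ^ 2 : ℂ) ^ (1 / 2 : ℂ) = 2 * a := by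
        have := ofReal_mul_cpow_half hp one_ne_zero
        rw [hsq] at this
        simpa using this
      have hs : (4 * a ^ 2 : ℂ) ∈ slitPlane := by
        rw [show (4 * a ^ 2 : ℂ) = ((4 * a ^ 2 : ℝ) : ℂ) by push_cast; ring]
        exact Complex.ofReal_mem_slitPlane.2 hp
      have hc := (continuousAt_cpow_const (b := (1 / 2 : ℂ)) hs).tendsto.comp hxl
      rw [h4] at hc
      exact tendsto_const_nhds.div hc (by simp [ha'])
    have h3 := tendsto_tsum_gaussian (l := 𝓝[>] (0 : ℝ)) (fun ε : ℝ => 1 / (ε * x ε)) (by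
      have : (fun ε : ℝ => (1 / ((ε : ℂ) * x ε)).re) =ᶠ[𝓝[>] 0]
          fun ε => ε⁻¹ * (1 / (4 * a ^ 2)) := by
        filter_upwards [self_mem_nhdsWithin] with ε hε
        have hε : 0 < ε := hε
        have hε' : (ε : ℂ) ≠ 0 := ofReal_ne_zero.2 hε.ne'
        have : 1 / ((ε : ℂ) * x ε) = ((ε⁻¹ * (1 / (4 * a ^ 2)) : ℝ) : ℂ) -
            ((1 / (2 * a) : ℝ) : ℂ) * I := by
          simp only [hx]
          have := hne ε
          push_cast
          field_simp
          ring
        rw [this]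
        simp [-ofReal_inv, -ofReal_mul, -ofReal_div]
      refine Tendsto.congr' this.symm ?_
      exact tendsto_inv_nhdsGT_zero.atTop_mul_const (by positivity)) 0
    have := h1.mul (h2.mul h3)
    rw [mul_one] at this
    refine this.congr' ?_
    filter_upwards [self_mem_nhdsWithin] with ε hε
    exact (hval ε hε).symm
  have hu := tendsto_nhds_unique hL hR
  rw [← Finset.sum_mul] at hu
  refine ⟨N * (Real.sqrt (2 * a) / (2 * a)), by positivity, ?_⟩
  have h8 : (I / (2 * a : ℂ)) ^ (1 / 2 : ℂ) = (Real.sqrt (1 / (2 * a)) : ℂ) * e (1 / 8) := by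
    rw [show I / (2 * a : ℂ) = ((1 / (2 * a) : ℝ) : ℂ) * I by push_cast; ring,
      ofReal_mul_cpow_half (by positivity) I_ne_zero, Complex.cpow_def_of_ne_zero I_ne_zero,
      Complex.log_I, e]
    congr 2; ring
  have hs : (Real.sqrt (2 * a) : ℂ) ≠ 0 := ofReal_ne_zero.2 (Real.sqrt_pos.2 (by positivity)).ne'
  rw [h8, Real.sqrt_div zero_le_one, Real.sqrt_one] at hu
  rw [neg_div, e_neg]
  have he := e_ne_zero (1 / 8)
  push_cast at hu ⊢
  field_simp at hu ⊢
  linear_combination hu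

/-! ### Sums over quotients of abelian groups -/

section QuotientSums

variable {A : Type*} [AddCommGroup A]

/-- The sum of `f` over representatives of the cosets of `Λ`. -/
def qsum (Λ : AddSubgroup A) (f : A → ℂ) : ℂ := ∑ᶠ x : A ⧸ Λ, f x.out

/-- `f` is invariant under translation by `Λ`. -/
def IsPeriodic (Λ : AddSubgroup A) (f : A → ℂ) : Prop := ∀ x, ∀ h ∈ Λ, f (x + h) = f x

variable {Λ : AddSubgroup A} {f : A → ℂ}

theorem IsPeriodic.out (hf : IsPeriodic Λ f) (x : A) :
    f (QuotientAddGroup.mk x : A ⧸ Λ).out = f x := by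
  obtain ⟨h, hh⟩ := QuotientAddGroup.mk_out_eq_add Λ x
  rw [hh]
  exact hf x h h.2

theorem qsum_congr {f g : A → ℂ} (h : ∀ x, f x = g x) : qsum Λ f = qsum Λ g := by
  simp only [qsum, h]

theorem qsum_eq_sum [Fintype (A ⧸ Λ)] (f : A → ℂ) : qsum Λ f = ∑ x : A ⧸ Λ, f x.out :=
  finsum_eq_sum_of_fintype _

theorem qsum_add_right [Finite (A ⧸ Λ)] (hf : IsPeriodic Λ f) (c : A) :
    qsum Λ (fun x => f (x + c)) = qsum Λ f := by
  have := Fintype.ofFinite (A ⧸ Λ)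
  rw [qsum_eq_sum, qsum_eq_sum]
  refine Fintype.sum_equiv (Equiv.addRight (c : A ⧸ Λ)) _ _ fun x => ?_
  rw [← hf.out (x.out + c)]
  simp

theorem qsum_mul_left [Finite (A ⧸ Λ)] (c : ℂ) (f : A → ℂ) :
    qsum Λ (fun x => c * f x) = c * qsum Λ f := by
  have := Fintype.ofFinite (A ⧸ Λ)
  rw [qsum_eq_sum, qsum_eq_sum, Finset.mul_sum]

theorem qsum_sum [Finite (A ⧸ Λ)] {κ : Type*} (s : Finset κ) (f : κ → A → ℂ) :
    qsum Λ (fun x => ∑ i ∈ s, f i x) = ∑ i ∈ s, qsum Λ (f i) := by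
  have := Fintype.ofFinite (A ⧸ Λ)
  simp only [qsum_eq_sum]
  exact Finset.sum_comm

theorem qsum_const [Finite (A ⧸ Λ)] (c : ℂ) :
    qsum Λ (fun _ => c) = Nat.card (A ⧸ Λ) * c := by
  have := Fintype.ofFinite (A ⧸ Λ)
  rw [qsum_eq_sum, Finset.sum_const, Finset.card_univ, Nat.card_eq_fintype_card, nsmul_eq_mul]

/-- A function multiplied by a constant `≠ 1` under some translation sums to zero. -/
theorem qsum_eq_zero [Finite (A ⧸ Λ)] (hf : IsPeriodic Λ f) {c : A} {ζ : ℂ} (hζ : ζ ≠ 1)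
    (h : ∀ x, f (x + c) = ζ * f x) : qsum Λ f = 0 := by
  have h1 := qsum_add_right hf c
  rw [qsum_congr h, qsum_mul_left] at h1
  have : (ζ - 1) * qsum Λ f = 0 := by linear_combination h1
  exact (mul_eq_zero.1 this).resolve_left (sub_ne_zero.2 hζ)

/-- Summing over the image of a homomorphism: all fibres have the same size. -/
theorem qsum_comp_hom {Λ' : AddSubgroup A} [Finite (A ⧸ Λ)] [Finite (A ⧸ Λ')]
    (φ : A →+ A) (hφ : Λ ≤ Λ'.comap φ) (hf : IsPeriodic Λ' f) (hr : Λ' ≤ φ.range)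
    [DecidablePred (· ∈ φ.range)] :
    ∃ c : ℕ, 0 < c ∧ qsum Λ (fun x => f (φ x)) =
      c * qsum Λ' (fun y => if y ∈ φ.range then f y else 0) := by
  classical
  have := Fintype.ofFinite (A ⧸ Λ)
  have := Fintype.ofFinite (A ⧸ Λ')
  set ψ := QuotientAddGroup.map Λ Λ' φ hφ with hψ
  refine ⟨(Finset.univ.filter fun x => ψ x = 0).card, ?_, ?_⟩
  · exact Finset.card_pos.2 ⟨0, by simp⟩
  · rw [qsum_eq_sum, qsum_eq_sum, Finset.mul_sum]
    have h1 : ∀ x : A ⧸ Λ, f (φ x.out) = f (ψ x).out := by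
      intro x
      conv_rhs => rw [← QuotientAddGroup.out_eq' x]
      rw [hψ, QuotientAddGroup.map_mk, hf.out]
    simp only [h1]
    rw [← Finset.sum_fiberwise_of_maps_to (s := Finset.univ) (t := Finset.univ) (g := ψ)
      (fun x _ => Finset.mem_univ _)]
    refine Finset.sum_congr rfl fun y _ => ?_
    rw [Finset.sum_congr rfl (g := fun _ => f y.out) (fun x hx => by
      rw [(Finset.mem_filter.1 hx).2]), Finset.sum_const, nsmul_eq_mul]
    by_cases hy : y.out ∈ φ.range
    · rw [if_pos hy]
      congr 2
      obtain ⟨x, hx⟩ := hy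
      refine AddMonoidHom.card_fiber_eq_of_mem_range ψ ⟨x, ?_⟩ ⟨0, map_zero _⟩
      rw [hψ, QuotientAddGroup.map_mk, hx, QuotientAddGroup.out_eq']
    · rw [if_neg hy, mul_zero, Finset.filter_eq_empty_iff.2, Finset.card_empty]
      · simp
      · intro x _ hx
        apply hy
        have : (QuotientAddGroup.mk (φ x.out) : A ⧸ Λ') = QuotientAddGroup.mk y.out := by
          rw [QuotientAddGroup.out_eq', ← hx, hψ]
          conv_rhs => rw [← QuotientAddGroup.out_eq' x]
          rw [QuotientAddGroup.map_mk]
        have h2 := hr (QuotientAddGroup.eq.1 this)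
        have h3 := φ.range.add_mem ⟨x.out, rfl⟩ h2
        simpa using h3

end QuotientSums

/-! ### Quotients by products of cyclic lattices -/

section Box

variable {ι : Type*}

/-- The lattice `∏ m_i ℤ`. -/
def boxLattice (m : ι → ℤ) : AddSubgroup (ι → ℤ) where
  carrier := {x | ∀ i, m i ∣ x i}
  zero_mem' := fun _ => dvd_zero _
  add_mem' := fun ha hb i => dvd_add (ha i) (hb i)
  neg_mem' := fun ha i => (dvd_neg).2 (ha i)

theorem mem_boxLattice {m : ι → ℤ} {x : ι → ℤ} : x ∈ boxLattice m ↔ ∀ i, m i ∣ x i := Iff.rfl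

/-- The remainders `0 ≤ x_i < |m_i|` represent the cosets of the box `∏ m_i ℤ`. -/
theorem boxLattice_bijective {m : ι → ℤ} (hm : ∀ i, m i ≠ 0) :
    Function.Bijective (fun x : (∀ i, Fin (m i).natAbs) =>
      (QuotientAddGroup.mk (fun i => ((x i : ℕ) : ℤ)) : (ι → ℤ) ⧸ boxLattice m)) := by
  constructor
  · intro x y hxy
    have h := QuotientAddGroup.eq.1 hxy
    funext i
    have hi : m i ∣ -((x i : ℕ) : ℤ) + (y i : ℕ) := h i
    rw [← Int.natAbs_dvd] at hi
    have h1 := (x i).2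
    have h2 := (y i).2
    have h3 : ((y i : ℕ) : ℤ) - (x i : ℕ) = 0 := by
      refine Int.eq_zero_of_abs_lt_dvd (by convert hi using 1; ring) ?_
      rw [abs_lt]; constructor <;> omega
    apply Fin.ext; omega
  · intro y
    induction y using QuotientAddGroup.induction_on with
    | H z =>
      refine ⟨fun i => ⟨(z i % m i).toNat, ?_⟩, ?_⟩
      · have h1 := Int.emod_nonneg (z i) (hm i)
        have h2 := Int.emod_lt_abs (z i) (hm i)
        rw [Int.abs_eq_natAbs] at h2
        omega
      · refine QuotientAddGroup.eq.2 fun i => ?_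
        have h1 := Int.emod_nonneg (z i) (hm i)
        have h2 : z i = m i * (z i / m i) + z i % m i := (Int.mul_ediv_add_emod _ _).symm
        simp only [Pi.add_apply, Pi.neg_apply, Int.toNat_of_nonneg h1]
        exact ⟨z i / m i, by linarith⟩

theorem finite_quotient_boxLattice [Finite ι] {m : ι → ℤ} (hm : ∀ i, m i ≠ 0) :
    Finite ((ι → ℤ) ⧸ boxLattice m) :=
  Finite.of_surjective _ (boxLattice_bijective hm).2

variable [Fintype ι]

theorem card_quotient_boxLattice {m : ι → ℤ} (hm : ∀ i, m i ≠ 0) :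
    Nat.card ((ι → ℤ) ⧸ boxLattice m) = ∏ i, (m i).natAbs := by
  rw [← Nat.card_congr (Equiv.ofBijective _ (boxLattice_bijective hm)), Nat.card_pi]
  simp

variable [DecidableEq ι]

theorem qsum_boxLattice {m : ι → ℤ} (hm : ∀ i, m i ≠ 0) {f : (ι → ℤ) → ℂ}
    (hf : IsPeriodic (boxLattice m) f) :
    qsum (boxLattice m) f = ∑ x : (∀ i, Fin (m i).natAbs), f fun i => ((x i : ℕ) : ℤ) := by
  have := finite_quotient_boxLattice hm
  have := Fintype.ofFinite ((ι → ℤ) ⧸ boxLattice m)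
  rw [qsum_eq_sum]
  exact (Fintype.sum_bijective _ (boxLattice_bijective hm)
    (fun x => f fun i => ((x i : ℕ) : ℤ)) _ fun x => (hf.out _).symm).symm

/-- A sum of a product over a box is the product of the sums. -/
theorem sum_pi_fin_prod (n : ι → ℕ) (g : ι → ℕ → ℂ) :
    ∑ x : (∀ i, Fin (n i)), ∏ i, g i (x i) = ∏ i, ∑ j ∈ Finset.range (n i), g i j := by
  have h := (Fintype.prod_sum (fun i (j : Fin (n i)) => g i j)).symm
  rw [h]
  exact Finset.prod_congr rfl fun i _ => Fin.sum_univ_eq_sum_range (g i) (n i)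

end Box

/-! ### Milgram's formula for positive definite even forms -/

section Milgram

variable {ι : Type*} [Fintype ι]

/-- An integer vector seen as a rational one. -/
def castV {ι : Type*} (x : ι → ℤ) : ι → ℚ := fun i => (x i : ℚ)

theorem castV_add {ι : Type*} (x y : ι → ℤ) : castV (x + y) = castV x + castV y := by
  funext i; simp [castV]

theorem castV_smul {ι : Type*} (n : ℤ) (x : ι → ℤ) : castV (n • x) = (n : ℚ) • castV x := by
  funext i; simp [castV]

theorem castV_mulVec {κ : Type*} (T : Matrix κ ι ℤ) (x : ι → ℤ) :
    castV (T.mulVec x) = (T.map (Int.cast : ℤ → ℚ)).mulVec (castV x) := by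
  funext i; simp [castV, Matrix.mulVec, dotProduct]

theorem dotProduct_castV (x y : ι → ℤ) : castV x ⬝ᵥ castV y = ((x ⬝ᵥ y : ℤ) : ℚ) := by
  simp [castV, dotProduct]

/-- The quadratic form of a matrix. -/
def qf (R : Matrix ι ι ℚ) (x : ι → ℚ) : ℚ := x ⬝ᵥ R.mulVec x

theorem qf_add {R : Matrix ι ι ℚ} (hR : R.IsSymm) (x y : ι → ℚ) :
    qf R (x + y) = qf R x + 2 * (x ⬝ᵥ R.mulVec y) + qf R y := by
  have h : y ⬝ᵥ R.mulVec x = x ⬝ᵥ R.mulVec y := by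
    rw [Matrix.dotProduct_mulVec, ← Matrix.mulVec_transpose, hR.eq, dotProduct_comm]
  simp only [qf, Matrix.mulVec_add, dotProduct_add, add_dotProduct, h]
  ring

theorem qf_mulVec {κ : Type*} [Fintype κ] (R : Matrix κ κ ℚ) (A : Matrix κ ι ℚ) (x : ι → ℚ) :
    qf R (A.mulVec x) = qf (A.transpose * R * A) x := by
  rw [qf, qf, Matrix.mulVec_mulVec, ← Matrix.vecMul_transpose, ← Matrix.dotProduct_mulVec,
    Matrix.mulVec_mulVec, Matrix.mul_assoc]

/-- A symmetric integer matrix is diagonalised over `ℚ` by an integer matrix. -/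
theorem exists_int_diagonalization [DecidableEq ι] (T : Matrix ι ι ℤ) (hT : T.IsSymm) :
    ∃ (A : Matrix ι ι ℤ) (d : ι → ℤ), A.det ≠ 0 ∧ A.transpose * T * A = Matrix.diagonal d := by
  set Tq := T.map (Int.cast : ℤ → ℚ) with hTq
  have hsymm : Tq.IsSymm := hT.map _
  have hB : LinearMap.IsSymm (Matrix.toBilin' Tq) := by
    refine ⟨fun x y => ?_⟩
    rw [Matrix.toBilin'_apply', Matrix.toBilin'_apply', Matrix.dotProduct_mulVec,
      ← Matrix.mulVec_transpose, hsymm.eq, dotProduct_comm]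
    rfl
  have : Invertible (2 : ℚ) := invertibleOfNonzero (by norm_num)
  obtain ⟨v0, hv0⟩ := LinearMap.BilinForm.exists_orthogonal_basis hB
  let eq : Fin (Module.finrank ℚ (ι → ℚ)) ≃ ι :=
    Fintype.equivOfCardEq (by simp)
  set v := v0.reindex eq with hv
  have hvo : ∀ i j, i ≠ j → Matrix.toBilin' Tq (v i) (v j) = 0 := by
    intro i j hij
    simp only [hv, Module.Basis.reindex_apply]
    exact hv0 (fun h => hij (eq.symm.injective h))
  have hint : ∀ j, ∃ (c : ℤ) (a : ι → ℤ), c ≠ 0 ∧ castV a = (c : ℚ) • v j := by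
    intro j
    obtain ⟨b, hb⟩ := IsLocalization.exist_integer_multiples_of_finite (nonZeroDivisors ℤ) (v j)
    choose a ha using hb
    refine ⟨b, a, nonZeroDivisors.ne_zero b.2, ?_⟩
    funext i
    have := ha i
    simpa [castV] using this
  choose c a hc ha using hint
  refine ⟨Matrix.of fun i j => a j i, fun j => a j ⬝ᵥ T.mulVec (a j), ?_, ?_⟩
  · have hli : LinearIndependent ℚ fun j => castV (a j) := by
      have := v.linearIndependent.units_smul fun j => Units.mk0 (c j : ℚ) (by exact_mod_cast hc j)
      convert! this using 1
      funext j
      rw [ha]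
      rfl
    have h1 : IsUnit (Matrix.of fun j i => ((a j i : ℤ) : ℚ)) :=
      Matrix.linearIndependent_rows_iff_isUnit.1 hli
    have h2 := (Matrix.isUnit_iff_isUnit_det _).1 h1
    intro h0
    have h3 : (Matrix.of fun j i => ((a j i : ℤ) : ℚ)) =
        ((Matrix.of fun i j => a j i : Matrix ι ι ℤ).map (Int.castRingHom ℚ)).transpose := by
      ext i j; simp
    rw [h3, Matrix.det_transpose, ← RingHom.mapMatrix_apply, ← RingHom.map_det, h0] at h2
    simp at h2
  · ext i j
    have h1 : ((Matrix.of fun i j => a j i).transpose * T * (Matrix.of fun i j => a j i)) i j =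
        a i ⬝ᵥ T.mulVec (a j) := by
      simp only [Matrix.mul_apply, dotProduct, Matrix.mulVec, Matrix.transpose_apply,
        Matrix.of_apply, Finset.sum_mul, Finset.mul_sum]
      rw [Finset.sum_comm]
      simp only [mul_assoc]
    rw [h1, Matrix.diagonal_apply]
    split_ifs with hij
    · rw [hij]
    · have h2 := hvo i j hij
      rw [Matrix.toBilin'_apply'] at h2
      have h3 : castV (a i) ⬝ᵥ Tq.mulVec (castV (a j)) = 0 := by
        rw [ha, ha, Matrix.mulVec_smul, dotProduct_smul, smul_dotProduct, h2, smul_zero, smul_zero]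
      rw [hTq, ← castV_mulVec, dotProduct_castV] at h3
      exact_mod_cast h3

/-- A common denominator for a matrix. -/
theorem exists_common_denominator (R : Matrix ι ι ℚ) :
    ∃ N : ℕ, 0 < N ∧ ∃ Z : Matrix ι ι ℤ, Z.map (Int.cast : ℤ → ℚ) = (N : ℚ) • R := by
  obtain ⟨b, hb⟩ := IsLocalization.exist_integer_multiples_of_finite (nonZeroDivisors ℤ)
    (fun p : ι × ι => R p.1 p.2)
  choose a ha using hb
  have hb0 : (b : ℤ) ≠ 0 := nonZeroDivisors.ne_zero b.2
  refine ⟨(b : ℤ).natAbs, Int.natAbs_pos.2 hb0, Matrix.of fun i j => (b : ℤ).sign * a (i, j), ?_⟩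
  ext i j
  have h := ha (i, j)
  simp only [algebraMap_int_eq, eq_intCast, zsmul_eq_mul] at h
  simp only [Matrix.map_apply, Matrix.of_apply, Int.cast_mul, h, Matrix.smul_apply, smul_eq_mul]
  rw [← mul_assoc, ← Int.cast_mul, Int.sign_mul_self]
  simp

/-- The Gaussian function `x ↦ e(-ᵗx R x / 2)`. -/
def gaussFun (R : Matrix ι ι ℚ) (x : ι → ℤ) : ℂ := e (((-(qf R (castV x)) / 2 : ℚ)) : ℂ)

theorem gaussFun_add {R : Matrix ι ι ℚ} (hR : R.IsSymm) (x y : ι → ℤ) :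
    gaussFun R (x + y) = gaussFun R x * e ((-(castV x ⬝ᵥ R.mulVec (castV y)) : ℚ) : ℂ) *
      gaussFun R y := by
  rw [gaussFun, gaussFun, gaussFun, ← e_add, ← e_add, castV_add, qf_add hR]
  congr 1
  push_cast
  ring

/-- If `N R` is integral and `N` is even, then `x ↦ e(-ᵗx R x / 2)` is periodic modulo `N`. -/
theorem gaussFun_periodic {R : Matrix ι ι ℚ} (hR : R.IsSymm) {N : ℕ} {Z : Matrix ι ι ℤ}
    (hZ : Z.map (Int.cast : ℤ → ℚ) = (N : ℚ) • R) (hN : 2 ∣ N) :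
    IsPeriodic (boxLattice fun _ => (N : ℤ)) (gaussFun R) := by
  intro x h hh
  choose y hy using hh
  have h1 : h = (N : ℤ) • y := by funext i; simpa using hy i
  obtain ⟨M, rfl⟩ := hN
  have h2 : R.mulVec (castV h) = castV (Z.mulVec y) := by
    rw [castV_mulVec, hZ, h1, castV_smul, Matrix.mulVec_smul, Matrix.smul_mulVec]
    simp
  have h3 : qf R (castV h) = ((2 * M * (y ⬝ᵥ Z.mulVec y) : ℤ) : ℚ) := by
    rw [qf, h2, dotProduct_castV, h1, smul_dotProduct]
    simp
  rw [gaussFun_add hR, h2, dotProduct_castV]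
  have h4 : gaussFun R h = 1 := by
    rw [gaussFun, h3, e_eq_one_iff]
    exact ⟨-(M * (y ⬝ᵥ Z.mulVec y)), by push_cast; ring⟩
  rw [h4, mul_one, (e_eq_one_iff _).2 ⟨-(x ⬝ᵥ Z.mulVec y), by push_cast; ring⟩, mul_one]

theorem gaussFun_comp {R R' : Matrix ι ι ℚ} (A : Matrix ι ι ℤ)
    (h : (A.map (Int.cast : ℤ → ℚ)).transpose * R * A.map (Int.cast : ℤ → ℚ) = R') (x : ι → ℤ) :
    gaussFun R (A.mulVec x) = gaussFun R' x := by
  rw [gaussFun, gaussFun, castV_mulVec, qf_mulVec, h]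

/-- An exponential sum over a full period vanishes unless the frequency is integral. -/
theorem qsum_character (N : ℕ) (hN : N ≠ 0) (c : ι → ℚ) (hc : ∀ i, ∃ z : ℤ, N * c i = z) :
    (∃ z : ι → ℤ, c = castV z) ∨
      qsum (boxLattice fun _ : ι => (N : ℤ)) (fun y => e ((-(castV y ⬝ᵥ c) : ℚ) : ℂ)) = 0 := by
  classical
  by_cases h : ∃ z : ι → ℤ, c = castV z
  · exact Or.inl h
  right
  have hfin := finite_quotient_boxLattice (m := fun _ : ι => (N : ℤ))
    (fun _ => by exact_mod_cast hN)
  have hadd : ∀ x y : ι → ℤ, e ((-(castV (x + y) ⬝ᵥ c) : ℚ) : ℂ) =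
      e ((-(castV y ⬝ᵥ c) : ℚ) : ℂ) * e ((-(castV x ⬝ᵥ c) : ℚ) : ℂ) := by
    intro x y
    rw [castV_add, add_dotProduct, ← e_add]
    congr 1; push_cast; ring
  have hex : ∃ i, ¬ ∃ z : ℤ, c i = z := by
    by_contra! h'
    choose z hz using h'
    exact h ⟨z, funext hz⟩
  obtain ⟨i, hi⟩ := hex
  refine qsum_eq_zero (c := Pi.single i 1) ?_ (ζ := e ((-(c i) : ℚ) : ℂ)) ?_ ?_
  · intro x h hh
    choose z hz using hc
    choose y hy using hh
    beta_reduce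
    rw [hadd]
    have : castV h ⬝ᵥ c = ((y ⬝ᵥ z : ℤ) : ℚ) := by
      simp only [castV, dotProduct]
      push_cast
      refine Finset.sum_congr rfl fun j _ => ?_
      rw [hy j, ← hz j]; push_cast; ring
    rw [this, (e_eq_one_iff _).2 ⟨-(y ⬝ᵥ z), by push_cast; ring⟩, one_mul]
  · intro h1
    obtain ⟨n, hn⟩ := (e_eq_one_iff _).1 h1
    exact hi ⟨-n, by push_cast; linarith⟩
  · intro x
    rw [hadd]
    congr 4
    have : castV (Pi.single i 1 : ι → ℤ) = Pi.single i 1 := by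
      funext j
      by_cases hj : j = i
      · subst hj; simp [castV]
      · simp [castV, hj]
    rw [this, single_one_dotProduct]

/-- Milgram's formula for a positive definite even integer form, up to a positive factor: the Gauss
sum over the discriminant group has phase `e(-r / 8)`, with `r` the rank. The form is diagonalised
over `ℚ`; passing to a sublattice `A ℤ^r` multiplies the sum by a positive number, because
averaging over the isotropic subgroup kills all terms outside the dual lattice. -/
theorem exists_pos_qsum_gaussFun [DecidableEq ι] (T : Matrix ι ι ℤ) (hT : T.IsSymm)
    (heven : ∀ x : ι → ℤ, 2 ∣ x ⬝ᵥ T.mulVec x) (hpos : ∀ x : ι → ℤ, x ≠ 0 → 0 < x ⬝ᵥ T.mulVec x)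
    (R : Matrix ι ι ℚ) (hR : R.IsSymm) (hRT : R * T.map (Int.cast : ℤ → ℚ) = 1) :
    ∃ N₀ : ℕ, 0 < N₀ ∧ ∀ N : ℕ, 0 < N → N₀ ∣ N → ∃ c : ℝ, 0 < c ∧
      qsum (boxLattice fun _ : ι => (N : ℤ)) (gaussFun R) = c * e (-1 / 8) ^ Fintype.card ι := by
  classical
  obtain ⟨A, d, hA, hAd⟩ := exists_int_diagonalization T hT
  set Tq := T.map (Int.cast : ℤ → ℚ) with hTq
  set Aq := A.map (Int.cast : ℤ → ℚ) with hAq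
  have hAqdet : IsUnit Aq.det := by
    have : Aq.det = (A.det : ℚ) := by
      rw [hAq]; exact ((Int.castRingHom ℚ).map_det A).symm
    rw [this]; exact (by exact_mod_cast hA : (A.det : ℚ) ≠ 0).isUnit
  -- the diagonal entries are positive and even
  have hdiag : ∀ j, d j = A.col j ⬝ᵥ T.mulVec (A.col j) := by
    intro j
    have := congrFun (congrFun hAd j) j
    rw [Matrix.diagonal_apply_eq, Matrix.mul_assoc, Matrix.mul_apply] at this
    rw [← this]
    simp only [dotProduct, Matrix.mulVec, Matrix.transpose_apply, Matrix.mul_apply, Matrix.col]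
  have hd : ∀ j, 0 < d j := by
    intro j
    rw [hdiag]
    refine hpos _ fun h => hA ?_
    exact Matrix.det_eq_zero_of_column_eq_zero j fun i => congrFun h i
  have hd2 : ∀ j, ∃ a : ℕ, 0 < a ∧ d j = 2 * a := by
    intro j
    obtain ⟨a, ha⟩ := heven (A.col j)
    rw [← hdiag] at ha
    have := hd j
    exact ⟨a.toNat, by omega, by omega⟩
  choose a ha0 ha using hd2
  have hdq : ∀ j, (d j : ℚ) ≠ 0 := fun j => by exact_mod_cast (hd j).ne'
  set RD : Matrix ι ι ℚ := Matrix.diagonal fun j => 1 / (d j : ℚ) with hRD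
  have hRDs : RD.IsSymm := Matrix.isSymm_diagonal _
  have hAdq : Aq.transpose * Tq * Aq = Matrix.diagonal fun j => (d j : ℚ) := by
    have := congrArg (fun M : Matrix ι ι ℤ => M.map (Int.castRingHom ℚ)) hAd
    simp only [Matrix.map_mul, Matrix.transpose_map] at this
    rw [Matrix.diagonal_map (by simp)] at this
    exact this
  have hDRD : (Matrix.diagonal fun j => (d j : ℚ)) * RD = 1 := by
    rw [hRD, Matrix.diagonal_mul_diagonal, ← Matrix.diagonal_one]
    congr 1; funext j; exact mul_one_div_cancel (hdq j)
  have hTR : Tq * R = 1 := mul_eq_one_comm.1 hRT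
  have hRDA : RD * Aq.transpose * Tq * Aq = 1 := by
    rw [Matrix.mul_assoc, Matrix.mul_assoc, ← Matrix.mul_assoc _ Tq, hAdq]
    exact mul_eq_one_comm.1 hDRD
  have hRDAT : RD * Aq.transpose * Tq = Aq⁻¹ := (Matrix.inv_eq_left_inv hRDA).symm
  have hRDAi : RD * Aq.transpose = Aq⁻¹ * R := by
    rw [← hRDAT, Matrix.mul_assoc _ Tq, hTR, Matrix.mul_one]
  have hARA : Aq * RD * Aq.transpose = R := by
    rw [Matrix.mul_assoc, hRDAi, Matrix.mul_nonsing_inv_cancel_left _ _ hAqdet]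
  -- a common period
  obtain ⟨N₁, hN₁, Z₁, hZ₁⟩ := exists_common_denominator R
  obtain ⟨N₂, hN₂, Z₂, hZ₂⟩ := exists_common_denominator Aq⁻¹
  obtain ⟨N₃, hN₃, Z₃, hZ₃⟩ := exists_common_denominator RD
  have hprod : 0 < ∏ j, a j := Finset.prod_pos fun j _ => ha0 j
  refine ⟨2 * N₁ * N₂ * N₃ * ∏ j, a j, by positivity, fun N hN hdvd => ?_⟩
  have hmult : ∀ {M : ℕ} {X : Matrix ι ι ℚ} {Z : Matrix ι ι ℤ}, M ∣ N →
      Z.map (Int.cast : ℤ → ℚ) = (M : ℚ) • X →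
      ∃ Z' : Matrix ι ι ℤ, Z'.map (Int.cast : ℤ → ℚ) = (N : ℚ) • X := by
    rintro M X Z ⟨q, rfl⟩ hZ
    refine ⟨(q : ℤ) • Z, ?_⟩
    ext i j
    have := congrFun (congrFun hZ i) j
    simp only [Matrix.map_apply, Matrix.smul_apply, smul_eq_mul] at this ⊢
    push_cast
    rw [this]; ring
  have h2N : 2 ∣ N := dvd_trans ⟨N₁ * N₂ * N₃ * ∏ j, a j, by ring⟩ hdvd
  obtain ⟨Z₁', hZ₁'⟩ := hmult (dvd_trans ⟨2 * N₂ * N₃ * ∏ j, a j, by ring⟩ hdvd) hZ₁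
  obtain ⟨Z₂', hZ₂'⟩ := hmult (dvd_trans ⟨2 * N₁ * N₃ * ∏ j, a j, by ring⟩ hdvd) hZ₂
  obtain ⟨Z₃', hZ₃'⟩ := hmult (dvd_trans ⟨2 * N₁ * N₂ * ∏ j, a j, by ring⟩ hdvd) hZ₃
  have haN : ∀ j, 2 * a j ∣ N := fun j =>
    dvd_trans (Nat.mul_dvd_mul_left 2 (Finset.dvd_prod_of_mem a (Finset.mem_univ j)))
      (dvd_trans ⟨N₁ * N₂ * N₃, by ring⟩ hdvd)
  have hN0 : ∀ _ : ι, (N : ℤ) ≠ 0 := fun _ => by exact_mod_cast hN.ne'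
  have hfin := finite_quotient_boxLattice hN0
  have hperD := gaussFun_periodic hRDs hZ₃' h2N
  have hperR := gaussFun_periodic hR hZ₁' h2N
  -- the diagonal case is a product of one-dimensional sums
  have hD : ∃ c : ℝ, 0 < c ∧ qsum (boxLattice fun _ : ι => (N : ℤ)) (gaussFun RD) =
      c * e (-1 / 8) ^ Fintype.card ι := by
    choose c hc0 hc using fun j => gauss_sum_one_dim (a j) (ha0 j) N hN (haN j)
    refine ⟨∏ j, c j, Finset.prod_pos fun j _ => hc0 j, ?_⟩
    rw [qsum_boxLattice hN0 hperD]
    have h1 : ∀ x : (∀ _ : ι, Fin (N : ℤ).natAbs), gaussFun RD (fun i => ((x i : ℕ) : ℤ)) =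
        ∏ i, e (-(((x i : ℕ) : ℂ) ^ 2 / (4 * a i))) := by
      intro x
      rw [gaussFun, ← e_sum]
      congr 1
      simp only [qf, hRD, Matrix.mulVec_diagonal, dotProduct, castV]
      push_cast
      rw [← Finset.sum_neg_distrib, Finset.sum_div]
      refine Finset.sum_congr rfl fun i _ => ?_
      rw [ha i]
      push_cast
      have := ha0 i
      field_simp
      norm_num
    rw [Finset.sum_congr rfl fun x _ => h1 x]
    rw [sum_pi_fin_prod (fun _ => (N : ℤ).natAbs) (fun i j => e (-((j : ℂ) ^ 2 / (4 * a i))))]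
    simp only [Int.natAbs_natCast, hc]
    rw [Finset.prod_mul_distrib, Finset.prod_const, Finset.card_univ]
    push_cast; rfl
  -- averaging over the translations by `ᵗA T y`
  set φ : (ι → ℤ) →+ (ι → ℤ) := A.transpose.mulVecLin.toAddMonoidHom with hφ
  have hφapp : ∀ x, φ x = A.transpose.mulVec x := fun x => rfl
  have hrange : ∀ x, (∃ z : ι → ℤ, Aq⁻¹.transpose.mulVec (castV x) = castV z) → x ∈ φ.range := by
    rintro x ⟨z, hz⟩
    refine ⟨z, ?_⟩
    have h1 : castV (A.transpose.mulVec z) = castV x := by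
      rw [castV_mulVec, ← hz, Matrix.transpose_map, Matrix.mulVec_mulVec, ← Matrix.transpose_mul,
        Matrix.nonsing_inv_mul _ hAqdet, Matrix.transpose_one, Matrix.one_mulVec]
    funext i
    have := congrFun h1 i
    simp only [castV] at this
    rw [hφapp]
    exact_mod_cast this
  have hsupp : qsum (boxLattice fun _ : ι => (N : ℤ)) (gaussFun RD) =
      qsum (boxLattice fun _ : ι => (N : ℤ))
        (fun x => if x ∈ φ.range then gaussFun RD x else 0) := by
    have hshift : ∀ y x, gaussFun RD (x + (A.transpose * T).mulVec y) = gaussFun RD x *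
        e ((-(castV y ⬝ᵥ Aq⁻¹.transpose.mulVec (castV x)) : ℚ) : ℂ) := by
      intro y x
      have e1 : castV ((A.transpose * T).mulVec y) = (Aq.transpose * Tq).mulVec (castV y) := by
        rw [← Matrix.mulVec_mulVec, castV_mulVec, castV_mulVec, Matrix.mulVec_mulVec,
          Matrix.transpose_map]
      have e2 : gaussFun RD ((A.transpose * T).mulVec y) = 1 := by
        have e3 : qf RD (castV ((A.transpose * T).mulVec y)) = ((y ⬝ᵥ T.mulVec y : ℤ) : ℚ) := by
          rw [e1, qf_mulVec, ← dotProduct_castV, castV_mulVec, qf]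
          congr 2
          rw [Matrix.transpose_mul, Matrix.transpose_transpose, (hT.map _ : Tq.IsSymm).eq,
            Matrix.mul_assoc, ← Matrix.mul_assoc RD, hRDAT, Matrix.mul_assoc,
            Matrix.mul_nonsing_inv _ hAqdet, Matrix.mul_one]
        obtain ⟨n, hn⟩ := heven y
        rw [gaussFun, e3, hn, e_eq_one_iff]
        exact ⟨-n, by push_cast; ring⟩
      rw [gaussFun_add hRDs, e2, mul_one, e1, Matrix.mulVec_mulVec, ← Matrix.mul_assoc, hRDAT,
        Matrix.dotProduct_mulVec, ← Matrix.mulVec_transpose, dotProduct_comm]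
    have hcard : (Nat.card ((ι → ℤ) ⧸ boxLattice fun _ : ι => (N : ℤ)) : ℂ) ≠ 0 := by
      exact_mod_cast Nat.card_pos.ne'
    refine mul_left_cancel₀ hcard ?_
    have := Fintype.ofFinite ((ι → ℤ) ⧸ boxLattice fun _ : ι => (N : ℤ))
    calc _ = qsum (boxLattice fun _ : ι => (N : ℤ)) (fun _ : ι → ℤ =>
          qsum (boxLattice fun _ : ι => (N : ℤ)) (gaussFun RD)) := (qsum_const _).symm
      _ = qsum (boxLattice fun _ : ι => (N : ℤ)) (fun y =>
          qsum (boxLattice fun _ : ι => (N : ℤ)) (fun x => gaussFun RD x *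
            e ((-(castV y ⬝ᵥ Aq⁻¹.transpose.mulVec (castV x)) : ℚ) : ℂ))) := by
        refine qsum_congr fun y => ?_
        rw [← qsum_add_right hperD ((A.transpose * T).mulVec y)]
        exact qsum_congr (hshift y)
      _ = qsum (boxLattice fun _ : ι => (N : ℤ)) (fun x => gaussFun RD x *
          qsum (boxLattice fun _ : ι => (N : ℤ)) (fun y =>
            e ((-(castV y ⬝ᵥ Aq⁻¹.transpose.mulVec (castV x)) : ℚ) : ℂ))) := by
        simp only [qsum_eq_sum, Finset.mul_sum]
        exact Finset.sum_comm
      _ = _ := by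
        rw [← qsum_mul_left]
        refine qsum_congr fun x => ?_
        by_cases hx : x ∈ φ.range
        · rw [if_pos hx, mul_comm]
          congr 1
          obtain ⟨z, rfl⟩ := hx
          rw [← mul_one (Nat.card _ : ℂ), ← qsum_const]
          refine qsum_congr fun y => ?_
          rw [e_eq_one_iff, hφapp, castV_mulVec, Matrix.mulVec_mulVec, Matrix.transpose_map,
            ← Matrix.transpose_mul, Matrix.mul_nonsing_inv _ hAqdet, Matrix.transpose_one,
            Matrix.one_mulVec, dotProduct_castV]
          exact ⟨-(y ⬝ᵥ z), by push_cast; ring⟩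
        · rw [if_neg hx, mul_zero]
          rcases qsum_character N hN.ne' (Aq⁻¹.transpose.mulVec (castV x)) (fun i => by
            refine ⟨(Z₂'.transpose.mulVec x) i, ?_⟩
            have := congrFun (castV_mulVec Z₂'.transpose x) i
            rw [Matrix.transpose_map, hZ₂', Matrix.transpose_smul, Matrix.smul_mulVec] at this
            simpa [castV] using this.symm) with h | h
          · exact absurd (hrange x h) hx
          · rw [h, mul_zero]
  obtain ⟨c, hc0, hc⟩ := hD
  obtain ⟨c', hc'0, hc'⟩ := qsum_comp_hom (Λ := boxLattice fun _ : ι => (N : ℤ))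
    (Λ' := boxLattice fun _ : ι => (N : ℤ)) φ (by
      intro x hx
      choose y hy using hx
      have : x = (N : ℤ) • y := by funext i; simpa using hy i
      rw [AddSubgroup.mem_comap, this, map_zsmul]
      exact fun i => ⟨φ y i, by simp⟩) hperD (by
      intro x hx
      choose y hy using hx
      have hxy : x = (N : ℤ) • y := by funext i; simpa using hy i
      refine hrange x ⟨Z₂'.transpose.mulVec y, ?_⟩
      rw [castV_mulVec, Matrix.transpose_map, hZ₂', hxy, castV_smul, Matrix.mulVec_smul,
        Matrix.transpose_smul, Matrix.smul_mulVec]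
      simp)
  refine ⟨c' * c, by positivity, ?_⟩
  rw [← hsupp, hc] at hc'
  rw [show ((c' * c : ℝ) : ℂ) * e (-1 / 8) ^ Fintype.card ι =
    (c' : ℂ) * (c * e (-1 / 8) ^ Fintype.card ι) by push_cast; ring, ← hc']
  refine qsum_congr fun x => ?_
  rw [hφapp]
  refine (gaussFun_comp A.transpose ?_ x).symm
  rw [Matrix.transpose_map, Matrix.transpose_transpose]
  exact hARA

end Milgram

/-! ### Arithmetic of a unimodular linking matrix -/

section GraphArithmetic

variable {V : Type*} [Fintype V] [DecidableEq V] {G : SimpleGraph V} [DecidableRel G.Adj]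
  {w : V → ℤ}

theorem linkingMatrix_mulVec (x : V → ℤ) (u : V) :
    (linkingMatrix G w).mulVec x u = w u * x u + ∑ y ∈ G.neighborFinset u, x y := by
  rw [linkingMatrix, Matrix.add_mulVec, Pi.add_apply, Matrix.mulVec_diagonal,
    SimpleGraph.adjMatrix_mulVec_apply]

theorem linkingMatrix_isSymm : (linkingMatrix G w).IsSymm :=
  (Matrix.isSymm_diagonal w).add (G.isSymm_adjMatrix)

theorem linkingMatrix_apply (u v : V) :
    linkingMatrix G w u v = (if u = v then w u else 0) + if G.Adj u v then 1 else 0 := by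
  simp [linkingMatrix, Matrix.diagonal_apply, SimpleGraph.adjMatrix_apply]

theorem mem_leaves {v i : V} : i ∈ leaves G v ↔ G.Adj v i ∧ G.degree i = 1 := by
  simp [leaves]

theorem neighborFinset_of_mem_leaves {v i : V} (hi : i ∈ leaves G v) :
    G.neighborFinset i = {v} := by
  rw [mem_leaves] at hi
  have h1 : v ∈ G.neighborFinset i := by simpa using hi.1.symm
  obtain ⟨a, ha⟩ := Finset.card_eq_one.1 ((G.card_neighborFinset_eq_degree i).trans hi.2)
  rw [ha] at h1 ⊢
  rw [Finset.mem_singleton.1 h1]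

theorem linkingMatrix_inv_isSymm : (linkingMatrix G w)⁻¹.IsSymm := by
  rw [Matrix.IsSymm, Matrix.transpose_nonsing_inv, linkingMatrix_isSymm.eq]

/-- Unimodularity: a divisor of `W x` divides `x`. -/
theorem dvd_of_linkingMatrix_mulVec (hW : IsUnit (linkingMatrix G w).det) {n : ℤ} {x : V → ℤ}
    (h : ∀ u, n ∣ (linkingMatrix G w).mulVec x u) (u : V) : n ∣ x u := by
  have h1 : (linkingMatrix G w)⁻¹.mulVec ((linkingMatrix G w).mulVec x) = x := by
    rw [Matrix.mulVec_mulVec, Matrix.nonsing_inv_mul _ hW, Matrix.one_mulVec]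
  rw [← h1]
  exact Finset.dvd_sum fun y _ => dvd_mul_of_dvd_right (h y) _

/-- Otherwise a common divisor of `w i` and `w j` divides the image under `W` of the difference of
the basis vectors of `i` and `j`, and so, `W` being unimodular, that difference itself. -/
theorem isCoprime_leaves (hW : IsUnit (linkingMatrix G w).det) {v i j : V} (hi : i ∈ leaves G v)
    (hj : j ∈ leaves G v) (hij : i ≠ j) : IsCoprime (w i) (w j) := by
  rw [Int.isCoprime_iff_gcd_eq_one]
  have hdiv : ∀ u, (Int.gcd (w i) (w j) : ℤ) ∣
      (linkingMatrix G w).mulVec (Pi.single i 1 - Pi.single j 1) u := by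
    intro u
    have hN : ∑ y ∈ G.neighborFinset u, ((Pi.single i 1 - Pi.single j 1 : V → ℤ)) y = 0 := by
      simp only [Pi.sub_apply, Finset.sum_sub_distrib, Finset.sum_pi_single']
      have h1 : i ∈ G.neighborFinset u ↔ u = v := by
        rw [SimpleGraph.mem_neighborFinset, SimpleGraph.adj_comm, ← SimpleGraph.mem_neighborFinset,
          neighborFinset_of_mem_leaves hi, Finset.mem_singleton]
      have h2 : j ∈ G.neighborFinset u ↔ u = v := by
        rw [SimpleGraph.mem_neighborFinset, SimpleGraph.adj_comm, ← SimpleGraph.mem_neighborFinset,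
          neighborFinset_of_mem_leaves hj, Finset.mem_singleton]
      simp only [h1, h2, sub_self]
    rw [linkingMatrix_mulVec, hN, add_zero]
    by_cases h1 : u = i
    · rw [h1]; exact dvd_mul_of_dvd_left (Int.gcd_dvd_left ..) _
    · by_cases h2 : u = j
      · rw [h2]; exact dvd_mul_of_dvd_left (Int.gcd_dvd_right ..) _
      · simp [h1, h2]
  have h := dvd_of_linkingMatrix_mulVec hW hdiv i
  simp only [Pi.sub_apply, Pi.single_eq_same, Pi.single_eq_of_ne hij, sub_zero] at h
  have := Int.le_of_dvd one_pos h
  have h0 : Int.gcd (w i) (w j) ≠ 0 := by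
    intro h0; rw [h0] at h; simp at h
  omega

/-- Two vertices of degree one are never adjacent. -/
theorem not_adj_of_degree_eq_one (hW : IsUnit (linkingMatrix G w).det)
    (hleaf : ∀ i, G.degree i = 1 → w i ≤ -2) {u i : V} (hu : G.degree u = 1)
    (hi : i ∈ leaves G u) : False := by
  have hi' := mem_leaves.1 hi
  have hui : u ∈ leaves G i := mem_leaves.2 ⟨hi'.1.symm, hu⟩
  have hne : u ≠ i := hi'.1.ne
  have hdiv : ∀ x, (1 - w i * w u) ∣
      (linkingMatrix G w).mulVec (Pi.single i 1 - Pi.single u (w i)) x := by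
    intro x
    rw [linkingMatrix_mulVec]
    have h1 : i ∈ G.neighborFinset x ↔ x = u := by
      rw [SimpleGraph.mem_neighborFinset, SimpleGraph.adj_comm, ← SimpleGraph.mem_neighborFinset,
        neighborFinset_of_mem_leaves hi, Finset.mem_singleton]
    have h2 : u ∈ G.neighborFinset x ↔ x = i := by
      rw [SimpleGraph.mem_neighborFinset, SimpleGraph.adj_comm, ← SimpleGraph.mem_neighborFinset,
        neighborFinset_of_mem_leaves hui, Finset.mem_singleton]
    simp only [Pi.sub_apply, Finset.sum_sub_distrib, Finset.sum_pi_single', h1, h2]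
    by_cases hx : x = u
    · subst hx
      simp only [Pi.single_eq_of_ne hne, Pi.single_eq_same, if_pos, if_neg hne, sub_zero, zero_sub]
      exact ⟨1, by ring⟩
    · by_cases hx' : x = i
      · subst hx'
        simp [hx]
      · simp [hx, hx']
  have h := dvd_of_linkingMatrix_mulVec hW hdiv i
  simp only [Pi.sub_apply, Pi.single_eq_same, Pi.single_eq_of_ne hne.symm, sub_zero] at h
  have h1 := hleaf i hi'.2
  have h2 := hleaf u hu
  have h3 : 4 ≤ w i * w u := by nlinarith
  have := Int.le_of_dvd one_pos ((neg_dvd).2 h)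
  omega

theorem two_le_degree_of_mem_leaves (hW : IsUnit (linkingMatrix G w).det)
    (hleaf : ∀ i, G.degree i = 1 → w i ≤ -2) {v i : V} (hi : i ∈ leaves G v) :
    2 ≤ G.degree v := by
  have h0 : 0 < G.degree v := (G.degree_pos_iff_exists_adj v).2 ⟨i, (mem_leaves.1 hi).1⟩
  have h1 : G.degree v ≠ 1 := fun h => not_adj_of_degree_eq_one hW hleaf h hi
  omega

/-- The row of `W W⁻¹ = 1` belonging to a leaf. -/
theorem leaf_row (hW : IsUnit (linkingMatrix G w).det) {u i v : V} (hi : i ∈ leaves G u)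
    (hiv : i ≠ v) : w i * (linkingMatrix G w)⁻¹ i v + (linkingMatrix G w)⁻¹ u v = 0 := by
  have h := congrFun (congrFun (Matrix.mul_nonsing_inv _ hW) i) v
  rw [Matrix.one_apply_ne hiv] at h
  have h2 := linkingMatrix_mulVec (G := G) (w := w) (fun x => (linkingMatrix G w)⁻¹ x v) i
  rw [neighborFinset_of_mem_leaves hi, Finset.sum_singleton] at h2
  rw [← h2]
  exact h

theorem ne_of_leaf {u i : V} (hi : i ∈ leaves G u) (v : V2 G) : i ≠ v.1 := by
  intro h
  have h1 := (mem_leaves.1 hi).2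
  have h2 := v.2
  rw [← h] at h2; omega

theorem S_apply (u v : V2 G) : S G w u v = -(linkingMatrix G w)⁻¹ u.1 v.1 := rfl

theorem S_isSymm : (S G w).IsSymm := by
  ext u v
  rw [Matrix.transpose_apply, S_apply, S_apply, linkingMatrix_inv_isSymm.apply]

theorem leaf_dvd_S (hW : IsUnit (linkingMatrix G w).det) (u v : V2 G) {i : V}
    (hi : i ∈ leaves G u.1) : w i ∣ S G w u v := by
  have h := leaf_row hW hi (ne_of_leaf hi v)
  exact ⟨(linkingMatrix G w)⁻¹ i v.1, by rw [S_apply]; linarith⟩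

theorem M_dvd_of_leaf_dvd (hW : IsUnit (linkingMatrix G w).det) (u : V) {z : ℤ}
    (h : ∀ i ∈ leaves G u, w i ∣ z) : M G w u ∣ z :=
  Finset.prod_dvd_of_coprime (fun _ hi _ hj hij => isCoprime_leaves hW hi hj hij) h

theorem leaf_dvd_M {v i : V} (hi : i ∈ leaves G v) : w i ∣ M G w v :=
  Finset.dvd_prod_of_mem _ hi

/-- The row of `S` at `u` is divisible by the weight of each leaf at `u`, and these are pairwise
coprime. -/
theorem M_dvd_S (hW : IsUnit (linkingMatrix G w).det) (u v : V2 G) : M G w u.1 ∣ S G w u v :=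
  M_dvd_of_leaf_dvd hW _ fun _ hi => leaf_dvd_S hW u v hi

theorem leaf_ne_zero (hleaf : ∀ i, G.degree i = 1 → w i ≤ -2) {v i : V} (hi : i ∈ leaves G v) :
    w i ≠ 0 := by
  have := hleaf i (mem_leaves.1 hi).2
  omega

theorem M_ne_zero (hleaf : ∀ i, G.degree i = 1 → w i ≤ -2) (v : V) : M G w v ≠ 0 :=
  Finset.prod_ne_zero_iff.2 fun _ hi => leaf_ne_zero hleaf hi

/-- The inverse of `S`: minus the Schur complement of the block of the leaves in the linking
matrix. -/
def Rmat (G : SimpleGraph V) [DecidableRel G.Adj] (w : V → ℤ) : Matrix (V2 G) (V2 G) ℚ :=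
  Matrix.diagonal (fun v => ∑ i ∈ leaves G v.1, 1 / (w i : ℚ)) -
    ((linkingMatrix G w).submatrix Subtype.val Subtype.val).map (Int.cast : ℤ → ℚ)

theorem Rmat_mul_SQ (hW : IsUnit (linkingMatrix G w).det)
    (hleaf : ∀ i, G.degree i = 1 → w i ≤ -2) : Rmat G w * SQ G w = 1 := by
  ext u v
  have h := congrFun (congrFun (Matrix.mul_nonsing_inv _ hW) u.1) v.1
  rw [Matrix.mul_apply] at h
  have h1 : ∑ x : {x // ¬ 2 ≤ G.degree x},
      linkingMatrix G w u.1 x.1 * (linkingMatrix G w)⁻¹ x.1 v.1 =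
      ∑ i ∈ leaves G u.1, (linkingMatrix G w)⁻¹ i v.1 := by
    rw [← Finset.sum_subtype (Finset.univ.filter fun x => ¬ 2 ≤ G.degree x) (by simp)
      (fun x => linkingMatrix G w u.1 x * (linkingMatrix G w)⁻¹ x v.1)]
    symm
    have hsub : leaves G u.1 ⊆ Finset.univ.filter fun x => ¬ 2 ≤ G.degree x := by
      intro i hi
      have := (mem_leaves.1 hi).2
      simp [this]
    rw [← Finset.sum_subset hsub]
    · refine Finset.sum_congr rfl fun i hi => ?_
      have hne : u.1 ≠ i := (ne_of_leaf hi u).symm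
      rw [linkingMatrix_apply, if_neg hne, if_pos (mem_leaves.1 hi).1, zero_add, one_mul]
    · intro x hx hx'
      have hx2 : ¬ 2 ≤ G.degree x := by simpa using hx
      have hne : u.1 ≠ x := fun h => hx2 (h ▸ u.2)
      have hna : ¬ G.Adj u.1 x := by
        intro ha
        have : 0 < G.degree x := (G.degree_pos_iff_exists_adj x).2 ⟨_, ha.symm⟩
        exact hx' (mem_leaves.2 ⟨ha, by omega⟩)
      rw [linkingMatrix_apply, if_neg hne, if_neg hna, zero_add, zero_mul]
  rw [← Fintype.sum_subtype_add_sum_subtype (fun x => 2 ≤ G.degree x), h1] at h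
  have h2 : ((1 : Matrix V V ℤ) u.1 v.1 : ℤ) = (1 : Matrix (V2 G) (V2 G) ℤ) u v := by
    simp only [Matrix.one_apply, Subtype.ext_iff]
  rw [h2] at h
  have h3 : ∑ i ∈ leaves G u.1, (((linkingMatrix G w)⁻¹ i v.1 : ℤ) : ℚ) =
      -((∑ i ∈ leaves G u.1, 1 / (w i : ℚ)) * ((linkingMatrix G w)⁻¹ u.1 v.1 : ℤ)) := by
    rw [Finset.sum_mul, ← Finset.sum_neg_distrib]
    refine Finset.sum_congr rfl fun i hi => ?_
    have h4 := leaf_row hW hi (ne_of_leaf hi v)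
    have h5 : (w i : ℚ) ≠ 0 := by exact_mod_cast leaf_ne_zero hleaf hi
    have h6 : (w i : ℚ) * ((linkingMatrix G w)⁻¹ i v.1 : ℤ) +
        ((linkingMatrix G w)⁻¹ u.1 v.1 : ℤ) = 0 := by
      exact_mod_cast h4
    field_simp
    linarith
  rw [Rmat, Matrix.sub_mul, Matrix.sub_apply, Matrix.diagonal_mul]
  have h7 : ((((linkingMatrix G w).submatrix Subtype.val Subtype.val).map (Int.cast : ℤ → ℚ) :
      Matrix (V2 G) (V2 G) ℚ) * SQ G w) u v =
      -∑ x : V2 G, ((linkingMatrix G w u.1 x.1 * (linkingMatrix G w)⁻¹ x.1 v.1 : ℤ) : ℚ) := by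
    rw [Matrix.mul_apply, ← Finset.sum_neg_distrib]
    refine Finset.sum_congr rfl fun x _ => ?_
    simp [SQ, S_apply]
  rw [h7]
  have h8 := congrArg (Int.cast : ℤ → ℚ) h
  push_cast at h8
  rw [h3] at h8
  have h9 : SQ G w u v = -((linkingMatrix G w)⁻¹ u.1 v.1 : ℤ) := by simp [SQ, S_apply]
  rw [h9]
  have h10 : (((1 : Matrix (V2 G) (V2 G) ℤ) u v : ℤ) : ℚ) = (1 : Matrix (V2 G) (V2 G) ℚ) u v := by
    simp only [Matrix.one_apply]; split_ifs <;> simp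
  rw [← h10, ← h8]
  push_cast
  ring

theorem SQ_inv (hW : IsUnit (linkingMatrix G w).det)
    (hleaf : ∀ i, G.degree i = 1 → w i ≤ -2) : (SQ G w)⁻¹ = Rmat G w :=
  Matrix.inv_eq_left_inv (Rmat_mul_SQ hW hleaf)

theorem Rmat_isSymm : (Rmat G w).IsSymm :=
  (Matrix.isSymm_diagonal _).sub ((linkingMatrix_isSymm.submatrix _).map _)

/-- The lattice `2 k S ℤ^r` is a box: `S` is the diagonal matrix of the `M_v` times a unimodular
matrix. -/
theorem lattice_eq (hW : IsUnit (linkingMatrix G w).det)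
    (hleaf : ∀ i, G.degree i = 1 → w i ≤ -2) {k : ℕ} (hk : 0 < k) :
    lattice G w k = boxLattice fun v : V2 G => 2 * k * M G w v.1 := by
  ext h
  have hmem : h ∈ lattice G w k ↔ ∃ y : V2 G → ℤ, (2 * k : ℤ) • (S G w).mulVec y = h := Iff.rfl
  rw [hmem, mem_boxLattice]
  constructor
  · rintro ⟨y, rfl⟩ v
    simp only [Pi.smul_apply, smul_eq_mul]
    refine mul_dvd_mul_left _ (Finset.dvd_sum fun x _ => dvd_mul_of_dvd_left (M_dvd_S hW v x) _)
  · intro hh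
    choose z hz using hh
    have hk' : (k : ℚ) ≠ 0 := by exact_mod_cast hk.ne'
    -- the preimage `S⁻¹ h / 2k` is integral
    have hint : ∃ y : V2 G → ℤ, castV y = (1 / (2 * k : ℚ)) • (Rmat G w).mulVec (castV h) := by
      refine ⟨fun v => (∑ i ∈ leaves G v.1, M G w v.1 / w i) * z v -
        ∑ x : V2 G, linkingMatrix G w v.1 x.1 * (M G w x.1 * z x), ?_⟩
      funext v
      rw [Rmat, Matrix.sub_mulVec, Pi.smul_apply, Pi.sub_apply, Matrix.mulVec_diagonal]
      simp only [castV, Matrix.mulVec, dotProduct, Matrix.map_apply, Matrix.submatrix_apply, hz]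
      push_cast
      rw [smul_eq_mul, mul_sub, Finset.sum_mul, Finset.sum_mul, Finset.mul_sum, Finset.mul_sum]
      congr 1
      · refine Finset.sum_congr rfl fun i hi => ?_
        have h5 : (w i : ℚ) ≠ 0 := by exact_mod_cast leaf_ne_zero hleaf hi
        rw [Int.cast_div (leaf_dvd_M hi) h5]
        field_simp
      · refine Finset.sum_congr rfl fun x _ => ?_
        field_simp
    obtain ⟨y, hy⟩ := hint
    refine ⟨y, ?_⟩
    have h1 : castV ((2 * k : ℤ) • (S G w).mulVec y) = castV h := by
      rw [castV_smul, castV_mulVec, hy, Matrix.mulVec_smul, Matrix.mulVec_mulVec]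
      have : (S G w).map (Int.cast : ℤ → ℚ) * Rmat G w = 1 :=
        mul_eq_one_comm.1 (Rmat_mul_SQ hW hleaf)
      rw [this, Matrix.one_mulVec, smul_smul]
      push_cast
      rw [mul_one_div_cancel (by positivity), one_smul]
    funext v
    have := congrFun h1 v
    simp only [castV] at this
    exact_mod_cast this

/-- `S` is a principal block of the inverse of the positive definite matrix `-W`. -/
theorem S_pos (hneg : (-(linkingMatrix G w).map (Int.cast : ℤ → ℝ)).PosDef)
    (hW : IsUnit (linkingMatrix G w).det) {x : V2 G → ℤ} (hx : x ≠ 0) :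
    0 < x ⬝ᵥ (S G w).mulVec x := by
  set X : V → ℤ := fun v => if h : 2 ≤ G.degree v then x ⟨v, h⟩ else 0 with hX
  set Y := (linkingMatrix G w)⁻¹.mulVec X with hY
  have hXv : ∀ v : V2 G, X v.1 = x v := fun v => by simp [hX, v.2]
  have hX0 : ∀ v, ¬ 2 ≤ G.degree v → X v = 0 := fun v hv => by simp [hX, hv]
  have hWY : (linkingMatrix G w).mulVec Y = X := by
    rw [hY, Matrix.mulVec_mulVec, Matrix.mul_nonsing_inv _ hW, Matrix.one_mulVec]
  have hY0 : Y ≠ 0 := by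
    intro h
    rw [h, Matrix.mulVec_zero] at hWY
    apply hx
    funext v
    rw [← hXv, ← hWY]; rfl
  have hsum : ∀ f : V → ℤ, ∑ v, X v * f v = ∑ v : V2 G, x v * f v.1 := by
    intro f
    rw [← Fintype.sum_subtype_add_sum_subtype (fun v => 2 ≤ G.degree v)]
    simp only [hXv]
    rw [add_eq_left]
    exact Finset.sum_eq_zero fun v _ => by rw [hX0 _ v.2, zero_mul]
  have h1 : x ⬝ᵥ (S G w).mulVec x = -(Y ⬝ᵥ (linkingMatrix G w).mulVec Y) := by
    rw [hWY, dotProduct_comm Y, dotProduct, dotProduct, hsum, ← Finset.sum_neg_distrib]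
    refine Finset.sum_congr rfl fun v _ => ?_
    rw [hY, Matrix.mulVec, Matrix.mulVec, dotProduct, dotProduct]
    have := hsum (fun y => (linkingMatrix G w)⁻¹ v.1 y)
    simp only [mul_comm (X _), mul_comm (x _)] at this ⊢
    rw [this]
    simp only [S_apply, neg_mul, Finset.sum_neg_distrib]
  rw [h1]
  have hYr : (fun v => (Y v : ℝ)) ≠ 0 := by
    intro h
    apply hY0
    funext v
    have := congrFun h v
    simpa using this
  have h2 := hneg.dotProduct_mulVec_pos hYr
  have h3 : star (fun v => (Y v : ℝ)) ⬝ᵥ (-(linkingMatrix G w).map (Int.cast : ℤ → ℝ)).mulVec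
      (fun v => (Y v : ℝ)) = ((-(Y ⬝ᵥ (linkingMatrix G w).mulVec Y) : ℤ) : ℝ) := by
    rw [Matrix.neg_mulVec, dotProduct_neg]
    simp [dotProduct, Matrix.mulVec]
  rw [h3] at h2
  exact_mod_cast h2

/-- Every leaf hangs at exactly one vertex of degree at least two. -/
theorem prod_leaves {R : Type*} [CommMonoid R] (hW : IsUnit (linkingMatrix G w).det)
    (hleaf : ∀ i, G.degree i = 1 → w i ≤ -2) (f : V → R) :
    ∏ v : V2 G, ∏ i ∈ leaves G v.1, f i = ∏ i : V1 G, f i.1 := by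
  rw [← Finset.prod_subtype (Finset.univ.filter fun v => 2 ≤ G.degree v) (by simp)
    (fun v => ∏ i ∈ leaves G v, f i), ← Finset.prod_subtype
    (Finset.univ.filter fun v => G.degree v = 1) (by simp) f, ← Finset.prod_biUnion]
  · refine Finset.prod_congr ?_ fun _ _ => rfl
    ext i
    simp only [Finset.mem_biUnion, Finset.mem_filter, Finset.mem_univ, true_and]
    constructor
    · rintro ⟨v, _, hi⟩
      exact (mem_leaves.1 hi).2
    · intro hi
      obtain ⟨v, hv⟩ := (G.degree_pos_iff_exists_adj i).1 (by omega)
      have hmem : i ∈ leaves G v := mem_leaves.2 ⟨hv.symm, hi⟩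
      exact ⟨v, two_le_degree_of_mem_leaves hW hleaf hmem, hmem⟩
  · intro u _ v _ huv
    refine Finset.disjoint_left.2 fun i hi hi' => huv ?_
    have := (neighborFinset_of_mem_leaves hi).symm.trans (neighborFinset_of_mem_leaves hi')
    simpa using this

/-- The sum of all degrees is even, and the leaves are the only vertices of odd degree that the
product omits. -/
theorem prod_neg_one_pow_degree : ∏ v : V2 G, (-1 : ℂ) ^ G.degree v.1 =
    (-1) ^ Fintype.card (V1 G) := by
  have h1 : ∏ v : V, (-1 : ℂ) ^ G.degree v = 1 := by
    rw [Finset.prod_pow_eq_pow_sum, G.sum_degrees_eq_twice_card_edges, pow_mul]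
    simp
  rw [← Fintype.prod_subtype_mul_prod_subtype (fun v => 2 ≤ G.degree v)] at h1
  have h2 : ∏ v : {v // ¬ 2 ≤ G.degree v}, (-1 : ℂ) ^ G.degree v.1 =
      (-1) ^ Fintype.card (V1 G) := by
    rw [← Finset.prod_subtype (Finset.univ.filter fun v => ¬ 2 ≤ G.degree v) (by simp)
      (fun v => (-1 : ℂ) ^ G.degree v), Fintype.card_subtype, Finset.card_eq_sum_ones,
      ← Finset.prod_pow_eq_pow_sum]
    symm
    refine Finset.prod_subset_one_on_sdiff ?_ ?_ ?_
    · intro v hv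
      have : G.degree v = 1 := by simpa using hv
      simp [this]
    · intro v hv
      simp only [Finset.mem_sdiff, Finset.mem_filter, Finset.mem_univ, true_and] at hv
      have : G.degree v = 0 := by omega
      simp [this]
    · intro v hv
      have : G.degree v = 1 := by simpa using hv
      simp [this]
  rw [h2] at h1
  have h3 : ((-1 : ℂ) ^ Fintype.card (V1 G)) * (-1) ^ Fintype.card (V1 G) = 1 := by
    rw [← mul_pow]; simp
  exact mul_right_cancel₀ (b := (-1 : ℂ) ^ Fintype.card (V1 G)) (by simp) (h1.trans h3.symm)

end GraphArithmetic

/-! ### Sums of periodic functions -/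

section PeriodicSums

theorem periodic_emod {h : ℤ → ℂ} {n : ℤ} (hh : ∀ a, h (a + n) = h a) (a : ℤ) :
    h (a % n) = h a := by
  have := Function.Periodic.int_mul (f := h) (c := n) hh (a / n) (a % n)
  rw [mul_comm, Int.cast_id, Int.emod_add_mul_ediv] at this
  exact this.symm

/-- A periodic function may be summed over any complete system of residues. -/
theorem sum_range_comp_of_injective {n : ℕ} (hn : 0 < n) {h : ℤ → ℂ} (hh : ∀ a, h (a + n) = h a)
    (σ : ℤ → ℤ) (hσ : ∀ a b, (n : ℤ) ∣ σ a - σ b → (n : ℤ) ∣ a - b) :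
    ∑ j ∈ Finset.range n, h (σ j) = ∑ j ∈ Finset.range n, h j := by
  have hn' : (n : ℤ) ≠ 0 := by exact_mod_cast hn.ne'
  have hmod : ∀ a : ℤ, 0 ≤ a % n ∧ a % n < n := fun a =>
    ⟨Int.emod_nonneg a hn', Int.emod_lt_of_pos a (by exact_mod_cast hn)⟩
  have hmaps : Set.MapsTo (fun j : ℕ => (σ j % n).toNat) (Finset.range n) (Finset.range n) := by
    intro j _
    have := hmod (σ j)
    simp only [Finset.coe_range, Set.mem_Iio]
    omega
  have hinj : Set.InjOn (fun j : ℕ => (σ j % n).toNat) (Finset.range n) := by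
    intro a ha b hb hab
    have h1 := hmod (σ a)
    have h2 := hmod (σ b)
    have h3 : σ a % n = σ b % n := by simp only at hab; omega
    have h4 := hσ a b (Int.dvd_of_emod_eq_zero
      (Int.emod_eq_emod_iff_emod_sub_eq_zero.1 h3))
    simp only [Finset.coe_range, Set.mem_Iio] at ha hb
    have h5 : (a : ℤ) - b = 0 := Int.eq_zero_of_abs_lt_dvd h4
      (by rw [abs_lt]; constructor <;> omega)
    omega
  refine Finset.sum_nbij (fun j : ℕ => (σ j % n).toNat) hmaps hinj
    (Finset.surjOn_of_injOn_of_card_le _ hmaps hinj le_rfl) fun j _ => ?_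
  have := hmod (σ j)
  rw [Int.toNat_of_nonneg this.1, periodic_emod hh]

/-- The Chinese remainder theorem for the product of two periodic functions. -/
theorem sum_range_mul_of_coprime {m n : ℕ} (hm : 0 < m) (hn : 0 < n) (hmn : Nat.Coprime m n)
    {f g : ℤ → ℂ} (hf : ∀ a, f (a + m) = f a) (hg : ∀ a, g (a + n) = g a) :
    ∑ j ∈ Finset.range (m * n), f j * g j =
      (∑ j ∈ Finset.range m, f j) * ∑ j ∈ Finset.range n, g j := by
  rw [Finset.sum_mul_sum, ← Finset.sum_product']
  have hmaps : Set.MapsTo (fun j : ℕ => (j % m, j % n)) (Finset.range (m * n))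
      (Finset.range m ×ˢ Finset.range n : Finset (ℕ × ℕ)) := by
    intro j _
    simp [Nat.mod_lt _ hm, Nat.mod_lt _ hn]
  have hinj : Set.InjOn (fun j : ℕ => (j % m, j % n)) (Finset.range (m * n)) := by
    intro a ha b hb hab
    simp only [Prod.mk.injEq] at hab
    simp only [Finset.coe_range, Set.mem_Iio] at ha hb
    have h1 : a ≡ b [MOD m * n] := (Nat.modEq_and_modEq_iff_modEq_mul hmn).1 hab
    exact Nat.ModEq.eq_of_lt_of_lt h1 ha hb
  refine Finset.sum_nbij (fun j : ℕ => (j % m, j % n)) hmaps hinj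
    (Finset.surjOn_of_injOn_of_card_le _ hmaps hinj (by simp)) fun j _ => ?_
  rw [Int.natCast_mod, Int.natCast_mod, periodic_emod hf, periodic_emod hg]

/-- The Chinese remainder theorem for sums of products of periodic functions. -/
theorem sum_range_prod_of_coprime {κ : Type*} (s : Finset κ) (n : κ → ℕ) (hn : ∀ i ∈ s, 0 < n i)
    (hc : (s : Set κ).Pairwise fun i j => Nat.Coprime (n i) (n j)) (h : κ → ℤ → ℂ)
    (hh : ∀ i ∈ s, ∀ a, h i (a + n i) = h i a) :
    ∑ j ∈ Finset.range (∏ i ∈ s, n i), ∏ i ∈ s, h i j =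
      ∏ i ∈ s, ∑ j ∈ Finset.range (n i), h i j := by
  classical
  induction s using Finset.induction_on with
  | empty => simp
  | insert i s hi ih =>
    have ih' := ih (fun j hj => hn j (Finset.mem_insert_of_mem hj))
      (hc.mono (by simp)) (fun j hj => hh j (Finset.mem_insert_of_mem hj))
    rw [Finset.prod_insert hi, Finset.prod_insert hi, ← ih']
    simp only [Finset.prod_insert hi]
    refine sum_range_mul_of_coprime (f := h i) (g := fun a => ∏ j ∈ s, h j a)
      (hn i (Finset.mem_insert_self _ _))
      (Finset.prod_pos fun j hj => hn j (Finset.mem_insert_of_mem hj)) ?_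
      (hh i (Finset.mem_insert_self _ _)) ?_
    · refine Nat.Coprime.prod_right fun j hj => ?_
      exact hc (by simp) (by simp [hj]) (fun h => hi (h ▸ hj))
    · intro a
      refine Finset.prod_congr rfl fun j hj => ?_
      obtain ⟨q, hq⟩ := Finset.dvd_prod_of_mem n hj
      rw [hq]
      have := Function.Periodic.nat_mul (f := h j) (c := (n j : ℤ))
        (hh j (Finset.mem_insert_of_mem hj)) q a
      push_cast
      rw [mul_comm]
      exact this

end PeriodicSums

/-! ### The Gauss sum of the linking matrix -/

section GaussSum

variable {V : Type*} [Fintype V] [DecidableEq V] {G : SimpleGraph V} [DecidableRel G.Adj]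
  {w : V → ℤ}

theorem gaussWeight_eq (hW : IsUnit (linkingMatrix G w).det)
    (hleaf : ∀ i, G.degree i = 1 → w i ≤ -2) (k : ℕ) (μ : V2 G → ℤ) :
    gaussWeight G w k μ = gaussFun ((1 / (2 * k : ℚ)) • Rmat G w) μ := by
  rw [gaussWeight, gaussFun, SQ_inv hW hleaf, qf, Matrix.smul_mulVec, dotProduct_smul]
  congr 1
  change _ = ((-((1 / (2 * k : ℚ)) * (castV μ ⬝ᵥ (Rmat G w).mulVec (castV μ))) / 2 : ℚ) : ℂ)
  push_cast
  change -((castV μ ⬝ᵥ (Rmat G w).mulVec (castV μ) : ℚ) : ℂ) / _ = _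
  rw [show (4 * k : ℂ) = 2 * k * 2 by ring, ← div_div]
  ring

theorem Rmat_smul_isSymm (k : ℕ) : ((1 / (2 * k : ℚ)) • Rmat G w).IsSymm :=
  Rmat_isSymm.smul _

theorem Rmat_smul_mulVec_lattice (hW : IsUnit (linkingMatrix G w).det)
    (hleaf : ∀ i, G.degree i = 1 → w i ≤ -2) {k : ℕ} (hk : 0 < k) (y : V2 G → ℤ) :
    ((1 / (2 * k : ℚ)) • Rmat G w).mulVec (castV ((2 * k : ℤ) • (S G w).mulVec y)) = castV y := by
  have hk' : (k : ℚ) ≠ 0 := by exact_mod_cast hk.ne'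
  have h1 : castV ((S G w).mulVec y) = (SQ G w).mulVec (castV y) := castV_mulVec _ _
  rw [castV_smul, h1, Matrix.mulVec_smul, Matrix.smul_mulVec, Matrix.mulVec_mulVec,
    Rmat_mul_SQ hW hleaf, Matrix.one_mulVec, smul_smul]
  push_cast
  rw [mul_one_div_cancel (by positivity), one_smul]

theorem gaussWeight_periodic (hW : IsUnit (linkingMatrix G w).det)
    (hleaf : ∀ i, G.degree i = 1 → w i ≤ -2) {k : ℕ} (hk : 0 < k) :
    IsPeriodic (lattice G w k) (gaussWeight G w k) := by
  intro x h hh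
  obtain ⟨y, rfl⟩ : ∃ y : V2 G → ℤ, (2 * k : ℤ) • (S G w).mulVec y = h := hh
  rw [gaussWeight_eq hW hleaf, gaussWeight_eq hW hleaf, gaussFun_add (Rmat_smul_isSymm k),
    Rmat_smul_mulVec_lattice hW hleaf hk, dotProduct_castV]
  have h1 : gaussFun ((1 / (2 * k : ℚ)) • Rmat G w) ((2 * k : ℤ) • (S G w).mulVec y) = 1 := by
    rw [gaussFun, qf, Rmat_smul_mulVec_lattice hW hleaf hk, dotProduct_castV, e_eq_one_iff]
    refine ⟨-(k * ((S G w).mulVec y ⬝ᵥ y)), ?_⟩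
    rw [smul_dotProduct]
    push_cast
    simp only [smul_eq_mul]
    push_cast
    ring
  rw [h1, mul_one, (e_eq_one_iff _).2 ⟨-(x ⬝ᵥ y), by push_cast; ring⟩, mul_one]

theorem boxModulus_ne_zero (hleaf : ∀ i, G.degree i = 1 → w i ≤ -2) {k : ℕ} (hk : 0 < k)
    (v : V2 G) : (2 * k * M G w v.1 : ℤ) ≠ 0 :=
  mul_ne_zero (by positivity) (M_ne_zero hleaf _)

theorem finite_quotient_lattice (hW : IsUnit (linkingMatrix G w).det)
    (hleaf : ∀ i, G.degree i = 1 → w i ≤ -2) {k : ℕ} (hk : 0 < k) :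
    Finite ((V2 G → ℤ) ⧸ lattice G w k) := by
  rw [lattice_eq hW hleaf hk]
  exact finite_quotient_boxLattice (boxModulus_ne_zero hleaf hk)

theorem norm_gaussWeight (k : ℕ) (μ : V2 G → ℤ) : ‖gaussWeight G w k μ‖ = 1 := by
  rw [gaussWeight]
  have := norm_e_ratCast
    (-((fun v => (μ v : ℚ)) ⬝ᵥ (SQ G w)⁻¹.mulVec (fun v => (μ v : ℚ))) / (4 * k))
  push_cast at this
  exact this

/-- The phase of the Gauss sum. -/
theorem exists_pos_qsum_gaussWeight (hneg : (-(linkingMatrix G w).map (Int.cast : ℤ → ℝ)).PosDef)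
    (hW : IsUnit (linkingMatrix G w).det) (hleaf : ∀ i, G.degree i = 1 → w i ≤ -2)
    {k : ℕ} (hk : 0 < k) :
    ∃ c : ℝ, 0 < c ∧ qsum (lattice G w k) (gaussWeight G w k) =
      c * e (-1 / 8) ^ Fintype.card (V2 G) := by
  classical
  have hk' : (k : ℚ) ≠ 0 := by exact_mod_cast hk.ne'
  have hfin := finite_quotient_lattice hW hleaf hk
  have hTx : ∀ x : V2 G → ℤ, x ⬝ᵥ ((2 * k : ℤ) • S G w).mulVec x =
      2 * (k * (x ⬝ᵥ (S G w).mulVec x)) := by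
    intro x
    rw [Matrix.smul_mulVec, dotProduct_smul, smul_eq_mul, mul_assoc]
  obtain ⟨N₀, hN₀, hN⟩ := exists_pos_qsum_gaussFun ((2 * k : ℤ) • S G w) (S_isSymm.smul _)
    (fun x => by rw [hTx]; exact ⟨_, rfl⟩)
    (fun x hx => by
      rw [hTx]
      have := S_pos hneg hW hx
      positivity)
    ((1 / (2 * k : ℚ)) • Rmat G w) (Rmat_smul_isSymm k) (by
      have : ((2 * k : ℤ) • S G w).map (Int.cast : ℤ → ℚ) = (2 * k : ℚ) • SQ G w := by
        ext i j
        simp only [SQ, Matrix.map_apply, Matrix.smul_apply, smul_eq_mul]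
        push_cast
        rfl
      rw [this, Matrix.smul_mul, Matrix.mul_smul, Rmat_mul_SQ hW hleaf, smul_smul,
        one_div_mul_cancel (by positivity), one_smul])
  set L : ℕ := ∏ v : V2 G, (2 * k * M G w v.1).natAbs with hL
  have hL0 : 0 < L := Finset.prod_pos fun v _ => Int.natAbs_pos.2 (boxModulus_ne_zero hleaf hk v)
  obtain ⟨c, hc0, hc⟩ := hN (N₀ * L) (by positivity) ⟨_, rfl⟩
  have hfinN := finite_quotient_boxLattice (m := fun _ : V2 G => ((N₀ * L : ℕ) : ℤ))
    (fun _ => by positivity)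
  obtain ⟨c', hc'0, hc'⟩ := qsum_comp_hom (Λ := boxLattice fun _ : V2 G => ((N₀ * L : ℕ) : ℤ))
    (AddMonoidHom.id _) (by
      intro x hx
      rw [AddSubgroup.mem_comap, AddMonoidHom.id_apply, lattice_eq hW hleaf hk]
      intro v
      refine dvd_trans ?_ (hx v)
      rw [← Int.natAbs_dvd_natAbs, Int.natAbs_natCast]
      exact dvd_mul_of_dvd_right (Finset.dvd_prod_of_mem _ (Finset.mem_univ v)) _)
    (gaussWeight_periodic hW hleaf hk) (fun x _ => ⟨x, rfl⟩)
  simp only [AddMonoidHom.id_apply] at hc'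
  rw [qsum_congr (gaussWeight_eq hW hleaf k), hc,
    qsum_congr (g := gaussWeight G w k) (fun y => if_pos ⟨y, rfl⟩)] at hc'
  refine ⟨c / c', by positivity, ?_⟩
  have : (c' : ℂ) ≠ 0 := by exact_mod_cast hc'0.ne'
  push_cast
  rw [div_mul_eq_mul_div, eq_div_iff this, hc', mul_comm]

/-- The squared modulus of the Gauss sum. -/
theorem qsum_gaussWeight_mul_conj (hW : IsUnit (linkingMatrix G w).det)
    (hleaf : ∀ i, G.degree i = 1 → w i ≤ -2) {k : ℕ} (hk : 0 < k) :
    qsum (lattice G w k) (gaussWeight G w k) *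
      (starRingEnd ℂ) (qsum (lattice G w k) (gaussWeight G w k)) =
      Nat.card ((V2 G → ℤ) ⧸ lattice G w k) := by
  classical
  have hfin := finite_quotient_lattice hW hleaf hk
  have := Fintype.ofFinite ((V2 G → ℤ) ⧸ lattice G w k)
  have hper := gaussWeight_periodic hW hleaf hk
  set R := (1 / (2 * k : ℚ)) • Rmat G w with hR
  have hRs : R.IsSymm := Rmat_smul_isSymm k
  have hstar : ∀ x, (starRingEnd ℂ) (gaussWeight G w k x) = (gaussWeight G w k x)⁻¹ := by
    intro x
    rw [Complex.inv_def, Complex.normSq_eq_norm_sq, norm_gaussWeight]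
    simp
  have hne : ∀ x, gaussWeight G w k x ≠ 0 := fun x => e_ne_zero _
  have hadd : ∀ y h, gaussWeight G w k (h + y) * (gaussWeight G w k y)⁻¹ =
      gaussWeight G w k h * e ((-(castV h ⬝ᵥ R.mulVec (castV y)) : ℚ) : ℂ) := by
    intro y h
    have h1 : gaussWeight G w k (h + y) = gaussWeight G w k h *
        e ((-(castV h ⬝ᵥ R.mulVec (castV y)) : ℚ) : ℂ) * gaussWeight G w k y := by
      simp only [gaussWeight_eq hW hleaf]
      exact gaussFun_add hRs h y
    rw [h1, mul_assoc, mul_inv_cancel₀ (hne y), mul_one]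
  -- summation over `y` first leaves only the class `h = 0`
  have hchar : ∀ h : V2 G → ℤ, qsum (lattice G w k)
      (fun y => e ((-(castV h ⬝ᵥ R.mulVec (castV y)) : ℚ) : ℂ)) =
      if h ∈ lattice G w k then (Nat.card ((V2 G → ℤ) ⧸ lattice G w k) : ℂ) else 0 := by
    intro h
    have hswap : ∀ y, castV h ⬝ᵥ R.mulVec (castV y) = castV y ⬝ᵥ R.mulVec (castV h) := by
      intro y
      rw [Matrix.dotProduct_mulVec, ← Matrix.mulVec_transpose, hRs.eq, dotProduct_comm]
    have haddy : ∀ y z, e ((-(castV h ⬝ᵥ R.mulVec (castV (y + z))) : ℚ) : ℂ) =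
        e ((-(castV h ⬝ᵥ R.mulVec (castV z)) : ℚ) : ℂ) *
          e ((-(castV h ⬝ᵥ R.mulVec (castV y)) : ℚ) : ℂ) := by
      intro y z
      rw [castV_add, Matrix.mulVec_add, dotProduct_add, ← e_add]
      congr 1; push_cast; ring
    split_ifs with hh
    · obtain ⟨z, rfl⟩ : ∃ z : V2 G → ℤ, (2 * k : ℤ) • (S G w).mulVec z = h := hh
      rw [← mul_one (Nat.card _ : ℂ), ← qsum_const]
      refine qsum_congr fun y => ?_
      rw [hswap, hR, Rmat_smul_mulVec_lattice hW hleaf hk, dotProduct_castV, e_eq_one_iff]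
      exact ⟨-(y ⬝ᵥ z), by push_cast; ring⟩
    · by_cases hint : ∃ z : V2 G → ℤ, R.mulVec (castV h) = castV z
      · exfalso
        obtain ⟨z, hz⟩ := hint
        refine hh ⟨z, ?_⟩
        have h1 := Rmat_smul_mulVec_lattice hW hleaf hk z
        rw [← hz] at h1
        have hk' : (k : ℚ) ≠ 0 := by exact_mod_cast hk.ne'
        have hSR : SQ G w * Rmat G w = 1 := mul_eq_one_comm.1 (Rmat_mul_SQ hW hleaf)
        have h2 := congrArg (fun x => ((2 * k : ℚ) • SQ G w).mulVec x) h1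
        simp only [hR, Matrix.mulVec_mulVec, Matrix.smul_mul, Matrix.mul_smul, hSR, smul_smul] at h2
        rw [one_div_mul_cancel (by positivity), one_smul, Matrix.one_mulVec,
          Matrix.one_mulVec] at h2
        funext v
        have h3 := congrFun h2 v
        simp only [castV] at h3
        exact_mod_cast h3
      · have hex : ∃ i, ¬ ∃ z : ℤ, R.mulVec (castV h) i = z := by
          by_contra! h'
          choose z hz using h'
          exact hint ⟨z, funext hz⟩
        obtain ⟨i, hi⟩ := hex
        refine qsum_eq_zero (c := Pi.single i 1)
          (ζ := e ((-(R.mulVec (castV h) i) : ℚ) : ℂ)) ?_ ?_ ?_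
        · rintro y l ⟨z, rfl⟩
          beta_reduce
          rw [haddy]
          have : R.mulVec (castV (((2 * k : ℤ) • (S G w).mulVecLin) z)) = castV z :=
            Rmat_smul_mulVec_lattice hW hleaf hk z
          rw [this, dotProduct_castV, (e_eq_one_iff _).2 ⟨-(h ⬝ᵥ z), by push_cast; ring⟩, one_mul]
        · intro h1
          obtain ⟨n, hn⟩ := (e_eq_one_iff _).1 h1
          exact hi ⟨-n, by push_cast; linarith⟩
        · intro y
          rw [haddy, hswap (Pi.single i 1)]
          congr 4
          have : castV (Pi.single i 1 : V2 G → ℤ) = Pi.single i 1 := by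
            funext j
            by_cases hj : j = i
            · subst hj; simp [castV]
            · simp [castV, hj]
          rw [this, single_one_dotProduct]
  have hconj : (starRingEnd ℂ) (qsum (lattice G w k) (gaussWeight G w k)) =
      qsum (lattice G w k) fun y => (gaussWeight G w k y)⁻¹ := by
    rw [qsum_eq_sum, qsum_eq_sum, map_sum]
    exact Finset.sum_congr rfl fun x _ => hstar _
  rw [hconj, ← qsum_mul_left]
  calc _ = qsum (lattice G w k) (fun y => qsum (lattice G w k) (fun h =>
        gaussWeight G w k h * e ((-(castV h ⬝ᵥ R.mulVec (castV y)) : ℚ) : ℂ))) := by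
        refine qsum_congr fun y => ?_
        rw [← qsum_add_right hper y, mul_comm, ← qsum_mul_left]
        refine qsum_congr fun h => ?_
        rw [← hadd, mul_comm]
    _ = qsum (lattice G w k) (fun h => gaussWeight G w k h *
        if h ∈ lattice G w k then (Nat.card ((V2 G → ℤ) ⧸ lattice G w k) : ℂ) else 0) := by
        simp only [← hchar, qsum_eq_sum, Finset.mul_sum]
        exact Finset.sum_comm
    _ = _ := by
        rw [qsum_eq_sum, Finset.sum_eq_single (0 : (V2 G → ℤ) ⧸ lattice G w k)]
        · have h0 : (0 : (V2 G → ℤ) ⧸ lattice G w k).out ∈ lattice G w k := by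
            rw [← QuotientAddGroup.eq_zero_iff, QuotientAddGroup.out_eq']
          have h1 : gaussWeight G w k (0 : (V2 G → ℤ) ⧸ lattice G w k).out = 1 := by
            have := hper 0 _ h0
            rw [zero_add] at this
            rw [this, gaussWeight_eq hW hleaf, gaussFun, qf]
            simp [castV, e_zero, dotProduct]
          rw [if_pos h0, h1, one_mul]
        · intro h _ hh
          rw [if_neg, mul_zero]
          rwa [← QuotientAddGroup.eq_zero_iff, QuotientAddGroup.out_eq']
        · intro h; exact absurd (Finset.mem_univ _) h

/-- The quadratic Gauss sum of the lattice `2 k S`: the prefactor is its inverse, up to sign. -/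
theorem prefactor_mul_qsum (hneg : (-(linkingMatrix G w).map (Int.cast : ℤ → ℝ)).PosDef)
    (hW : IsUnit (linkingMatrix G w).det) (hleaf : ∀ i, G.degree i = 1 → w i ≤ -2)
    {k : ℕ} (hk : 0 < k) :
    prefactor G w k * qsum (lattice G w k) (gaussWeight G w k) = (-1) ^ Fintype.card (V1 G) := by
  obtain ⟨c, hc0, hc⟩ := exists_pos_qsum_gaussWeight hneg hW hleaf hk
  have h8 : ‖e (-1 / 8)‖ = 1 := by
    have := norm_e_ratCast (-1 / 8)
    push_cast at this
    exact this
  have h1 := qsum_gaussWeight_mul_conj hW hleaf hk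
  rw [Complex.mul_conj, Complex.normSq_eq_norm_sq, hc, norm_mul, norm_pow, h8, one_pow, mul_one,
    Complex.norm_real, Real.norm_eq_abs, sq_abs] at h1
  have h2 : c ^ 2 = (Nat.card ((V2 G → ℤ) ⧸ lattice G w k) : ℝ) := by exact_mod_cast h1
  have hcard : (Nat.card ((V2 G → ℤ) ⧸ lattice G w k) : ℝ) =
      (2 * k) ^ Fintype.card (V2 G) * ∏ i : V1 G, |(w i.1 : ℝ)| := by
    rw [lattice_eq hW hleaf hk, card_quotient_boxLattice (boxModulus_ne_zero hleaf hk),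
      ← prod_leaves hW hleaf (fun i => |(w i : ℝ)|)]
    push_cast
    rw [← Finset.card_univ, ← Finset.prod_const, ← Finset.prod_mul_distrib]
    refine Finset.prod_congr rfl fun v _ => ?_
    rw [Nat.cast_natAbs]
    push_cast
    rw [abs_mul, M]
    push_cast
    rw [Finset.abs_prod, abs_of_nonneg (by positivity : (0 : ℝ) ≤ 2 * k)]
  have hc' : c = Real.sqrt (2 * k) ^ Fintype.card (V2 G) * ∏ i : V1 G, Real.sqrt |(w i.1 : ℝ)| := by
    have h3 : c = Real.sqrt (c ^ 2) := (Real.sqrt_sq hc0.le).symm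
    rw [h3, h2, hcard, Real.sqrt_eq_iff_mul_self_eq (by positivity) (by positivity), ← sq,
      mul_pow (Real.sqrt _ ^ _), ← pow_mul, mul_comm _ 2, pow_mul, Real.sq_sqrt (by positivity),
      ← Finset.prod_pow]
    congr 1
    exact Finset.prod_congr rfl fun i _ => (Real.sq_sqrt (abs_nonneg _)).symm
  have hcc : ((Real.sqrt (2 * k) : ℝ) : ℂ) ^ Fintype.card (V2 G) *
      ∏ i : V1 G, ((Real.sqrt |(w i.1 : ℝ)| : ℝ) : ℂ) = c := by
    rw [hc']; push_cast; rfl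
  rw [prefactor, hcc, hc]
  have hc0' : (c : ℂ) ≠ 0 := ofReal_ne_zero.2 hc0.ne'
  have he : e ((Fintype.card (V2 G) : ℂ) / 8) * e (-1 / 8) ^ Fintype.card (V2 G) = 1 := by
    rw [← zpow_natCast, e_zpow, ← e_add]
    convert e_zero using 2
    push_cast; ring
  rw [div_mul_eq_mul_div, div_eq_iff hc0']
  linear_combination ((-1) ^ Fintype.card (V1 G) * c) * he

/-- Expansion of `e(Q(x) / k)` into characters, when `2 S x` is integral: complete the square and
translate the Gauss sum. -/
theorem e_Q_mul_qsum (hW : IsUnit (linkingMatrix G w).det)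
    (hleaf : ∀ i, G.degree i = 1 → w i ≤ -2) {k : ℕ} (hk : 0 < k) (x : V2 G → ℚ)
    (hx : ∃ c : V2 G → ℤ, castV c = (2 : ℚ) • (SQ G w).mulVec x) :
    e ((Q G w x : ℚ) / (k : ℂ)) * qsum (lattice G w k) (gaussWeight G w k) =
      qsum (lattice G w k) fun μ => gaussWeight G w k μ * e ((castV μ ⬝ᵥ x : ℚ) / (k : ℂ)) := by
  have hfin := finite_quotient_lattice hW hleaf hk
  have hk' : (k : ℚ) ≠ 0 := by exact_mod_cast hk.ne'
  obtain ⟨c, hc⟩ := hx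
  rw [← qsum_add_right (gaussWeight_periodic hW hleaf hk) (-c), ← qsum_mul_left]
  refine qsum_congr fun μ => ?_
  have hcast : castV (-c) = -castV c := by funext i; simp [castV]
  have hRc : ((1 / (2 * k : ℚ)) • Rmat G w).mulVec (castV (-c)) = -((1 / (k : ℚ)) • x) := by
    rw [hcast, hc, Matrix.mulVec_neg, Matrix.mulVec_smul, Matrix.smul_mulVec, Matrix.mulVec_mulVec,
      Rmat_mul_SQ hW hleaf, Matrix.one_mulVec, smul_smul]
    congr 2
    field_simp
  rw [gaussWeight_eq hW hleaf, gaussFun_add (Rmat_smul_isSymm k), ← gaussWeight_eq hW hleaf, hRc]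
  have hg : gaussFun ((1 / (2 * k : ℚ)) • Rmat G w) (-c) = e (-((Q G w x : ℚ) / (k : ℂ))) := by
    rw [gaussFun, qf, hRc, hcast, hc, Q, neg_dotProduct_neg, dotProduct_smul, smul_dotProduct,
      dotProduct_comm]
    congr 1
    simp only [smul_eq_mul]
    push_cast
    ring
  rw [hg, e_neg, dotProduct_neg, dotProduct_smul, neg_neg]
  have he := e_ne_zero ((Q G w x : ℚ) / (k : ℂ))
  field_simp
  congr 1
  simp only [smul_eq_mul]
  push_cast
  ring_nf

/-- `2 S x` is integral for `x` in the coset of a point of `𝒮`. -/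
theorem exists_castV_eq_two_smul (hW : IsUnit (linkingMatrix G w).det)
    (hleaf : ∀ i, G.degree i = 1 → w i ≤ -2) (x : V2 G → ℚ)
    (hx : ∀ v : V2 G, ∃ (l : leaves G v.1 → ℤˣ) (z : ℤ), x v = point G w v.1 l + z) :
    ∃ c : V2 G → ℤ, castV c = (2 : ℚ) • (SQ G w).mulVec x := by
  choose l z hlz using hx
  have hd : ∀ u v : V2 G, ∀ i : leaves G v.1, ∃ c : ℤ, S G w u v = w i.1 * c := by
    intro u v i
    obtain ⟨c, hc⟩ := leaf_dvd_S hW v u i.2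
    exact ⟨c, by rw [← hc]; exact S_isSymm.apply _ _⟩
  choose c hc using hd
  refine ⟨fun u => ∑ v : V2 G, (S G w u v * (2 * z v + G.degree v.1 - 2) +
    ∑ i : leaves G v.1, c u v i * (l v i : ℤ)), ?_⟩
  funext u
  rw [Pi.smul_apply, smul_eq_mul]
  simp only [castV, Matrix.mulVec, dotProduct, hlz, point]
  push_cast
  rw [Finset.mul_sum]
  refine Finset.sum_congr rfl fun v _ => ?_
  have h1 : ∑ i : leaves G v.1, (c u v i : ℚ) * ((l v i : ℤ) : ℚ) =
      2 * (SQ G w u v * ∑ i : leaves G v.1, ((l v i : ℤ) : ℚ) / (2 * (w i.1 : ℚ))) := by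
    rw [Finset.mul_sum, Finset.mul_sum]
    refine Finset.sum_congr rfl fun i _ => ?_
    have h5 : (w i.1 : ℚ) ≠ 0 := by exact_mod_cast leaf_ne_zero hleaf i.2
    rw [SQ, Matrix.map_apply, hc u v i]
    push_cast
    field_simp
  rw [h1]
  have h2 : SQ G w u v = (S G w u v : ℚ) := rfl
  rw [h2]
  ring

end GaussSum

/-! ### Reduction of the Gauss sum modulo `2k` -/

section Transformation

variable {V : Type*} [Fintype V] [DecidableEq V] {G : SimpleGraph V} [DecidableRel G.Adj]
  {w : V → ℤ}

/-- The factor `e(ᵗx W x / 4k)` of the Gaussian weight, with `W` restricted to the vertices of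
degree at least two. -/
def edgeWeight (G : SimpleGraph V) [DecidableRel G.Adj] (w : V → ℤ) (k : ℕ) (x : V2 G → ℤ) : ℂ :=
  e (((x ⬝ᵥ ((linkingMatrix G w).submatrix Subtype.val Subtype.val).mulVec x : ℤ) : ℂ) / (4 * k))

/-- The factor `∏ e(-a² / 4 k w_i)` of the Gaussian weight coming from the leaves at `v`. -/
def leafWeight (G : SimpleGraph V) [DecidableRel G.Adj] (w : V → ℤ) (k : ℕ) (v : V) (a : ℤ) : ℂ :=
  ∏ i ∈ leaves G v, e (-((a : ℂ) ^ 2 / (4 * k * w i)))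

/-- Since `S⁻¹` is minus the block of `W` at the vertices of degree at least two, corrected by
`∑ 1 / w_i` on the diagonal, the Gaussian weight splits off one factor for each leaf. -/
theorem gaussWeight_eq_mul (hW : IsUnit (linkingMatrix G w).det)
    (hleaf : ∀ i, G.degree i = 1 → w i ≤ -2) (k : ℕ) (μ : V2 G → ℤ) :
    gaussWeight G w k μ = edgeWeight G w k μ * ∏ v : V2 G, leafWeight G w k v.1 (μ v) := by
  simp only [leafWeight, ← e_sum]
  rw [gaussWeight, edgeWeight, ← e_add, SQ_inv hW hleaf, Rmat, Matrix.sub_mulVec,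
    dotProduct_sub]
  congr 1
  have h1 : (fun v => (μ v : ℚ)) ⬝ᵥ
      (((linkingMatrix G w).submatrix Subtype.val Subtype.val).map (Int.cast : ℤ → ℚ)).mulVec
      (fun v : V2 G => (μ v : ℚ)) =
      ((μ ⬝ᵥ ((linkingMatrix G w).submatrix Subtype.val Subtype.val).mulVec μ : ℤ) : ℚ) := by
    rw [← dotProduct_castV, castV_mulVec]; rfl
  rw [h1]
  have h2 : (((fun v => (μ v : ℚ)) ⬝ᵥ (Matrix.diagonal fun v : V2 G => ∑ i ∈ leaves G v.1,
      1 / (w i : ℚ)).mulVec (fun v => (μ v : ℚ)) : ℚ) : ℂ) =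
      ∑ v : V2 G, ∑ i ∈ leaves G v.1, (μ v : ℂ) ^ 2 / w i := by
    simp only [dotProduct, Matrix.mulVec_diagonal]
    push_cast
    refine Finset.sum_congr rfl fun v _ => ?_
    rw [Finset.sum_mul, Finset.mul_sum]
    refine Finset.sum_congr rfl fun i _ => ?_
    ring
  push_cast
  have h3 : ∑ v : V2 G, ∑ i ∈ leaves G v.1, -((μ v : ℂ) ^ 2 / (4 * k * w i)) =
      -(∑ v : V2 G, ∑ i ∈ leaves G v.1, (μ v : ℂ) ^ 2 / w i) / (4 * k) := by
    rw [neg_div, Finset.sum_div, ← Finset.sum_neg_distrib]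
    refine Finset.sum_congr rfl fun v _ => ?_
    rw [Finset.sum_div, ← Finset.sum_neg_distrib]
    refine Finset.sum_congr rfl fun i _ => ?_
    rw [div_div, mul_comm (w i : ℂ)]
  rw [h3, h2]
  ring

theorem edgeWeight_periodic {k : ℕ} (hk : 0 < k) :
    IsPeriodic (boxLattice fun _ : V2 G => (2 * k : ℤ)) (edgeWeight G w k) := by
  intro x h hh
  choose y hy using hh
  have h1 : h = (2 * k : ℤ) • y := funext hy
  set T := (linkingMatrix G w).submatrix (Subtype.val : V2 G → V) Subtype.val with hT
  have hTs : T.IsSymm := linkingMatrix_isSymm.submatrix _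
  have h2 : y ⬝ᵥ T.mulVec x = x ⬝ᵥ T.mulVec y := by
    rw [Matrix.dotProduct_mulVec, ← Matrix.mulVec_transpose, hTs.eq, dotProduct_comm]
  have h3 : (x + h) ⬝ᵥ T.mulVec (x + h) = x ⬝ᵥ T.mulVec x +
      4 * k * (x ⬝ᵥ T.mulVec y + k * (y ⬝ᵥ T.mulVec y)) := by
    rw [h1]
    simp only [Matrix.mulVec_add, Matrix.mulVec_smul, dotProduct_add, add_dotProduct,
      dotProduct_smul, smul_dotProduct, smul_eq_mul, h2]
    ring
  have hk' : (k : ℂ) ≠ 0 := by exact_mod_cast hk.ne'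
  rw [edgeWeight, edgeWeight, h3,
    ← e_add_int (((x ⬝ᵥ T.mulVec x : ℤ) : ℂ) / (4 * k)) (x ⬝ᵥ T.mulVec y + k * (y ⬝ᵥ T.mulVec y))]
  congr 1
  push_cast
  field_simp

/-- The contribution of the leaves at `v`: the sum of `g`, weighted by the leaf weight, over the
classes modulo `2 k M_v` above the class of `b` modulo `2 k`. -/
def localSum (G : SimpleGraph V) [DecidableRel G.Adj] (w : V → ℤ) (k : ℕ) (v : V) (g : ℤ → ℂ)
    (b : ℤ) : ℂ :=
  ∑ j ∈ Finset.range (M G w v).natAbs,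
    leafWeight G w k v (b + 2 * k * j) * g (b + 2 * k * j)

theorem leafWeight_periodic (hleaf : ∀ i, G.degree i = 1 → w i ≤ -2) {k : ℕ} (hk : 0 < k) (v : V)
    (a : ℤ) : leafWeight G w k v (a + 2 * k * M G w v) = leafWeight G w k v a := by
  refine Finset.prod_congr rfl fun i hi => ?_
  obtain ⟨c, hc⟩ := leaf_dvd_M (w := w) hi
  have h5 : (w i : ℂ) ≠ 0 := by exact_mod_cast leaf_ne_zero hleaf hi
  have hk' : (k : ℂ) ≠ 0 := by exact_mod_cast hk.ne'
  rw [← e_add_int (-((a : ℂ) ^ 2 / (4 * k * w i))) (-(a * c + k * w i * c ^ 2)), hc]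
  congr 1
  push_cast
  field_simp
  ring

theorem localSum_periodic (hleaf : ∀ i, G.degree i = 1 → w i ≤ -2) {k : ℕ} (hk : 0 < k) (v : V)
    {g : ℤ → ℂ} (hg : ∀ a, g (a + 2 * k * M G w v) = g a) (b : ℤ) :
    localSum G w k v g (b + 2 * k) = localSum G w k v g b := by
  set f : ℤ → ℂ := fun j => leafWeight G w k v (b + 2 * k * j) * g (b + 2 * k * j) with hf
  have hfM : ∀ j, f (j + M G w v) = f j := by
    intro j
    have h1 : b + 2 * k * (j + M G w v) = (b + 2 * k * j) + 2 * k * M G w v := by ring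
    simp only [hf, h1, leafWeight_periodic hleaf hk, hg]
  have hper : ∀ j, f (j + (M G w v).natAbs) = f j := by
    intro j
    rcases Int.natAbs_eq (M G w v) with h | h
    · rw [← h, hfM]
    · rw [← hfM (j + _)]
      congr 1; omega
  have := sum_range_comp_of_injective (Int.natAbs_pos.2 (M_ne_zero hleaf v)) hper (fun j => j + 1)
    (fun a b h => by simpa using h)
  rw [localSum, localSum]
  refine Eq.trans (Finset.sum_congr rfl fun j _ => ?_) this
  simp only [hf]
  congr 2 <;> ring

theorem sum_range_mul_eq (m n : ℕ) (f : ℕ → ℂ) :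
    ∑ a ∈ Finset.range (m * n), f a =
      ∑ b ∈ Finset.range m, ∑ j ∈ Finset.range n, f (b + m * j) := by
  rw [mul_comm, ← Fin.sum_univ_eq_sum_range, ← finProdFinEquiv.sum_comp, Fintype.sum_prod_type,
    Finset.sum_comm, ← Fin.sum_univ_eq_sum_range (fun b => ∑ j ∈ Finset.range n, f (b + m * j))]
  refine Finset.sum_congr rfl fun b _ => ?_
  rw [← Fin.sum_univ_eq_sum_range (fun j => f (b + m * j))]
  rfl

/-- The Gauss sum over the lattice `2 k S`, with factorised weights, reduces to a sum modulo `2 k`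
of products of local sums. -/
theorem qsum_gaussWeight_mul_prod (hW : IsUnit (linkingMatrix G w).det)
    (hleaf : ∀ i, G.degree i = 1 → w i ≤ -2) {k : ℕ} (hk : 0 < k) (g : V2 G → ℤ → ℂ)
    (hg : ∀ v a, g v (a + 2 * k * M G w v.1) = g v a) :
    qsum (lattice G w k) (fun μ => gaussWeight G w k μ * ∏ v, g v (μ v)) =
      qsum (boxLattice fun _ : V2 G => (2 * k : ℤ)) (fun b => edgeWeight G w k b *
        ∏ v : V2 G, localSum G w k v.1 (g v) (b v)) := by
  have h2k : ∀ _ : V2 G, (2 * k : ℤ) ≠ 0 := fun _ => by positivity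
  have hgper : ∀ (f : ℤ → ℂ) (n : ℤ), (∀ a, f (a + n) = f a) → ∀ a h, n ∣ h → f (a + h) = f a := by
    rintro f n hf a _ ⟨c, rfl⟩
    have := Function.Periodic.int_mul (f := f) (c := n) hf c a
    rwa [mul_comm, Int.cast_id] at this
  have hfac : ∀ μ : V2 G → ℤ, gaussWeight G w k μ * ∏ v, g v (μ v) =
      edgeWeight G w k μ * ∏ v : V2 G, (leafWeight G w k v.1 (μ v) * g v (μ v)) := by
    intro μ
    rw [gaussWeight_eq_mul hW hleaf, Finset.prod_mul_distrib, mul_assoc]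
  rw [lattice_eq hW hleaf hk, qsum_boxLattice (boxModulus_ne_zero hleaf hk), qsum_boxLattice h2k]
  · simp only [hfac]
    set F : V2 G → ℤ → ℂ := fun v a => leafWeight G w k v.1 a * g v a with hF
    -- insert the reduction modulo `2 k` of the summation variable
    have hins : ∀ x : (∀ v : V2 G, Fin (2 * k * M G w v.1 : ℤ).natAbs),
        edgeWeight G w k (fun v => ((x v : ℕ) : ℤ)) * ∏ v : V2 G, F v ((x v : ℕ) : ℤ) =
        ∑ b : (∀ _ : V2 G, Fin (2 * k : ℤ).natAbs), edgeWeight G w k (fun v => ((b v : ℕ) : ℤ)) *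
          ∏ v : V2 G, if (x v : ℕ) % (2 * k) = b v then F v ((x v : ℕ) : ℤ) else 0 := by
      intro x
      have hlt : ∀ v, (x v : ℕ) % (2 * k) < (2 * k : ℤ).natAbs := fun v => by
        have : (2 * k : ℤ).natAbs = 2 * k := by omega
        rw [this]; exact Nat.mod_lt _ (by omega)
      rw [Finset.sum_eq_single (fun v => ⟨(x v : ℕ) % (2 * k), hlt v⟩)]
      · simp only [if_true]
        congr 1
        have := edgeWeight_periodic (G := G) (w := w) hk
          (fun v => (((x v : ℕ) % (2 * k) : ℕ) : ℤ))
          (fun v => 2 * k * ((x v : ℕ) / (2 * k) : ℕ)) (fun v => ⟨_, rfl⟩)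
        rw [← this]
        congr 1
        funext v
        simp only [Pi.add_apply]
        have := Nat.mod_add_div (x v : ℕ) (2 * k)
        exact_mod_cast this.symm
      · intro b _ hb
        have : ∃ v, (x v : ℕ) % (2 * k) ≠ b v := by
          by_contra! h
          exact hb (funext fun v => Fin.ext (h v).symm)
        obtain ⟨v, hv⟩ := this
        rw [Finset.prod_eq_zero (Finset.mem_univ v) (if_neg hv), mul_zero]
      · intro h; exact absurd (Finset.mem_univ _) h
    simp only [hF] at hins
    rw [Finset.sum_congr rfl fun x _ => hins x, Finset.sum_comm]
    refine Finset.sum_congr rfl fun b _ => ?_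
    rw [← Finset.mul_sum]
    congr 1
    rw [sum_pi_fin_prod (fun v : V2 G => (2 * k * M G w v.1 : ℤ).natAbs)
      (fun v a => if a % (2 * k) = b v then F v a else 0)]
    refine Finset.prod_congr rfl fun v _ => ?_
    have hn : (2 * k * M G w v.1 : ℤ).natAbs = (2 * k) * (M G w v.1).natAbs := by
      rw [Int.natAbs_mul]; congr 1
    have hb : (b v : ℕ) < 2 * k := lt_of_lt_of_eq (b v).2 (by omega)
    rw [hn, sum_range_mul_eq, Finset.sum_eq_single (b v : ℕ)]
    · rw [localSum]
      refine Finset.sum_congr rfl fun j _ => ?_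
      rw [if_pos (by rw [Nat.add_mul_mod_self_left, Nat.mod_eq_of_lt hb])]
      simp only [hF]
      push_cast
      rfl
    · intro c hc hcb
      refine Finset.sum_eq_zero fun j _ => if_neg ?_
      rwa [Nat.add_mul_mod_self_left, Nat.mod_eq_of_lt (Finset.mem_range.1 hc)]
    · intro h; exact absurd (Finset.mem_range.2 hb) h
  · intro x h hh
    beta_reduce
    rw [edgeWeight_periodic hk x h hh]
    refine congrArg (edgeWeight G w k x * ·) (Finset.prod_congr rfl fun v _ => ?_)
    exact hgper (localSum G w k v.1 (g v)) (2 * k) (localSum_periodic hleaf hk v.1 (hg v)) (x v)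
      (h v)
      (hh v)
  · intro x h hh
    have h1 := gaussWeight_periodic hW hleaf hk x h (by rwa [lattice_eq hW hleaf hk])
    beta_reduce
    rw [h1]
    refine congrArg (gaussWeight G w k x * ·) (Finset.prod_congr rfl fun v _ => ?_)
    exact hgper (g v) (2 * k * M G w v.1) (hg v) (x v) (h v) (hh v)

end Transformation

/-! ### The local functions -/

section LocalFunctions

variable {V : Type*} [Fintype V] [DecidableEq V] {G : SimpleGraph V} [DecidableRel G.Adj]
  {w : V → ℤ}

/-- The summand `e(-a² / 4 k n) (e(a / 2 k n) exp(-s / 2 n) - e(-a / 2 k n) exp(s / 2 n))` of the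
contribution of a leaf of weight `n`. -/
def leafTerm (k : ℕ) (n : ℤ) (a : ℤ) (s : ℂ) : ℂ :=
  e (-((a : ℂ) ^ 2 / (4 * k * n))) * (e ((a : ℂ) / (2 * k * n)) * cexp (-s / (2 * n)) -
    (e ((a : ℂ) / (2 * k * n)) * cexp (-s / (2 * n)))⁻¹)

/-- The contribution of a leaf of weight `n`: the sum of `leafTerm` over the classes modulo `2kn`
that lie above the class of `b` modulo `2k`. -/
def leafSum (k : ℕ) (n : ℤ) (b : ℤ) (s : ℂ) : ℂ :=
  ∑ j ∈ Finset.range n.natAbs, leafTerm k n (b + 2 * k * j) s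

/-- The contribution of a vertex together with its leaves, the other variables being fixed modulo
`2 k`. -/
def localK (G : SimpleGraph V) [DecidableRel G.Adj] (w : V → ℤ) (k : ℕ) (v : V) (b : ℤ) (s : ℂ) :
    ℂ :=
  (e ((b : ℂ) / (2 * k)) * cexp (-s / 2) - (e ((b : ℂ) / (2 * k)) * cexp (-s / 2))⁻¹) ^
    ((2 : ℤ) - G.degree v) * ∏ i ∈ leaves G v, leafSum k (w i) b s

theorem leafTerm_periodic {k : ℕ} (hk : 0 < k) {n : ℤ} (hn : n ≠ 0) (a : ℤ) (s : ℂ) :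
    leafTerm k n (a + 2 * k * n) s = leafTerm k n a s := by
  have h5 : (n : ℂ) ≠ 0 := by exact_mod_cast hn
  have hk' : (k : ℂ) ≠ 0 := by exact_mod_cast hk.ne'
  have h1 : e (((a + 2 * k * n : ℤ) : ℂ) / (2 * k * n)) = e ((a : ℂ) / (2 * k * n)) := by
    rw [← e_add_int ((a : ℂ) / (2 * k * n)) 1]
    congr 1; push_cast; field_simp
  have h2 : e (-(((a + 2 * k * n : ℤ) : ℂ) ^ 2 / (4 * k * n))) =
      e (-((a : ℂ) ^ 2 / (4 * k * n))) := by
    rw [← e_add_int (-((a : ℂ) ^ 2 / (4 * k * n))) (-(a + k * n))]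
    congr 1; push_cast; field_simp; ring
  rw [leafTerm, leafTerm, h1, h2]

theorem leafTerm_natAbs_periodic {k : ℕ} (hk : 0 < k) {n : ℤ} (hn : n ≠ 0) (b : ℤ) (s : ℂ) (j : ℤ) :
    leafTerm k n (b + 2 * k * (j + n.natAbs)) s = leafTerm k n (b + 2 * k * j) s := by
  rcases Int.natAbs_eq n with h | h
  · rw [← h, ← leafTerm_periodic hk hn (b + 2 * k * j)]
    congr 1; ring
  · rw [← leafTerm_periodic hk hn]
    congr 1
    have : ((n.natAbs : ℕ) : ℤ) = -n := by omega
    rw [this]; ring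

theorem leafSum_periodic {k : ℕ} (hk : 0 < k) {n : ℤ} (hn : n ≠ 0) (b : ℤ) (s : ℂ) :
    leafSum k n (b + 2 * k) s = leafSum k n b s := by
  have := sum_range_comp_of_injective (Int.natAbs_pos.2 hn)
    (h := fun j => leafTerm k n (b + 2 * k * j) s) (leafTerm_natAbs_periodic hk hn b s)
    (fun j => j + 1) (fun a b h => by simpa using h)
  rw [leafSum, leafSum]
  refine Eq.trans (Finset.sum_congr rfl fun j _ => ?_) this
  congr 1; ring

/-- The contribution of a leaf is odd in `b` at `s = 0`. -/
theorem leafSum_neg {k : ℕ} (hk : 0 < k) {n : ℤ} (hn : n ≠ 0) (b : ℤ) :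
    leafSum k n (-b) 0 = -leafSum k n b 0 := by
  have := sum_range_comp_of_injective (Int.natAbs_pos.2 hn)
    (h := fun j => leafTerm k n (b + 2 * k * j) 0) (leafTerm_natAbs_periodic hk hn b 0)
    (fun j => -j) (fun a b h => by
      have : a - b = -(-a - -b) := by ring
      rw [this]; exact (dvd_neg).2 h)
  rw [leafSum, leafSum, ← this, ← Finset.sum_neg_distrib]
  refine Finset.sum_congr rfl fun j _ => ?_
  have h1 : ((-b + 2 * k * j : ℤ) : ℂ) = -((b + 2 * k * -j : ℤ) : ℂ) := by push_cast; ring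
  rw [leafTerm, leafTerm, h1, neg_sq, neg_div]
  generalize ((b + 2 * k * -j : ℤ) : ℂ) = c
  rw [e_neg (c / (2 * k * n))]
  simp only [neg_zero, zero_div, Complex.exp_zero, mul_one, inv_inv]
  ring

/-- The contribution of a leaf vanishes at `s = 0` when `k ∣ b`: it is then odd under `b ↦ -b`,
which fixes the class of `b` modulo `2 k`. -/
theorem leafSum_eq_zero {k : ℕ} (hk : 0 < k) {n : ℤ} (hn : n ≠ 0) {b : ℤ} (hb : (k : ℤ) ∣ b) :
    leafSum k n b 0 = 0 := by
  obtain ⟨c, rfl⟩ := hb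
  have h1 := leafSum_neg hk hn (k * c)
  have h2 : leafSum k n (-(k * c)) 0 = leafSum k n (k * c) 0 := by
    have := Function.Periodic.int_mul (f := fun b => leafSum k n b 0) (c := (2 * k : ℤ))
      (fun b => leafSum_periodic hk hn b 0) (-c) (k * c)
    beta_reduce at this
    rw [← this]
    congr 1
    simp only [Int.cast_id]; ring
  rw [h2] at h1
  linear_combination (1 / 2 : ℂ) * h1

/-- The factor of `F(f₁; t)` at a vertex. -/
def vertexFactor (G : SimpleGraph V) [DecidableRel G.Adj] (w : V → ℤ) (k : ℕ) (v : V) (s : ℂ)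
    (a : ℤ) : ℂ :=
  Gv G w v (zeta (2 * k * M G w v) ^ a * cexp (-s / (2 * (M G w v : ℂ))))

theorem vertexFactor_eq (hleaf : ∀ i, G.degree i = 1 → w i ≤ -2) {k : ℕ} (hk : 0 < k) (v : V)
    (s : ℂ) (a : ℤ) : vertexFactor G w k v s a =
      (e ((a : ℂ) / (2 * k)) * cexp (-s / 2) - (e ((a : ℂ) / (2 * k)) * cexp (-s / 2))⁻¹) ^
        ((2 : ℤ) - G.degree v) * ∏ i ∈ leaves G v, (e ((a : ℂ) / (2 * k * w i)) *
          cexp (-s / (2 * w i)) - (e ((a : ℂ) / (2 * k * w i)) * cexp (-s / (2 * w i)))⁻¹) := by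
  have hM : (M G w v : ℂ) ≠ 0 := by exact_mod_cast M_ne_zero hleaf v
  have hk' : (k : ℂ) ≠ 0 := by exact_mod_cast hk.ne'
  have hpow : ∀ (n : ℤ) (y : ℂ), (n : ℂ) = M G w v * y →
      (zeta (2 * k * M G w v) ^ a * cexp (-s / (2 * (M G w v : ℂ)))) ^ n =
      e ((a : ℂ) / (2 * k) * y) * cexp (-s / 2 * y) := by
    intro n y hy
    rw [mul_zpow, zeta, ← zpow_mul, e_zpow, ← Complex.exp_int_mul, hy]
    congr 2
    · push_cast; rw [hy]; field_simp
    · field_simp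
  rw [vertexFactor, Gv, zpow_neg, hpow _ 1 (by ring), mul_one, mul_one]
  congr 1
  refine Finset.prod_congr rfl fun i hi => ?_
  have h5 : (w i : ℂ) ≠ 0 := by exact_mod_cast leaf_ne_zero hleaf hi
  rw [zpow_neg, hpow _ (1 / w i) (by rw [Int.cast_div (leaf_dvd_M hi) h5]; ring)]
  rw [show (a : ℂ) / (2 * k) * (1 / w i) = a / (2 * k * w i) by field_simp,
    show -s / 2 * (1 / (w i : ℂ)) = -s / (2 * w i) by field_simp]

theorem vertexFactor_periodic (hleaf : ∀ i, G.degree i = 1 → w i ≤ -2) {k : ℕ} (hk : 0 < k) (v : V)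
    (s : ℂ) (a : ℤ) :
    vertexFactor G w k v s (a + 2 * k * M G w v) = vertexFactor G w k v s a := by
  have hM : (2 * k * M G w v : ℂ) ≠ 0 := by
    have := M_ne_zero hleaf v
    exact_mod_cast (by positivity : (2 * k * M G w v : ℤ) ≠ 0)
  have hz : zeta (2 * k * M G w v) ^ (2 * k * M G w v) = 1 := by
    rw [zeta, e_zpow]
    refine Eq.trans ?_ (e_int 1)
    congr 1
    push_cast
    exact mul_one_div_cancel hM
  rw [vertexFactor, zpow_add₀ (show zeta (2 * k * M G w v) ≠ 0 from e_ne_zero _), hz, mul_one]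
  rfl

/-- The local sum of the factors at a vertex factorises over the leaves, by the Chinese remainder
theorem. -/
theorem localSum_vertexFactor (hW : IsUnit (linkingMatrix G w).det)
    (hleaf : ∀ i, G.degree i = 1 → w i ≤ -2) {k : ℕ} (hk : 0 < k) (v : V) (s : ℂ) (b : ℤ) :
    localSum G w k v (vertexFactor G w k v s) b = localK G w k v b s := by
  have hk' : (k : ℂ) ≠ 0 := by exact_mod_cast hk.ne'
  have hterm : ∀ j : ℤ,
      leafWeight G w k v (b + 2 * k * j) * vertexFactor G w k v s (b + 2 * k * j) =
      (e ((b : ℂ) / (2 * k)) * cexp (-s / 2) - (e ((b : ℂ) / (2 * k)) * cexp (-s / 2))⁻¹) ^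
        ((2 : ℤ) - G.degree v) * ∏ i ∈ leaves G v, leafTerm k (w i) (b + 2 * k * j) s := by
    intro j
    have h1 : e (((b + 2 * k * j : ℤ) : ℂ) / (2 * k)) = e ((b : ℂ) / (2 * k)) := by
      rw [← e_add_int ((b : ℂ) / (2 * k)) j]
      congr 1; push_cast; field_simp
    rw [vertexFactor_eq hleaf hk, h1, mul_left_comm, leafWeight, ← Finset.prod_mul_distrib]
    rfl
  have hnat : (M G w v).natAbs = ∏ i ∈ leaves G v, (w i).natAbs := map_prod Int.natAbsHom _ _
  rw [localSum, localK, Finset.sum_congr rfl fun (j : ℕ) _ => hterm (j : ℤ), ← Finset.mul_sum,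
    hnat]
  congr 1
  exact sum_range_prod_of_coprime (leaves G v) (fun i => (w i).natAbs)
    (fun i hi => Int.natAbs_pos.2 (leaf_ne_zero hleaf hi))
    (fun i hi j hj hij => Int.isCoprime_iff_nat_coprime.1 (isCoprime_leaves hW hi hj hij))
    (fun i j => leafTerm k (w i) (b + 2 * k * j) s)
    (fun i hi a => leafTerm_natAbs_periodic hk (leaf_ne_zero hleaf hi) b s a)

end LocalFunctions

/-! ### Poles of the local functions -/

section LocalAnalysis

/-- An analytic function vanishing at `0` is divisible by `s`. -/
theorem exists_analytic_factor {f : ℂ → ℂ} (hf : AnalyticAt ℂ f 0) (h0 : f 0 = 0) :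
    ∃ g : ℂ → ℂ, AnalyticAt ℂ g 0 ∧ g 0 = deriv f 0 ∧ ∀ s, f s = s * g s := by
  refine ⟨dslope f 0, ?_, dslope_same f 0, fun s => ?_⟩
  · obtain ⟨p, hp⟩ := hf
    exact hp.has_fpower_series_dslope_fslope.analyticAt
  · have := sub_smul_dslope f 0 s
    rw [h0, sub_zero, sub_zero, smul_eq_mul] at this
    exact this.symm

theorem analyticAt_sub_inv (c : ℂ) (x z : ℂ) :
    AnalyticAt ℂ (fun s : ℂ => e c * cexp (-s / x) - (e c * cexp (-s / x))⁻¹) z := by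
  have h1 : AnalyticAt ℂ (fun s : ℂ => e c * cexp (-s / x)) z := by
    simp only [div_eq_mul_inv]
    fun_prop
  exact h1.sub (h1.inv (mul_ne_zero (e_ne_zero _) (Complex.exp_ne_zero _)))

theorem analyticAt_leafSum (k : ℕ) (n b : ℤ) (z : ℂ) : AnalyticAt ℂ (leafSum k n b) z := by
  have : leafSum k n b = fun s => ∑ j ∈ Finset.range n.natAbs, leafTerm k n (b + 2 * k * j) s := rfl
  rw [this]
  refine Finset.analyticAt_fun_sum _ fun j _ => ?_
  exact analyticAt_const.mul (analyticAt_sub_inv _ _ _)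

theorem e_half_sub_inv_eq_zero_iff {k : ℕ} (hk : 0 < k) (b : ℤ) :
    e ((b : ℂ) / (2 * k)) - (e ((b : ℂ) / (2 * k)))⁻¹ = 0 ↔ (k : ℤ) ∣ b := by
  have hk' : (k : ℂ) ≠ 0 := by exact_mod_cast hk.ne'
  have hkq : (k : ℚ) ≠ 0 := by exact_mod_cast hk.ne'
  have h1 : e ((b : ℂ) / (2 * k)) * e ((b : ℂ) / (2 * k)) = e (((b / k : ℚ)) : ℂ) := by
    rw [← e_add]; congr 1; push_cast; field_simp; norm_num
  rw [sub_eq_zero, ← mul_eq_one_iff_eq_inv₀ (e_ne_zero _), h1, e_eq_one_iff]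
  constructor
  · rintro ⟨n, hn⟩
    refine ⟨n, ?_⟩
    rw [div_eq_iff hkq] at hn
    rw [mul_comm]
    exact_mod_cast hn
  · rintro ⟨n, rfl⟩
    refine ⟨n, ?_⟩
    push_cast; field_simp

variable {V : Type*} [Fintype V] [DecidableEq V] {G : SimpleGraph V} [DecidableRel G.Adj]
  {w : V → ℤ}

theorem localK_zero (k : ℕ) (v : V) (b : ℤ) : localK G w k v b 0 =
    (e ((b : ℂ) / (2 * k)) - (e ((b : ℂ) / (2 * k)))⁻¹) ^ ((2 : ℤ) - G.degree v) *
      ∏ i ∈ leaves G v, leafSum k (w i) b 0 := by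
  simp [localK]

theorem analyticAt_localK {k : ℕ} (hk : 0 < k) (v : V) {b : ℤ} (hb : ¬ (k : ℤ) ∣ b) :
    AnalyticAt ℂ (localK G w k v b) 0 := by
  have h1 := analyticAt_sub_inv ((b : ℂ) / (2 * k)) 2 0
  refine (h1.zpow ?_).mul (Finset.analyticAt_fun_prod _ fun i _ => analyticAt_leafSum _ _ _ _)
  simpa [e_half_sub_inv_eq_zero_iff hk b] using hb

/-- For `k ∣ b` the contribution of `v` has order at least `|v̄| + 2 - deg v` at `s = 0`: each
contribution of a leaf vanishes there. -/
theorem localK_eq_zpow_mul (hleaf : ∀ i, G.degree i = 1 → w i ≤ -2) {k : ℕ} (hk : 0 < k) (v : V)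
    {b : ℤ} (hb : (k : ℤ) ∣ b) : ∃ g : ℂ → ℂ, AnalyticAt ℂ g 0 ∧
      ∀ᶠ s in 𝓝[≠] (0 : ℂ), localK G w k v b s =
        s ^ (((leaves G v).card : ℤ) + 2 - G.degree v) * g s := by
  set y := e ((b : ℂ) / (2 * k)) with hy
  have hy1 : y - y⁻¹ = 0 := (e_half_sub_inv_eq_zero_iff hk b).2 hb
  have hy0 : y ≠ 0 := e_ne_zero _
  obtain ⟨σ, hσ, hσ0, hσs⟩ := exists_analytic_factor (analyticAt_sub_inv ((b : ℂ) / (2 * k)) 2 0)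
    (by simpa using hy1)
  have hσne : σ 0 ≠ 0 := by
    have hd1 : HasDerivAt (fun s : ℂ => y * cexp (-s / 2)) (y * (cexp (-0 / 2) * (-1 / 2))) 0 :=
      (((hasDerivAt_id (0 : ℂ)).neg.div_const 2).cexp).const_mul y
    have hd2 := hd1.sub (hd1.inv (mul_ne_zero hy0 (Complex.exp_ne_zero _)))
    have hd3 : deriv (fun s : ℂ => e ((b : ℂ) / (2 * k)) * cexp (-s / 2) -
        (e ((b : ℂ) / (2 * k)) * cexp (-s / 2))⁻¹) 0 = _ := hd2.deriv
    rw [hσ0, hd3]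
    simp only [neg_zero, zero_div, Complex.exp_zero, mul_one, one_mul]
    have h2 : y ^ 2 = 1 := by
      have : y * (y - y⁻¹) = 0 := by rw [hy1, mul_zero]
      rw [mul_sub, mul_inv_cancel₀ hy0] at this
      linear_combination this
    rw [h2]
    intro h
    apply hy0
    linear_combination (-1 : ℂ) * h
  have hℓ : ∀ i ∈ leaves G v, ∃ g : ℂ → ℂ, AnalyticAt ℂ g 0 ∧
      ∀ s, leafSum k (w i) b s = s * g s := by
    intro i hi
    obtain ⟨g, hg, _, hgs⟩ := exists_analytic_factor (analyticAt_leafSum k (w i) b 0)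
      (leafSum_eq_zero hk (leaf_ne_zero hleaf hi) hb)
    exact ⟨g, hg, hgs⟩
  choose! ℓ hℓ hℓs using hℓ
  refine ⟨fun s => σ s ^ ((2 : ℤ) - G.degree v) * ∏ i ∈ leaves G v, ℓ i s,
    (hσ.zpow hσne).mul (Finset.analyticAt_fun_prod _ hℓ), ?_⟩
  filter_upwards [self_mem_nhdsWithin] with s hs
  have hs : s ≠ 0 := hs
  rw [localK, hσs, Finset.prod_congr rfl fun i hi => hℓs i hi s, Finset.prod_mul_distrib,
    Finset.prod_const, mul_zpow, add_sub_assoc, zpow_add₀ hs, zpow_natCast]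
  ring

/-- The order of the local function is nonnegative for `k ∤ b` and at least `|v̄| + 2 - deg v` for
`k ∣ b`. -/
theorem le_meromorphicOrderAt_localK (hleaf : ∀ i, G.degree i = 1 → w i ≤ -2) {k : ℕ} (hk : 0 < k)
    (v : V) (b : ℤ) : MeromorphicAt (localK G w k v b) 0 ∧
      ((min 0 (((leaves G v).card : ℤ) + 2 - G.degree v) : ℤ) : WithTop ℤ) ≤
        meromorphicOrderAt (localK G w k v b) 0 := by
  by_cases hb : (k : ℤ) ∣ b
  · obtain ⟨g, hg, hgs⟩ := localK_eq_zpow_mul hleaf hk v hb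
    set n := ((leaves G v).card : ℤ) + 2 - G.degree v with hn
    have hid : MeromorphicAt (fun s : ℂ => s) 0 := MeromorphicAt.id 0
    have hz : MeromorphicAt (fun s : ℂ => s ^ n) 0 := hid.fun_zpow n
    have hm : MeromorphicAt (fun s : ℂ => s ^ n * g s) 0 := hz.mul hg.meromorphicAt
    refine ⟨hm.congr (hgs.mono fun s hs => hs.symm), ?_⟩
    rw [meromorphicOrderAt_congr hgs]
    have h1 := meromorphicOrderAt_mul hz hg.meromorphicAt
    have h2 : meromorphicOrderAt (fun s : ℂ => s ^ n) 0 = n := by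
      have := meromorphicOrderAt_zpow_id_sub_const (𝕜 := ℂ) (x := 0) (n := n)
      simp only [sub_zero] at this
      exact this
    have h3 : (0 : WithTop ℤ) ≤ meromorphicOrderAt g 0 := hg.meromorphicOrderAt_nonneg
    calc ((min 0 n : ℤ) : WithTop ℤ) ≤ (n : WithTop ℤ) := by exact_mod_cast min_le_right _ _
      _ ≤ (n : WithTop ℤ) + meromorphicOrderAt g 0 := le_add_of_nonneg_right h3
      _ = _ := by rw [← h2, ← h1]; rfl
  · have h := analyticAt_localK (G := G) (w := w) hk v hb
    refine ⟨h.meromorphicAt, le_trans ?_ h.meromorphicOrderAt_nonneg⟩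
    exact_mod_cast min_le_left _ _

/-- Meromorphic functions of order at least `n ≤ 0` are closed under linear combinations. -/
theorem meromorphicOrderAt_sum_mul {κ : Type*} (s : Finset κ) (c : κ → ℂ) (f : κ → ℂ → ℂ)
    {n : WithTop ℤ}
    (hf : ∀ i ∈ s, MeromorphicAt (f i) 0 ∧ n ≤ meromorphicOrderAt (f i) 0) :
    MeromorphicAt (fun z => ∑ i ∈ s, c i * f i z) 0 ∧
      n ≤ meromorphicOrderAt (fun z => ∑ i ∈ s, c i * f i z) 0 := by
  classical
  induction s using Finset.induction_on with
  | empty =>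
    refine ⟨by simp, ?_⟩
    have : meromorphicOrderAt (fun _ : ℂ => (0 : ℂ)) 0 = ⊤ := by
      rw [meromorphicOrderAt_eq_top_iff]; simp
    simp [this]
  | insert i s hi ih =>
    obtain ⟨h1, h2⟩ := ih fun j hj => hf j (Finset.mem_insert_of_mem hj)
    obtain ⟨h3, h4⟩ := hf i (Finset.mem_insert_self _ _)
    have hc : AnalyticAt ℂ (fun _ : ℂ => c i) 0 := analyticAt_const
    have h5 : MeromorphicAt (fun z => c i * f i z) 0 := hc.meromorphicAt.mul h3
    have h6 : n ≤ meromorphicOrderAt (fun z => c i * f i z) 0 := by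
      have := meromorphicOrderAt_mul hc.meromorphicAt h3
      refine h4.trans ?_
      refine le_trans (le_add_of_nonneg_left hc.meromorphicOrderAt_nonneg) this.ge
    simp only [Finset.sum_insert hi]
    exact ⟨h5.add h1, (le_min h6 h2).trans (meromorphicOrderAt_add h5 h1)⟩

/-- `F(f₁; t)` as a finite combination of products of functions of one variable. -/
theorem ratF_eq (hW : IsUnit (linkingMatrix G w).det)
    (hleaf : ∀ i, G.degree i = 1 → w i ≤ -2) {k : ℕ} (hk : 0 < k) (t : V3 G → ℂ) :
    ratF G w k t = prefactor G w k * qsum (boxLattice fun _ : V2 G => (2 * k : ℤ)) (fun b =>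
      edgeWeight G w k b * ∏ v : V2 G, localK G w k v.1 (b v) (ext0 G t v)) := by
  have h1 : ratF G w k t = prefactor G w k * qsum (lattice G w k) (fun μ =>
      gaussWeight G w k μ * ∏ v : V2 G, vertexFactor G w k v.1 (ext0 G t v) (μ v)) := rfl
  rw [h1, qsum_gaussWeight_mul_prod hW hleaf hk
    (fun (v : V2 G) a => vertexFactor G w k v.1 (ext0 G t v) a)
    (fun v a => vertexFactor_periodic hleaf hk v.1 _ a)]
  simp only [localSum_vertexFactor hW hleaf hk]

theorem finite_quotient_two_mul {k : ℕ} (hk : 0 < k) :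
    Finite ((V2 G → ℤ) ⧸ boxLattice fun _ : V2 G => (2 * k : ℤ)) :=
  finite_quotient_boxLattice fun _ => by positivity

/-- As a function of `t_v`, `F(f₁; t)` is a linear combination of local functions at `v`, whatever
the values of the other variables. -/
theorem meromorphicOrderAt_ratF (hW : IsUnit (linkingMatrix G w).det)
    (hleaf : ∀ i, G.degree i = 1 → w i ≤ -2) {k : ℕ} (hk : 0 < k) (v : V3 G) (t : V3 G → ℂ) :
    MeromorphicAt (fun s : ℂ => ratF G w k (Function.update t v s)) 0 ∧
      ((min 0 (((leaves G v.1).card : ℤ) + 2 - G.degree v.1) : ℤ) : WithTop ℤ) ≤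
        meromorphicOrderAt (fun s : ℂ => ratF G w k (Function.update t v s)) 0 := by
  have hfin := finite_quotient_two_mul (G := G) hk
  have := Fintype.ofFinite ((V2 G → ℤ) ⧸ boxLattice fun _ : V2 G => (2 * k : ℤ))
  have hext : ∀ s, ext0 G (Function.update t v s) (V3.toV2 G v) = s := by
    intro s
    rw [ext0, dif_pos (show 3 ≤ G.degree (V3.toV2 G v).1 from v.2)]
    exact Function.update_self ..
  have hext' : ∀ s, ∀ u ≠ V3.toV2 G v, ext0 G (Function.update t v s) u = ext0 G t u := by
    intro s u hu
    rw [ext0, ext0]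
    split_ifs with h
    · rw [Function.update_of_ne]
      intro h'
      apply hu
      rw [← h']
      rfl
    · rfl
  have hfun : (fun s : ℂ => ratF G w k (Function.update t v s)) = fun s =>
      ∑ x : (V2 G → ℤ) ⧸ boxLattice fun _ : V2 G => (2 * k : ℤ),
        (prefactor G w k * (edgeWeight G w k x.out * ∏ u ∈ Finset.univ.erase (V3.toV2 G v),
          localK G w k u.1 (x.out u) (ext0 G t u))) * localK G w k v.1 (x.out (V3.toV2 G v)) s := by
    funext s
    rw [ratF_eq hW hleaf hk, qsum_eq_sum, Finset.mul_sum]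
    refine Finset.sum_congr rfl fun x _ => ?_
    rw [← Finset.mul_prod_erase _ _ (Finset.mem_univ (V3.toV2 G v)), hext,
      Finset.prod_congr rfl fun u hu => by rw [hext' s u (Finset.ne_of_mem_erase hu)]]
    change prefactor G w k * (_ * (localK G w k v.1 _ s * _)) = _
    ring
  rw [hfun]
  exact meromorphicOrderAt_sum_mul _ _ _ fun x _ => le_meromorphicOrderAt_localK hleaf hk v.1 _

end LocalAnalysis

/-! ### Cancellation by sign changes on branches of the tree -/

section Reflection

/-- A function that is odd under an involution of the group preserving `Λ` sums to zero. -/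
theorem qsum_eq_zero_of_odd {A : Type*} [AddCommGroup A] {Λ : AddSubgroup A} [Finite (A ⧸ Λ)]
    {f : A → ℂ} (φ : A →+ A) (hφ : ∀ x, φ (φ x) = x) (hΛ : ∀ h ∈ Λ, φ h ∈ Λ)
    (hf : IsPeriodic Λ f) (h : ∀ x, f (φ x) = -f x) : qsum Λ f = 0 := by
  classical
  have hr : φ.range = ⊤ := AddMonoidHom.range_eq_top.2 fun x => ⟨φ x, hφ x⟩
  obtain ⟨c, hc, hce⟩ := qsum_comp_hom (Λ := Λ) (Λ' := Λ) φ hΛ hf (by rw [hr]; exact le_top)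
  simp only [hr, AddSubgroup.mem_top, if_true] at hce
  rw [qsum_congr h, qsum_congr (g := fun x => (-1 : ℂ) * f x) (fun x => by ring),
    qsum_mul_left] at hce
  have hc1 : (c : ℂ) + 1 ≠ 0 := by exact_mod_cast c.succ_ne_zero
  have : ((c : ℂ) + 1) * qsum Λ f = 0 := by linear_combination -hce
  exact (mul_eq_zero.1 this).resolve_left hc1

variable {V : Type*} [Fintype V] [DecidableEq V] {G : SimpleGraph V} [DecidableRel G.Adj]
  {w : V → ℤ}

/-- The sum of the degrees over a set of vertices joined to its complement by a single edge is
odd. -/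
theorem odd_sum_degree (K : Finset V) {u v : V} (hu : u ∈ K) (hv : v ∉ K) (huv : G.Adj u v)
    (hK : ∀ x ∈ K, ∀ y ∉ K, G.Adj x y → x = u ∧ y = v) : Odd (∑ x ∈ K, G.degree x) := by
  classical
  let H : SimpleGraph V :=
    { Adj := fun x y => G.Adj x y ∧ x ∈ K ∧ y ∈ K
      symm := ⟨fun x y h => ⟨h.1.symm, h.2.2, h.2.1⟩⟩
      loopless := ⟨fun x h => G.loopless.irrefl x h.1⟩ }
  have h1 : ∀ x ∈ K, G.degree x = H.degree x + if x = u then 1 else 0 := by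
    intro x hx
    have h2 : G.neighborFinset x = H.neighborFinset x ∪ if x = u then {v} else ∅ := by
      ext y
      by_cases hxu : x = u
      · subst hxu
        simp only [SimpleGraph.mem_neighborFinset, if_true, Finset.mem_union, Finset.mem_singleton]
        constructor
        · intro h
          by_cases hy : y ∈ K
          · exact Or.inl ⟨h, hx, hy⟩
          · exact Or.inr (hK x hx y hy h).2
        · rintro (h | rfl)
          · exact h.1
          · exact huv
      · simp only [SimpleGraph.mem_neighborFinset, if_neg hxu, Finset.union_empty]
        constructor
        · intro h
          by_cases hy : y ∈ K
          · exact ⟨h, hx, hy⟩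
          · exact absurd (hK x hx y hy h).1 hxu
        · exact fun h => h.1
    rw [← SimpleGraph.card_neighborFinset_eq_degree, h2, Finset.card_union_of_disjoint,
      SimpleGraph.card_neighborFinset_eq_degree]
    · split_ifs <;> simp
    · split_ifs
      · rw [Finset.disjoint_singleton_right, SimpleGraph.mem_neighborFinset]
        exact fun h => hv h.2.2
      · exact Finset.disjoint_empty_right _
  have h2 : ∑ x ∈ K, H.degree x = ∑ x, H.degree x := by
    refine Finset.sum_subset (Finset.subset_univ _) fun x _ hx => ?_
    rw [← SimpleGraph.card_neighborFinset_eq_degree, Finset.card_eq_zero,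
      Finset.eq_empty_iff_forall_notMem]
    intro y hy
    exact hx ((H.mem_neighborFinset x y).1 hy).2.1
  rw [Finset.sum_congr rfl h1, Finset.sum_add_distrib, h2, H.sum_degrees_eq_twice_card_edges,
    Finset.sum_ite_eq', if_pos hu]
  exact ⟨_, rfl⟩

/-- In a tree, the branch at an edge `{u, v}` on the side of `u`. -/
theorem exists_branch (hG : G.IsTree) {u v : V} (huv : G.Adj u v) : ∃ K : Finset V, u ∈ K ∧ v ∉ K ∧
    ∀ x ∈ K, ∀ y ∉ K, G.Adj x y → x = u ∧ y = v := by
  classical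
  have hb := SimpleGraph.isAcyclic_iff_forall_adj_isBridge.1 hG.isAcyclic huv
  rw [SimpleGraph.isBridge_iff] at hb
  refine ⟨Finset.univ.filter fun x => (G.deleteEdges {s(u, v)}).Reachable u x, by simp,
    by simpa using hb, ?_⟩
  intro x hx y hy hxy
  simp only [Finset.mem_filter, Finset.mem_univ, true_and] at hx hy
  by_cases h : s(x, y) = s(u, v)
  · rcases Sym2.eq_iff.1 h with h' | ⟨rfl, rfl⟩
    · exact h'
    · exact absurd (SimpleGraph.Reachable.refl _) hy
  · refine absurd (hx.trans (SimpleGraph.Adj.reachable ?_)) hy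
    rw [SimpleGraph.deleteEdges_adj]
    exact ⟨hxy, h⟩

/-- Changing the signs of the coordinates on `K`. -/
def reflect (K : Finset V) : (V2 G → ℤ) →+ (V2 G → ℤ) where
  toFun b v := if v.1 ∈ K then -b v else b v
  map_zero' := by funext v; simp
  map_add' a b := by
    funext v
    simp only [Pi.add_apply]
    split_ifs <;> ring

theorem reflect_apply (K : Finset V) (b : V2 G → ℤ) (v : V2 G) :
    reflect K b v = if v.1 ∈ K then -b v else b v := rfl

theorem reflect_reflect (K : Finset V) (b : V2 G → ℤ) : reflect K (reflect K b) = b := by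
  funext v
  simp only [reflect_apply]
  split_ifs <;> simp

/-- The edge weight is unchanged if the signs are changed on a branch attached to a vertex whose
coordinate is divisible by `k`. -/
theorem edgeWeight_reflect {k : ℕ} (hk : 0 < k) {K : Finset V} {u : V} {v : V2 G}
    (hK : ∀ x ∈ K, ∀ y ∉ K, G.Adj x y → x = u ∧ y = v.1) {b : V2 G → ℤ} (hb : (k : ℤ) ∣ b v) :
    edgeWeight G w k (reflect K b) = edgeWeight G w k b := by
  set T := (linkingMatrix G w).submatrix (Subtype.val : V2 G → V) Subtype.val with hT
  have hTs : T.IsSymm := linkingMatrix_isSymm.submatrix _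
  set p : V2 G → ℤ := fun x => if x.1 ∈ K then 0 else b x with hp
  set q : V2 G → ℤ := fun x => if x.1 ∈ K then b x else 0 with hq
  have h1 : b = p + q := by funext x; simp only [hp, hq, Pi.add_apply]; split_ifs <;> ring
  have h2 : reflect K b = p - q := by
    funext x; simp only [hp, hq, Pi.sub_apply, reflect_apply]; split_ifs <;> ring
  have h3 : q ⬝ᵥ T.mulVec p = p ⬝ᵥ T.mulVec q := by
    rw [Matrix.dotProduct_mulVec, ← Matrix.mulVec_transpose, hTs.eq, dotProduct_comm]
  obtain ⟨c, hc⟩ : (k : ℤ) ∣ p ⬝ᵥ T.mulVec q := by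
    simp only [dotProduct, Matrix.mulVec]
    refine Finset.dvd_sum fun x _ => ?_
    rw [Finset.mul_sum]
    refine Finset.dvd_sum fun y _ => ?_
    by_cases hx : x.1 ∈ K
    · simp [hp, hx]
    by_cases hy : y.1 ∈ K
    · by_cases hxy : G.Adj y.1 x.1
      · have : x = v := Subtype.ext (hK _ hy _ hx hxy).2
        subst this
        simp only [hp, if_neg hx]
        exact hb.mul_right _
      · have hne : x.1 ≠ y.1 := fun h => hx (h ▸ hy)
        have : T x y = 0 := by
          rw [hT, Matrix.submatrix_apply, linkingMatrix_apply, if_neg hne,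
            if_neg (fun h => hxy h.symm), add_zero]
        simp [this]
    · simp [hq, hy]
  have h4 : (p - q) ⬝ᵥ T.mulVec (p - q) =
      (p + q) ⬝ᵥ T.mulVec (p + q) - 4 * (p ⬝ᵥ T.mulVec q) := by
    simp only [Matrix.mulVec_add, Matrix.mulVec_sub, dotProduct_add, add_dotProduct,
      dotProduct_sub, sub_dotProduct, h3]
    ring
  have hk' : (k : ℂ) ≠ 0 := by exact_mod_cast hk.ne'
  rw [edgeWeight, edgeWeight, ← hT, h2, h4, ← h1, hc,
    ← e_add_int (((b ⬝ᵥ T.mulVec b : ℤ) : ℂ) / (4 * k)) (-c)]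
  congr 1
  push_cast
  field_simp
  ring

/-- The parity of the local functions at `s = 0`. -/
theorem localK_neg (hleaf : ∀ i, G.degree i = 1 → w i ≤ -2) {k : ℕ} (hk : 0 < k) (v : V) (b : ℤ) :
    localK G w k v (-b) 0 =
      (-1) ^ G.degree v * (-1) ^ (leaves G v).card * localK G w k v b 0 := by
  have h1 : ∏ i ∈ leaves G v, leafSum k (w i) (-b) 0 =
      (-1) ^ (leaves G v).card * ∏ i ∈ leaves G v, leafSum k (w i) b 0 := by
    rw [Finset.prod_congr rfl fun i hi => leafSum_neg hk (leaf_ne_zero hleaf hi) b,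
      Finset.prod_neg]
  have h2 : e (((-b : ℤ) : ℂ) / (2 * k)) = (e ((b : ℂ) / (2 * k)))⁻¹ := by
    rw [← e_neg]; congr 1; push_cast; ring
  have h3 : ((-1 : ℂ)) ^ ((2 : ℤ) - G.degree v) = (-1) ^ G.degree v := by
    rw [zpow_sub₀ (by norm_num), zpow_natCast]
    rcases neg_one_pow_eq_or ℂ (G.degree v) with h | h <;> rw [h] <;> norm_num
  have h4 : ∀ y : ℂ, y⁻¹ - y⁻¹⁻¹ = (-1) * (y - y⁻¹) := fun y => by rw [inv_inv]; ring
  rw [localK_zero, localK_zero, h1, h2, h4, mul_zpow, h3]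
  ring

/-- The product of the signs of the local functions over a branch attached to a vertex without
leaves is `-1`. -/
theorem prod_branch_sign (hW : IsUnit (linkingMatrix G w).det)
    (hleaf : ∀ i, G.degree i = 1 → w i ≤ -2) {K : Finset V} {u v : V} (hu : u ∈ K) (hv : v ∉ K)
    (huv : G.Adj u v) (hK : ∀ x ∈ K, ∀ y ∉ K, G.Adj x y → x = u ∧ y = v) (hlv : leaves G v = ∅)
    (hdv : 2 ≤ G.degree v) :
    ∏ x : V2 G, (if x.1 ∈ K then (-1 : ℂ) ^ G.degree x.1 * (-1) ^ (leaves G x.1).card else 1) =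
      -1 := by
  have h1 : ∀ x : V2 G, ∀ i ∈ leaves G x.1, (i ∈ K ↔ x.1 ∈ K) := by
    intro x i hi
    have hadj := (mem_leaves.1 hi).1
    have hdi := (mem_leaves.1 hi).2
    constructor
    · intro hiK
      by_contra hxK
      have := (hK i hiK x.1 hxK hadj.symm).2
      rw [this, hlv] at hi
      exact absurd hi (Finset.notMem_empty _)
    · intro hxK
      by_contra hiK
      have := (hK x.1 hxK i hiK hadj).2
      rw [this] at hdi
      omega
  have h2 : ∏ x : V2 G, (if x.1 ∈ K then (-1 : ℂ) ^ (leaves G x.1).card else 1) =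
      ∏ i : V1 G, (if i.1 ∈ K then (-1 : ℂ) ^ G.degree i.1 else 1) := by
    rw [← prod_leaves hW hleaf (fun i => if i ∈ K then (-1 : ℂ) ^ G.degree i else 1)]
    refine Finset.prod_congr rfl fun x _ => ?_
    rw [Finset.prod_congr rfl fun i hi => by
      rw [show (if i ∈ K then (-1 : ℂ) ^ G.degree i else 1) = if x.1 ∈ K then (-1 : ℂ) else 1 by
        rw [(mem_leaves.1 hi).2, pow_one]
        by_cases h : x.1 ∈ K
        · rw [if_pos h, if_pos ((h1 x i hi).2 h)]
        · rw [if_neg h, if_neg (mt (h1 x i hi).1 h)]], Finset.prod_const]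
    split_ifs <;> simp
  have h3 : ∏ x : V2 G, (if x.1 ∈ K then (-1 : ℂ) ^ G.degree x.1 * (-1) ^ (leaves G x.1).card
      else 1) = (∏ x : V2 G, (if x.1 ∈ K then (-1 : ℂ) ^ G.degree x.1 else 1)) *
        ∏ i : V1 G, (if i.1 ∈ K then (-1 : ℂ) ^ G.degree i.1 else 1) := by
    rw [← h2, ← Finset.prod_mul_distrib]
    refine Finset.prod_congr rfl fun x _ => ?_
    split_ifs <;> simp
  set f : V → ℂ := fun x => if x ∈ K then (-1 : ℂ) ^ G.degree x else 1 with hf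
  have h4 : (∏ x : V2 G, f x.1) = ∏ x ∈ Finset.univ.filter fun x => 2 ≤ G.degree x, f x :=
    (Finset.prod_subtype (Finset.univ.filter fun x => 2 ≤ G.degree x) (by simp) f).symm
  have h5 : (∏ x : V1 G, f x.1) = ∏ x ∈ Finset.univ.filter fun x => ¬ 2 ≤ G.degree x, f x := by
    rw [← Finset.prod_subtype (Finset.univ.filter fun x => G.degree x = 1) (by simp) f]
    refine Finset.prod_subset (fun x hx => ?_) fun x hx hx' => ?_
    · simp only [Finset.mem_filter, Finset.mem_univ, true_and] at hx ⊢
      omega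
    · simp only [Finset.mem_filter, Finset.mem_univ, true_and] at hx hx'
      have : G.degree x = 0 := by omega
      simp [hf, this]
  rw [h3]
  change (∏ x : V2 G, f x.1) * ∏ x : V1 G, f x.1 = -1
  rw [h4, h5, Finset.prod_filter_mul_prod_filter_not, hf, Finset.prod_ite_mem,
    Finset.univ_inter, Finset.prod_pow_eq_pow_sum]
  exact (odd_sum_degree K hu hv huv hK).neg_one_pow

open Classical in
/-- The terms of the reduced Gauss sum at `s = 0` for which `k` divides some coordinate cancel:
they vanish if that coordinate belongs to a vertex of degree at least three or with leaves, and
otherwise they are odd under the change of signs on a branch at that vertex. -/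
theorem qsum_edgeWeight_mul_localK_eq (hG : G.IsTree) (hW : IsUnit (linkingMatrix G w).det)
    (hleaf : ∀ i, G.degree i = 1 → w i ≤ -2) {k : ℕ} (hk : 0 < k) :
    qsum (boxLattice fun _ : V2 G => (2 * k : ℤ)) (fun b =>
        edgeWeight G w k b * ∏ v : V2 G, localK G w k v.1 (b v) 0) =
      qsum (boxLattice fun _ : V2 G => (2 * k : ℤ)) (fun b => edgeWeight G w k b *
        ∏ v : V2 G, if (k : ℤ) ∣ b v then 0 else localK G w k v.1 (b v) 0) := by
  have hfin := finite_quotient_two_mul (G := G) hk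
  set F : (V2 G → ℤ) → ℂ := fun b =>
    edgeWeight G w k b * ∏ v : V2 G, localK G w k v.1 (b v) 0 with hF
  set D : (V2 G → ℤ) → Finset (V2 G) := fun b => Finset.univ.filter fun v => (k : ℤ) ∣ b v with hD
  have hmem : ∀ b x, x ∈ D b ↔ (k : ℤ) ∣ b x := fun b x => by
    simp only [hD, Finset.mem_filter_univ]
  have hFper : IsPeriodic (boxLattice fun _ : V2 G => (2 * k : ℤ)) F := by
    intro x h hh
    simp only [hF, edgeWeight_periodic hk x h hh]
    refine congrArg (edgeWeight G w k x * ·) (Finset.prod_congr rfl fun v _ => ?_)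
    obtain ⟨c, hc⟩ := mem_boxLattice.1 hh v
    have h1 : Function.Periodic (fun b => localK G w k v.1 b 0) (2 * k : ℤ) := by
      intro b
      simp only [← localSum_vertexFactor hW hleaf hk]
      exact localSum_periodic hleaf hk v.1 (fun a => vertexFactor_periodic hleaf hk v.1 0 a) b
    have h2 := h1.int_mul c (x v)
    simp only [Int.cast_id] at h2
    rw [Pi.add_apply, hc, mul_comm]
    exact h2
  have hDper : ∀ x, ∀ h ∈ boxLattice fun _ : V2 G => (2 * k : ℤ), D (x + h) = D x := by
    intro x h hh
    ext v
    rw [hmem, hmem, Pi.add_apply]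
    exact Int.dvd_add_left ((Dvd.intro_left _ rfl).trans (mem_boxLattice.1 hh v))
  have hzero : ∀ Δ : Finset (V2 G), Δ.Nonempty →
      qsum (boxLattice fun _ : V2 G => (2 * k : ℤ)) (fun b => if D b = Δ then F b else 0) = 0 := by
    rintro Δ ⟨v, hv⟩
    by_cases h3 : 3 ≤ G.degree v.1 ∨ (leaves G v.1).Nonempty
    · -- the factor at `v` vanishes
      rw [qsum_congr (g := fun _ => (0 : ℂ)), qsum_const, mul_zero]
      intro b
      split_ifs with hb
      · have hkb : (k : ℤ) ∣ b v := by
          rw [← hb] at hv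
          exact (hmem _ _).1 hv
        have : localK G w k v.1 (b v) 0 = 0 := by
          rw [localK_zero]
          rcases h3 with h3 | ⟨i, hi⟩
          · rw [(e_half_sub_inv_eq_zero_iff hk _).2 hkb, zero_zpow _ (by omega), zero_mul]
          · rw [Finset.prod_eq_zero hi (leafSum_eq_zero hk (leaf_ne_zero hleaf hi) hkb), mul_zero]
        simp only [hF]
        rw [Finset.prod_eq_zero (Finset.mem_univ v) this, mul_zero]
      · rfl
    · push Not at h3
      obtain ⟨u, huv⟩ := (G.degree_pos_iff_exists_adj v.1).1 (by have := v.2; omega)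
      obtain ⟨K, hu, hvK, hK⟩ := exists_branch hG huv.symm
      have hDr : ∀ b, D (reflect K b) = D b := by
        intro b
        ext x
        rw [hmem, hmem, reflect_apply]
        split_ifs
        · exact dvd_neg
        · rfl
      refine qsum_eq_zero_of_odd (reflect K) (reflect_reflect K) (fun h hh => ?_) (fun x h hh => ?_)
        fun b => ?_
      · rw [mem_boxLattice] at hh ⊢
        intro x
        rw [reflect_apply]
        split_ifs
        · exact (dvd_neg).2 (hh x)
        · exact hh x
      · rw [hDper x h hh, hFper x h hh]
      · rw [hDr]
        split_ifs with hb
        · have hkb : (k : ℤ) ∣ b v := by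
            rw [← hb] at hv
            exact (hmem _ _).1 hv
          have h5 : ∀ x : V2 G, localK G w k x.1 (reflect K b x) 0 =
              (if x.1 ∈ K then (-1 : ℂ) ^ G.degree x.1 * (-1) ^ (leaves G x.1).card else 1) *
                localK G w k x.1 (b x) 0 := by
            intro x
            rw [reflect_apply]
            split_ifs
            · exact localK_neg hleaf hk _ _
            · rw [one_mul]
          simp only [hF]
          rw [edgeWeight_reflect hk hK hkb, Finset.prod_congr rfl fun x _ => h5 x,
            Finset.prod_mul_distrib, prod_branch_sign hW hleaf hu hvK huv.symm hK h3.2 v.2]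
          ring
        · rw [neg_zero]
  have hsplit : ∀ b, F b = ∑ Δ : Finset (V2 G), if D b = Δ then F b else 0 := fun b => by simp
  rw [qsum_congr hsplit, qsum_sum, Finset.sum_eq_single ∅]
  · refine qsum_congr fun b => ?_
    split_ifs with hb
    · simp only [hF]
      refine congrArg (edgeWeight G w k b * ·) (Finset.prod_congr rfl fun v _ => ?_)
      rw [if_neg]
      intro h
      have : v ∈ D b := (hmem _ _).2 h
      rw [hb] at this
      exact absurd this (Finset.notMem_empty _)
    · obtain ⟨v, hv⟩ := Finset.nonempty_iff_ne_empty.2 hb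
      rw [Finset.prod_eq_zero (Finset.mem_univ v), mul_zero]
      rw [if_pos ((hmem _ _).1 hv)]
  · intro Δ _ hΔ
    exact hzero Δ (Finset.nonempty_iff_ne_empty.2 hΔ)
  · intro h; exact absurd (Finset.mem_univ _) h

/-- The weighted Gauss sum, reduced modulo `2 k`. -/
theorem weightedGaussSum_eq (hG : G.IsTree) (hW : IsUnit (linkingMatrix G w).det)
    (hleaf : ∀ i, G.degree i = 1 → w i ≤ -2) {k : ℕ} (hk : 0 < k) :
    weightedGaussSum G w k = prefactor G w k * qsum (boxLattice fun _ : V2 G => (2 * k : ℤ))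
      (fun b => edgeWeight G w k b * ∏ v : V2 G, localK G w k v.1 (b v) 0) := by
  classical
  have hdvd : ∀ (v : V) (a : ℤ) (j : ℤ), (k : ℤ) ∣ a + 2 * k * j ↔ (k : ℤ) ∣ a := fun v a j =>
    Int.dvd_add_left ⟨2 * j, by ring⟩
  set g : V2 G → ℤ → ℂ := fun v a => if (k : ℤ) ∣ a then 0 else vertexFactor G w k v.1 0 a with hg
  have hgper : ∀ v a, g v (a + 2 * k * M G w v.1) = g v a := by
    intro v a
    simp only [hg, hdvd v.1, vertexFactor_periodic hleaf hk]
  have h1 : weightedGaussSum G w k = prefactor G w k * qsum (lattice G w k) (fun μ =>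
      gaussWeight G w k μ * ∏ v : V2 G, g v (μ v)) := by
    rw [weightedGaussSum, qsum]
    congr 1
    refine finsum_congr fun x => ?_
    split_ifs with h
    · congr 1
      refine Finset.prod_congr rfl fun v _ => ?_
      simp only [hg, if_neg (h v), vertexFactor, neg_zero, zero_div, Complex.exp_zero, mul_one]
    · push Not at h
      obtain ⟨v, hv⟩ := h
      rw [Finset.prod_eq_zero (Finset.mem_univ v), mul_zero]
      simp only [hg, if_pos hv]
  rw [h1, qsum_gaussWeight_mul_prod hW hleaf hk g hgper,
    qsum_edgeWeight_mul_localK_eq hG hW hleaf hk]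
  congr 1
  refine qsum_congr fun b => ?_
  congr 1
  refine Finset.prod_congr rfl fun v _ => ?_
  split_ifs with h
  · simp only [localSum, hg, hdvd v.1, if_pos h, mul_zero, Finset.sum_const_zero]
  · rw [← localSum_vertexFactor hW hleaf hk]
    simp only [localSum, hg, hdvd v.1, if_neg h]

end Reflection

/-! ### Holomorphy at the origin -/

section Value

variable {V : Type*} [Fintype V] [DecidableEq V] {G : SimpleGraph V} [DecidableRel G.Adj]
  {w : V → ℤ}

/-- If `|v̄| + 2 - deg v > 0`, the singularity of the local function at `s = 0` is removable, and
the value there is the one assigned by the convention `0⁻¹ = 0`, both being zero for `k ∣ b`. -/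
theorem exists_analyticAt_localK (hleaf : ∀ i, G.degree i = 1 → w i ≤ -2) {k : ℕ} (hk : 0 < k)
    {v : V} (hv : 3 ≤ G.degree v) (hpos : 0 < ((leaves G v).card : ℤ) + 2 - G.degree v) (b : ℤ) :
    ∃ K : ℂ → ℂ, AnalyticAt ℂ K 0 ∧ (∀ᶠ s in 𝓝[≠] (0 : ℂ), localK G w k v b s = K s) ∧
      K 0 = localK G w k v b 0 := by
  by_cases hb : (k : ℤ) ∣ b
  · obtain ⟨g, hg, hgs⟩ := localK_eq_zpow_mul hleaf hk v hb
    lift ((leaves G v).card : ℤ) + 2 - G.degree v to ℕ using hpos.le with n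
    refine ⟨fun s => s ^ n * g s, (analyticAt_id.pow n).mul hg, ?_, ?_⟩
    · filter_upwards [hgs] with s hs
      rw [hs, zpow_natCast]
    · beta_reduce
      rw [localK_zero, (e_half_sub_inv_eq_zero_iff hk _).2 hb, zero_zpow _ (by omega),
        zero_pow (by omega), zero_mul, zero_mul]
  · exact ⟨_, analyticAt_localK hk v hb, Eventually.of_forall fun _ => rfl, rfl⟩

/-- The local function at `v` as a function of all the variables; it is constant if `v` has degree
two. -/
theorem exists_analyticAt_localK_ext0 (hleaf : ∀ i, G.degree i = 1 → w i ≤ -2) {k : ℕ}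
    (hk : 0 < k) (hpos : ∀ v : V3 G, 0 < ((leaves G v.1).card : ℤ) + 2 - G.degree v.1)
    (v : V2 G) (b : ℤ) :
    ∃ K : (V3 G → ℂ) → ℂ, AnalyticAt ℂ K 0 ∧
      (∀ᶠ t in 𝓝 (0 : V3 G → ℂ), (∀ u, t u ≠ 0) → localK G w k v.1 b (ext0 G t v) = K t) ∧
      K 0 = localK G w k v.1 b 0 := by
  by_cases h : 3 ≤ G.degree v.1
  · obtain ⟨K, hK, hKs, hK0⟩ := exists_analyticAt_localK hleaf hk h (hpos ⟨v.1, h⟩) b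
    have hproj : Tendsto (fun t : V3 G → ℂ => t ⟨v.1, h⟩) (𝓝 0) (𝓝 0) :=
      (continuous_apply (⟨v.1, h⟩ : V3 G)).tendsto' _ _ rfl
    refine ⟨fun t => K (t ⟨v.1, h⟩), ?_, ?_, hK0⟩
    · refine AnalyticAt.fun_comp (g := K) (f := fun t : V3 G → ℂ => t ⟨v.1, h⟩) hK ?_
      exact (ContinuousLinearMap.proj (R := ℂ) (φ := fun _ : V3 G => ℂ) ⟨v.1, h⟩).analyticAt 0
    · filter_upwards [hproj.eventually (eventually_nhdsWithin_iff.1 hKs)] with t ht hne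
      rw [ext0, dif_pos h]
      exact ht (hne _)
  · refine ⟨fun _ => localK G w k v.1 b 0, analyticAt_const, ?_, rfl⟩
    refine Eventually.of_forall fun t _ => ?_
    rw [ext0, dif_neg h]

/-- Holomorphy of `F(f₁; t)` at `t = 0`, with its value. -/
theorem exists_analyticAt_ratF (hG : G.IsTree) (hW : IsUnit (linkingMatrix G w).det)
    (hleaf : ∀ i, G.degree i = 1 → w i ≤ -2) {k : ℕ} (hk : 0 < k)
    (hpos : ∀ v : V3 G, 0 < ((leaves G v.1).card : ℤ) + 2 - G.degree v.1) :
    ∃ H : (V3 G → ℂ) → ℂ, AnalyticAt ℂ H 0 ∧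
      (∀ᶠ t in 𝓝 (0 : V3 G → ℂ), (∀ v, t v ≠ 0) → ratF G w k t = H t) ∧
      H 0 = weightedGaussSum G w k := by
  have hfin := finite_quotient_two_mul (G := G) hk
  have := Fintype.ofFinite ((V2 G → ℤ) ⧸ boxLattice fun _ : V2 G => (2 * k : ℤ))
  choose K hK hKs hK0 using exists_analyticAt_localK_ext0 hleaf hk hpos
  refine ⟨fun t => prefactor G w k * ∑ x : (V2 G → ℤ) ⧸ boxLattice fun _ : V2 G => (2 * k : ℤ),
    edgeWeight G w k x.out * ∏ v : V2 G, K v (x.out v) t, ?_, ?_, ?_⟩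
  · exact analyticAt_const.mul (Finset.analyticAt_fun_sum _ fun x _ =>
      analyticAt_const.mul (Finset.analyticAt_fun_prod _ fun v _ => hK _ _))
  · have : ∀ᶠ t in 𝓝 (0 : V3 G → ℂ), ∀ x : (V2 G → ℤ) ⧸ boxLattice fun _ : V2 G => (2 * k : ℤ),
        ∀ v : V2 G, (∀ u, t u ≠ 0) →
          localK G w k v.1 (x.out v) (ext0 G t v) = K v (x.out v) t :=
      eventually_all.2 fun x => eventually_all.2 fun v => hKs v (x.out v)
    filter_upwards [this] with t ht hne
    rw [ratF_eq hW hleaf hk, qsum_eq_sum]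
    congr 1
    refine Finset.sum_congr rfl fun x _ => ?_
    rw [Finset.prod_congr rfl fun v _ => ht x v hne]
  · rw [weightedGaussSum_eq hG hW hleaf hk, qsum_eq_sum]
    simp only [hK0]

end Value

/-! ### Signed sums over `𝒮` -/

section Signs

/-- If a combination of the reciprocals of pairwise coprime integers is an integer, then each
coefficient is divisible by the corresponding integer. -/
theorem dvd_of_sum_div_eq_int {κ : Type*} [Fintype κ] [DecidableEq κ] {n c : κ → ℤ}
    (hn : ∀ i, n i ≠ 0) (hcop : ∀ i j, i ≠ j → IsCoprime (n i) (n j)) {z : ℤ}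
    (h : ∑ i, (c i : ℚ) / n i = z) (j : κ) : n j ∣ c j := by
  have h1 : ∑ i, c i * ∏ x ∈ Finset.univ.erase i, n x = z * ∏ i, n i := by
    have h2 : ∀ i, (c i : ℚ) / n i * ∏ x, (n x : ℚ) =
        c i * ∏ x ∈ Finset.univ.erase i, (n x : ℚ) := by
      intro i
      have : (n i : ℚ) ≠ 0 := by exact_mod_cast hn i
      rw [← Finset.mul_prod_erase _ _ (Finset.mem_univ i)]
      field_simp
    have h3 : (∑ i, (c i : ℚ) / n i) * ∏ x, (n x : ℚ) = z * ∏ x, (n x : ℚ) := by rw [h]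
    rw [Finset.sum_mul, Finset.sum_congr rfl fun i _ => h2 i] at h3
    exact_mod_cast h3
  have h4 : n j ∣ c j * ∏ x ∈ Finset.univ.erase j, n x := by
    rw [← Finset.add_sum_erase _ _ (Finset.mem_univ j)] at h1
    have h5 : n j ∣ ∑ i ∈ Finset.univ.erase j, c i * ∏ x ∈ Finset.univ.erase i, n x :=
      Finset.dvd_sum fun i hi => Dvd.dvd.mul_left (Finset.dvd_prod_of_mem n
        (Finset.mem_erase.2 ⟨(Finset.ne_of_mem_erase hi).symm, Finset.mem_univ j⟩)) _
    have h6 : n j ∣ z * ∏ i, n i :=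
      Dvd.dvd.mul_left (Finset.dvd_prod_of_mem n (Finset.mem_univ j)) _
    rw [← h1] at h6
    exact (Int.dvd_add_left h5).1 h6
  exact (IsCoprime.prod_right fun x hx =>
    hcop j x (Finset.ne_of_mem_erase hx).symm).dvd_of_dvd_mul_right h4

theorem sum_units_int (f : ℤˣ → ℂ) : ∑ u : ℤˣ, f u = f 1 + f (-1) := by
  have : (Finset.univ : Finset ℤˣ) = {1, -1} := rfl
  rw [this, Finset.sum_pair (by decide)]

variable {V : Type*} [Fintype V] [DecidableEq V] {G : SimpleGraph V} [DecidableRel G.Adj]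
  {w : V → ℤ}

/-- The numbers in `𝒮_v` determine the signs, even modulo `ℤ`. -/
theorem point_injective_mod (hW : IsUnit (linkingMatrix G w).det)
    (hleaf : ∀ i, G.degree i = 1 → w i ≤ -2) {v : V} {l l' : leaves G v → ℤˣ} {z : ℤ}
    (h : point G w v l = point G w v l' + z) : l = l' := by
  have hd : ∀ i, ∃ c : ℤ, (l i : ℤ) - (l' i : ℤ) = 2 * c ∧ |c| ≤ 1 ∧ (c = 0 → l i = l' i) := by
    intro i
    rcases Int.units_eq_one_or (l i) with h1 | h1 <;> rcases Int.units_eq_one_or (l' i) with h2 | h2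
    · exact ⟨0, by simp [h1, h2]⟩
    · exact ⟨1, by simp [h1, h2]⟩
    · exact ⟨-1, by simp [h1, h2]⟩
    · exact ⟨0, by simp [h1, h2]⟩
  choose c hc hc1 hc0 using hd
  have hsum : ∑ i : leaves G v, (c i : ℚ) / w i.1 = z := by
    rw [point, point] at h
    have : ∑ i : leaves G v, (c i : ℚ) / w i.1 =
        ∑ i : leaves G v, ((l i : ℤ) : ℚ) / (2 * (w i.1 : ℚ)) -
          ∑ i : leaves G v, ((l' i : ℤ) : ℚ) / (2 * (w i.1 : ℚ)) := by
      rw [← Finset.sum_sub_distrib]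
      refine Finset.sum_congr rfl fun i _ => ?_
      have h1 : (w i.1 : ℚ) ≠ 0 := by exact_mod_cast leaf_ne_zero hleaf i.2
      have h2 : ((l i : ℤ) : ℚ) - ((l' i : ℤ) : ℚ) = 2 * c i := by exact_mod_cast hc i
      rw [← sub_div, h2]
      field_simp
    rw [this]
    linear_combination h
  funext i
  refine hc0 i ?_
  have hdvd := dvd_of_sum_div_eq_int (fun i : leaves G v => leaf_ne_zero hleaf i.2)
    (fun i j hij => isCoprime_leaves hW i.2 j.2 fun h => hij (Subtype.ext h)) hsum i
  refine Int.eq_zero_of_abs_lt_dvd ((abs_dvd _ _).2 hdvd) ?_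
  have h1 := hleaf i.1 (mem_leaves.1 i.2).2
  have h2 := hc1 i
  have h3 : |w i.1| = -w i.1 := abs_of_nonpos (by omega)
  omega

/-- The signs chosen in the definition of `ε_v` are the given ones, by `point_injective_mod`. -/
theorem epsv_point (hW : IsUnit (linkingMatrix G w).det)
    (hleaf : ∀ i, G.degree i = 1 → w i ≤ -2) {v : V} (l : leaves G v → ℤˣ) :
    epsv G w v (point G w v l) = ∏ i, ((l i : ℤˣ) : ℤ) := by
  have h : ∃ l' : leaves G v → ℤˣ, ∃ z : ℤ, point G w v l = point G w v l' + z := ⟨l, 0, by simp⟩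
  rw [epsv, dif_pos h]
  obtain ⟨z, hz⟩ := h.choose_spec
  rw [← point_injective_mod hW hleaf hz]

theorem sum_calSv (hW : IsUnit (linkingMatrix G w).det)
    (hleaf : ∀ i, G.degree i = 1 → w i ≤ -2) (v : V) (f : ℚ → ℂ) :
    ∑ α ∈ calSv G w v, (epsv G w v α : ℂ) * f α =
      ∑ l : leaves G v → ℤˣ, (∏ i, ((l i : ℤ) : ℂ)) * f (point G w v l) := by
  rw [calSv, Finset.sum_image]
  · refine Finset.sum_congr rfl fun l _ => ?_
    rw [epsv_point hW hleaf]
    push_cast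
    rfl
  · intro l _ l' _ h
    exact point_injective_mod hW hleaf (z := 0) (by simpa using h)

theorem sum_calS_prod (f : V2 G → ℚ → ℂ) :
    ∑ α ∈ calS G w, (eps G w α : ℂ) * ∏ v, f v (α v) =
      ∏ v : V2 G, ∑ α ∈ calSv G w v.1, (epsv G w v.1 α : ℂ) * f v α := by
  rw [Finset.prod_univ_sum, calS]
  refine Finset.sum_congr rfl fun α _ => ?_
  rw [eps, Finset.prod_mul_distrib]
  push_cast
  rfl

theorem exists_point_of_mem_calS {α : V2 G → ℚ} (hα : α ∈ calS G w) (v : V2 G) :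
    ∃ l : leaves G v.1 → ℤˣ, α v = point G w v.1 l := by
  have := Fintype.mem_piFinset.1 hα v
  rw [calSv, Finset.mem_image] at this
  obtain ⟨l, _, hl⟩ := this
  exact ⟨l, hl.symm⟩

/-- A signed sum of exponentials is a product of hyperbolic sines. -/
theorem sum_sign_mul_prod_zpow {κ : Type*} [Fintype κ] [DecidableEq κ] (x : κ → ℂ) :
    ∑ l : κ → ℤˣ, (∏ i, ((l i : ℤ) : ℂ)) * ∏ i, x i ^ (l i : ℤ) = ∏ i, (x i - (x i)⁻¹) := by
  have : ∀ i, x i - (x i)⁻¹ = ∑ u : ℤˣ, ((u : ℤ) : ℂ) * x i ^ (u : ℤ) := by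
    intro i
    rw [sum_units_int]
    simp [sub_eq_add_neg]
  rw [Finset.prod_congr rfl fun i _ => this i, Finset.prod_univ_sum, Fintype.piFinset_univ]
  simp only [Finset.prod_mul_distrib]

/-- The signed sum of `e(μ α / k) exp(-s α)` over `α ∈ 𝒮_v`, times the factor `(1 - y)^{2 - deg v}`,
`y = e(μ / k) exp(-s)`, is up to sign the factor of `F(f₁; t)` at `v`. -/
theorem sum_calSv_exp_mul (hW : IsUnit (linkingMatrix G w).det)
    (hleaf : ∀ i, G.degree i = 1 → w i ≤ -2) {k : ℕ} (hk : 0 < k) (v : V) (s : ℂ) (a : ℤ) :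
    (∑ α ∈ calSv G w v, (epsv G w v α : ℂ) * (e ((a : ℂ) * α / k) * cexp (-s * α))) *
      (1 - e ((a : ℂ) / k) * cexp (-s)) ^ ((2 : ℤ) - G.degree v) =
      (-1) ^ G.degree v * vertexFactor G w k v s a := by
  have hk' : (k : ℂ) ≠ 0 := by exact_mod_cast hk.ne'
  set Y : ℂ := e ((a : ℂ) / (2 * k)) * cexp (-s / 2) with hY
  have hY0 : Y ≠ 0 := mul_ne_zero (e_ne_zero _) (Complex.exp_ne_zero _)
  set X : leaves G v → ℂ := fun i => e ((a : ℂ) / (2 * k * w i.1)) * cexp (-s / (2 * w i.1)) with hX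
  have hpt : ∀ l : leaves G v → ℤˣ,
      e ((a : ℂ) * (point G w v l : ℚ) / k) * cexp (-s * (point G w v l : ℚ)) =
        Y ^ ((G.degree v : ℤ) - 2) * ∏ i, X i ^ (l i : ℤ) := by
    intro l
    have h1 : (((point G w v l : ℚ)) : ℂ) = (((G.degree v : ℤ) - 2 : ℤ) : ℂ) / 2 +
        ∑ i : leaves G v, ((l i : ℤ) : ℂ) / (2 * w i.1) := by
      rw [point]; push_cast; ring
    have h2 : ∏ i, X i ^ (l i : ℤ) =
        e ((a : ℂ) * (∑ i : leaves G v, ((l i : ℤ) : ℂ) / (2 * w i.1)) / k) *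
        cexp (-s * ∑ i : leaves G v, ((l i : ℤ) : ℂ) / (2 * w i.1)) := by
      rw [Finset.mul_sum, Finset.mul_sum, Finset.sum_div, e_sum, Complex.exp_sum,
        ← Finset.prod_mul_distrib]
      refine Finset.prod_congr rfl fun i _ => ?_
      have h3 : (w i.1 : ℂ) ≠ 0 := by exact_mod_cast leaf_ne_zero hleaf i.2
      rw [hX, mul_zpow, e_zpow, ← Complex.exp_int_mul]
      congr 2
      · field_simp
      · ring
    have h4 : Y ^ ((G.degree v : ℤ) - 2) =
        e ((a : ℂ) * ((((G.degree v : ℤ) - 2 : ℤ) : ℂ) / 2) / k) *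
        cexp (-s * ((((G.degree v : ℤ) - 2 : ℤ) : ℂ) / 2)) := by
      rw [hY, mul_zpow, e_zpow, ← Complex.exp_int_mul]
      congr 2
      · field_simp
      · ring
    rw [h1, h2, h4, mul_add, add_div, e_add, mul_add, Complex.exp_add]
    ring
  have hy : e ((a : ℂ) / k) * cexp (-s) = Y * Y := by
    rw [hY, mul_mul_mul_comm, ← e_add, ← Complex.exp_add]
    congr 2
    · field_simp; norm_num
    · ring
  have h5 : ((-1 : ℂ)) ^ ((2 : ℤ) - G.degree v) = (-1) ^ G.degree v := by
    rw [zpow_sub₀ (by norm_num), zpow_natCast]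
    rcases neg_one_pow_eq_or ℂ (G.degree v) with h | h <;> rw [h] <;> norm_num
  have h6 : 1 - Y * Y = (-1) * (Y * (Y - Y⁻¹)) := by field_simp; ring
  rw [sum_calSv hW hleaf v (fun α => e ((a : ℂ) * α / k) * cexp (-s * α)),
    Finset.sum_congr rfl fun l _ => by rw [hpt l, mul_left_comm], ← Finset.mul_sum,
    sum_sign_mul_prod_zpow, hy, h6, vertexFactor_eq hleaf hk, mul_zpow (-1) (Y * (Y - Y⁻¹)),
    mul_zpow Y (Y - Y⁻¹), h5,
    ← Finset.prod_coe_sort (leaves G v)]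
  have h7 : Y ^ ((G.degree v : ℤ) - 2) * Y ^ ((2 : ℤ) - G.degree v) = 1 := by
    rw [← zpow_add₀ hY0]; simp
  linear_combination (-1 : ℂ) ^ G.degree v * (Y - Y⁻¹) ^ ((2 : ℤ) - G.degree v) *
    (∏ i, (X i - (X i)⁻¹)) * h7

end Signs

/-! ### Summation of the series -/

section Series

theorem hasSum_mul_prod {ι κ : Type*} {f : ι → ℂ} {g : κ → ℂ} {x y : ℂ} (hf : HasSum f x)
    (hg : HasSum g y) : HasSum (fun p : ι × κ => f p.1 * g p.2) (x * y) :=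
  hf.mul hg (summable_mul_of_summable_norm hf.summable.norm hg.summable.norm)

theorem hasSum_pi_prod_option {κ : Type*} [Fintype κ] {a : Option κ → ℕ → ℂ} {s : Option κ → ℂ}
    (h : ∀ i, HasSum (a i) (s i))
    (h1 : HasSum (fun n : κ → ℕ => ∏ i, a (some i) (n i)) (∏ i, s (some i))) :
    HasSum (fun n : Option κ → ℕ => ∏ i, a i (n i)) (∏ i, s i) := by
  have h2 := hasSum_mul_prod (h none) h1
  rw [← Fintype.prod_option] at h2
  refine (Equiv.piOptionEquivProd (β := fun _ : Option κ => ℕ)).symm.hasSum_iff.1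
    (h2.congr_fun fun p => ?_)
  exact Fintype.prod_option _

theorem hasSum_pi_prod_equiv {κ ι : Type*} [Fintype κ] [Fintype ι] (ε : κ ≃ ι) {a : ι → ℕ → ℂ}
    {s : ι → ℂ} (h1 : HasSum (fun n : κ → ℕ => ∏ i, a (ε i) (n i)) (∏ i, s (ε i))) :
    HasSum (fun n : ι → ℕ => ∏ i, a i (n i)) (∏ i, s i) := by
  rw [ε.prod_comp s] at h1
  refine (Equiv.arrowCongr ε (Equiv.refl ℕ)).hasSum_iff.1 (h1.congr_fun fun n => ?_)
  refine (ε.prod_comp _).symm.trans (Finset.prod_congr rfl fun i _ => ?_)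
  simp [Equiv.arrowCongr]

/-- The product of finitely many absolutely convergent series is the series of the products. -/
theorem hasSum_pi_prod {ι : Type*} [Fintype ι] (a : ι → ℕ → ℂ) (s : ι → ℂ)
    (h : ∀ i, HasSum (a i) (s i)) :
    HasSum (fun n : ι → ℕ => ∏ i, a i (n i)) (∏ i, s i) := by
  have key : ∀ m : ℕ, ∀ (a : Fin m → ℕ → ℂ) (s : Fin m → ℂ), (∀ i, HasSum (a i) (s i)) →
      HasSum (fun n : Fin m → ℕ => ∏ i, a i (n i)) (∏ i, s i) := by
    intro m
    induction m with
    | zero =>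
      intro a s _
      simp only [Finset.univ_eq_empty, Finset.prod_empty]
      exact hasSum_unique (fun _ : Fin 0 → ℕ => (1 : ℂ))
    | succ m ih =>
      intro a s h
      exact hasSum_pi_prod_equiv (finSuccEquiv m).symm
        (hasSum_pi_prod_option (fun i => h _) (ih _ _ fun i => h _))
  exact hasSum_pi_prod_equiv (Fintype.equivFin ι).symm (key _ _ _ fun i => h _)

theorem hasSum_qsum {A ι : Type*} [AddCommGroup A] {Λ : AddSubgroup A} [Finite (A ⧸ Λ)]
    {f : ι → A → ℂ} {g : A → ℂ} (h : ∀ x, HasSum (fun n => f n x) (g x)) :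
    HasSum (fun n => qsum Λ (f n)) (qsum Λ g) := by
  have := Fintype.ofFinite (A ⧸ Λ)
  simp only [qsum_eq_sum]
  exact hasSum_sum fun x _ => h _

/-- The polynomial `(x + d - 3) ⋯ (x + 1) / (d - 3)!`. -/
def vertexPoly (d : ℕ) : Polynomial ℚ :=
  Polynomial.C (1 / ((d - 3).factorial : ℚ)) *
    ∏ j ∈ Finset.Icc 1 (d - 3), (Polynomial.X + Polynomial.C (j : ℚ))

theorem eval_vertexPoly (d n : ℕ) :
    (vertexPoly d).eval (n : ℚ) = ((n + (d - 3)).choose (d - 3) : ℕ) := by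
  rw [vertexPoly, Polynomial.eval_mul, Polynomial.eval_C, Polynomial.eval_prod]
  have h1 : ∏ j ∈ Finset.Icc 1 (d - 3), (Polynomial.X + Polynomial.C (j : ℚ)).eval (n : ℚ) =
      (((n + 1).ascFactorial (d - 3) : ℕ) : ℚ) := by
    rw [Nat.ascFactorial_eq_prod_range, ← Finset.Ico_add_one_right_eq_Icc,
      Finset.prod_Ico_eq_prod_range]
    push_cast
    refine Finset.prod_congr (by simp) fun j _ => ?_
    simp
    ring
  rw [h1, Nat.ascFactorial_eq_factorial_mul_choose]
  have h2 : ((d - 3).factorial : ℚ) ≠ 0 := by exact_mod_cast (d - 3).factorial_ne_zero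
  push_cast
  field_simp

/-- The negative binomial series. -/
theorem hasSum_vertexPoly {d : ℕ} (hd : 3 ≤ d) {y : ℂ} (hy : ‖y‖ < 1) :
    HasSum (fun n : ℕ => (((vertexPoly d).eval (n : ℚ) : ℚ) : ℂ) * y ^ n)
      ((1 - y) ^ ((2 : ℤ) - d)) := by
  have h1 := hasSum_choose_mul_geometric_of_norm_lt_one (d - 3) hy
  have h2 : (1 - y) ^ ((2 : ℤ) - d) = 1 / (1 - y) ^ (d - 3 + 1) := by
    rw [one_div, ← zpow_natCast, ← zpow_neg]
    congr 1
    omega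
  rw [h2]
  refine h1.congr_fun ?_
  intro n
  rw [eval_vertexPoly]
  push_cast
  rfl

variable {V : Type*} [Fintype V] [DecidableEq V] {G : SimpleGraph V} [DecidableRel G.Adj]
  {w : V → ℤ}

theorem P_eq_prod :
    P G = ∏ v : V3 G, Polynomial.aeval (MvPolynomial.X v) (vertexPoly (G.degree v.1)) := by
  refine Finset.prod_congr rfl fun v _ => ?_
  simp only [vertexPoly, map_mul, map_prod, map_add, Polynomial.aeval_X, Polynomial.aeval_C]
  rfl

theorem eval_P (n : V3 G → ℚ) :
    MvPolynomial.eval n (P G) = ∏ v : V3 G, (vertexPoly (G.degree v.1)).eval (n v) := by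
  rw [P_eq_prod, map_prod]
  refine Finset.prod_congr rfl fun v _ => ?_
  have : MvPolynomial.eval n (Polynomial.aeval (MvPolynomial.X v) (vertexPoly (G.degree v.1))) =
      MvPolynomial.aeval n (Polynomial.aeval (MvPolynomial.X v) (vertexPoly (G.degree v.1))) := rfl
  rw [this, ← Polynomial.aeval_algHom_apply, MvPolynomial.aeval_X]
  rfl

/-- Vertices of degree two contribute trivial factors. -/
theorem prod_V2_eq_prod_V3 {g : V2 G → ℂ} (h : ∀ v, ¬ 3 ≤ G.degree v.1 → g v = 1) :
    ∏ v, g v = ∏ v : V3 G, g (V3.toV2 G v) := by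
  refine (Fintype.prod_of_injective (V3.toV2 G) (fun a b hab => ?_) _ _ (fun v hv => h v ?_)
    fun _ => rfl).symm
  · exact Subtype.ext (congrArg (fun x : V2 G => x.1) hab)
  · exact fun h3 => hv ⟨⟨v.1, h3⟩, rfl⟩

theorem ext0_toV2 {R : Type*} [Zero R] (x : V3 G → R) (v : V3 G) : ext0 G x (V3.toV2 G v) = x v :=
  dif_pos v.2

theorem ext0_of_not {R : Type*} [Zero R] (x : V3 G → R) {v : V2 G} (h : ¬ 3 ≤ G.degree v.1) :
    ext0 G x v = 0 := dif_neg h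

/-- The Gaussian exponential as a combination of characters. -/
theorem e_Q_ext0_mul_qsum (hW : IsUnit (linkingMatrix G w).det)
    (hleaf : ∀ i, G.degree i = 1 → w i ≤ -2) {k : ℕ} (hk : 0 < k) {α : V2 G → ℚ}
    (hα : α ∈ calS G w) (n : V3 G → ℕ) :
    e ((Q G w (fun v => ext0 G (fun u => (n u : ℚ)) v + α v) : ℚ) / (k : ℂ)) *
        qsum (lattice G w k) (gaussWeight G w k) =
      qsum (lattice G w k) fun μ => gaussWeight G w k μ *
        ((∏ v : V2 G, e ((μ v : ℂ) * α v / k)) *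
          ∏ v : V3 G, e ((μ (V3.toV2 G v) : ℂ) / k) ^ n v) := by
  rw [e_Q_mul_qsum hW hleaf hk _ (exists_castV_eq_two_smul hW hleaf _ fun v => ?_)]
  · refine qsum_congr fun μ => ?_
    have h1 : ∏ v : V3 G, e ((μ (V3.toV2 G v) : ℂ) / k) ^ n v =
        ∏ v : V2 G, e ((μ v : ℂ) / k) ^ ext0 G n v := by
      rw [prod_V2_eq_prod_V3]
      · simp only [ext0_toV2]
      · intro v hv
        rw [ext0_of_not n hv, pow_zero]
    have h2 : ∀ v : V2 G, e ((μ v : ℂ) / k) ^ ext0 G n v =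
        e (((ext0 G n v : ℕ) : ℂ) * ((μ v : ℂ) / k)) := fun v => by
      rw [← zpow_natCast, e_zpow]; rfl
    rw [h1, ← Finset.prod_mul_distrib]
    congr 1
    rw [Finset.prod_congr rfl fun v _ => by rw [h2 v, ← e_add], ← e_sum]
    congr 1
    simp only [dotProduct, castV]
    push_cast
    rw [Finset.sum_div]
    refine Finset.sum_congr rfl fun v _ => ?_
    have h3 : ((ext0 G (fun u => (n u : ℚ)) v : ℚ) : ℂ) = ((ext0 G n v : ℕ) : ℂ) := by
      by_cases hv : 3 ≤ G.degree v.1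
      · simp [ext0, hv]
      · simp [ext0, hv]
    rw [h3]
    ring
  · obtain ⟨l, hl⟩ := exists_point_of_mem_calS hα v
    refine ⟨l, (ext0 G n v : ℕ), ?_⟩
    have h3 : ext0 G (fun u => (n u : ℚ)) v = ((ext0 G n v : ℕ) : ℚ) := by
      by_cases hv : 3 ≤ G.degree v.1
      · simp [ext0, hv]
      · simp [ext0, hv]
    rw [h3, hl]
    push_cast
    ring

theorem qsum_gaussWeight_ne_zero
    (hneg : (-(linkingMatrix G w).map (Int.cast : ℤ → ℝ)).PosDef)
    (hW : IsUnit (linkingMatrix G w).det) (hleaf : ∀ i, G.degree i = 1 → w i ≤ -2)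
    {k : ℕ} (hk : 0 < k) : qsum (lattice G w k) (gaussWeight G w k) ≠ 0 := by
  intro h
  have := prefactor_mul_qsum hneg hW hleaf hk
  rw [h, mul_zero] at this
  exact pow_ne_zero _ (by norm_num) this.symm

/-- Each inner series, multiplied by the Gauss sum, converges to a combination of products of
geometric series. -/
theorem hasSum_term_mul_qsum (hW : IsUnit (linkingMatrix G w).det)
    (hleaf : ∀ i, G.degree i = 1 → w i ≤ -2) {k : ℕ} (hk : 0 < k) {t : V3 G → ℝ}
    (ht : ∀ v, 0 < t v) {α : V2 G → ℚ} (hα : α ∈ calS G w) :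
    HasSum (fun n => term G w k (f1 G) t α n * qsum (lattice G w k) (gaussWeight G w k))
      (qsum (lattice G w k) fun μ => gaussWeight G w k μ * ∏ v : V2 G,
        (e ((μ v : ℂ) * α v / k) * cexp (-ext0 G (fun u => (t u : ℂ)) v * α v) *
          (1 - e ((μ v : ℂ) / k) * cexp (-ext0 G (fun u => (t u : ℂ)) v)) ^
            ((2 : ℤ) - G.degree v.1))) := by
  have hfin := finite_quotient_lattice hW hleaf hk
  set T : V2 G → ℂ := ext0 G (fun u => (t u : ℂ)) with hT
  have hterm : ∀ n, term G w k (f1 G) t α n * qsum (lattice G w k) (gaussWeight G w k) =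
      qsum (lattice G w k) fun μ => (gaussWeight G w k μ *
        ∏ v : V2 G, (e ((μ v : ℂ) * α v / k) * cexp (-T v * α v))) *
          ∏ v : V3 G, ((((vertexPoly (G.degree v.1)).eval (n v : ℚ) : ℚ) : ℂ) *
            (e ((μ (V3.toV2 G v) : ℂ) / k) * cexp (-(t v : ℂ))) ^ n v) := by
    intro n
    have hf : f1 G (fun v => ext0 G t v * (ext0 G (fun u => (n u : ℝ)) v + (α v : ℝ))) =
        (∏ v : V2 G, cexp (-T v * α v)) * ∏ v : V3 G, cexp (-(t v : ℂ)) ^ n v := by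
      have h1 : ∏ v : V3 G, cexp (-(t v : ℂ)) ^ n v = ∏ v : V2 G, cexp (-T v) ^ ext0 G n v := by
        rw [prod_V2_eq_prod_V3]
        · simp only [ext0_toV2, hT]
        · intro v hv
          rw [ext0_of_not n hv, pow_zero]
      rw [h1, ← Finset.prod_mul_distrib, f1,
        Finset.prod_congr rfl fun v _ => by rw [← Complex.exp_nat_mul, ← Complex.exp_add],
        ← Complex.exp_sum]
      congr 1
      push_cast
      rw [← Finset.sum_neg_distrib]
      refine Finset.sum_congr rfl fun v _ => ?_
      by_cases hv : 3 ≤ G.degree v.1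
      · simp only [hT, ext0, dif_pos hv]; push_cast; ring
      · simp only [hT, ext0, dif_neg hv]; push_cast; ring
    rw [term, mul_right_comm, mul_right_comm (e _) _ (qsum _ _), e_Q_ext0_mul_qsum hW hleaf hk hα,
      eval_P, hf, mul_assoc, mul_comm, ← qsum_mul_left]
    refine qsum_congr fun μ => ?_
    simp only [mul_pow, Finset.prod_mul_distrib]
    push_cast
    ring
  simp only [hterm]
  refine hasSum_qsum fun μ => ?_
  have hV3 : ∏ v : V2 G, (1 - e ((μ v : ℂ) / k) * cexp (-T v)) ^ ((2 : ℤ) - G.degree v.1) =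
      ∏ v : V3 G, (1 - e ((μ (V3.toV2 G v) : ℂ) / k) * cexp (-(t v : ℂ))) ^
        ((2 : ℤ) - G.degree v.1) := by
    rw [prod_V2_eq_prod_V3]
    · simp only [hT, ext0_toV2]; rfl
    · intro v hv
      have := v.2
      rw [show (2 : ℤ) - G.degree v.1 = 0 by omega, zpow_zero]
  rw [Finset.prod_mul_distrib (f := fun v : V2 G => e ((μ v : ℂ) * α v / k) * cexp (-T v * α v)),
    ← mul_assoc, hV3]
  have hsum : ∀ v : V3 G, HasSum (fun n : ℕ =>
      (((vertexPoly (G.degree v.1)).eval (n : ℚ) : ℚ) : ℂ) *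
        (e ((μ (V3.toV2 G v) : ℂ) / k) * cexp (-(t v : ℂ))) ^ n)
      ((1 - e ((μ (V3.toV2 G v) : ℂ) / k) * cexp (-(t v : ℂ))) ^ ((2 : ℤ) - G.degree v.1)) := by
    intro v
    refine hasSum_vertexPoly v.2 ?_
    have h1 := norm_e_ratCast ((μ (V3.toV2 G v) : ℚ) / k)
    push_cast at h1
    rw [norm_mul, h1, one_mul, Complex.norm_exp]
    simpa using ht v
  exact (hasSum_pi_prod _ _ hsum).mul_left _

/-- The inner series converge absolutely: in `ℂ` this is the same as summability. -/
theorem summable_term (hneg : (-(linkingMatrix G w).map (Int.cast : ℤ → ℝ)).PosDef)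
    (hW : IsUnit (linkingMatrix G w).det) (hleaf : ∀ i, G.degree i = 1 → w i ≤ -2)
    {k : ℕ} (hk : 0 < k) {t : V3 G → ℝ} (ht : ∀ v, 0 < t v) {α : V2 G → ℚ}
    (hα : α ∈ calS G w) : Summable (term G w k (f1 G) t α) :=
  (summable_mul_right_iff (qsum_gaussWeight_ne_zero hneg hW hleaf hk)).1
    (hasSum_term_mul_qsum hW hleaf hk ht hα).summable

/-- The series `F(f₁; t)` sums to the rational function. After multiplication by the Gauss sum, the
terms for a fixed `μ` are `gaussWeight` times a product over the vertices, which is evaluated by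
`sum_calSv_exp_mul`; the signs `(-1)^{deg v}` combine to `(-1)^{|V_1|}`. -/
theorem seriesF_eq_ratF (hneg : (-(linkingMatrix G w).map (Int.cast : ℤ → ℝ)).PosDef)
    (hW : IsUnit (linkingMatrix G w).det) (hleaf : ∀ i, G.degree i = 1 → w i ≤ -2)
    {k : ℕ} (hk : 0 < k) {t : V3 G → ℝ} (ht : ∀ v, 0 < t v) :
    seriesF G w k (f1 G) t = ratF G w k (fun v => (t v : ℂ)) := by
  have hfin := finite_quotient_lattice hW hleaf hk
  have hG0 := qsum_gaussWeight_ne_zero hneg hW hleaf hk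
  set T : V2 G → ℂ := ext0 G (fun u => (t u : ℂ)) with hT
  have h1 : ratF G w k (fun v => (t v : ℂ)) = prefactor G w k * qsum (lattice G w k) (fun μ =>
      gaussWeight G w k μ * ∏ v : V2 G, vertexFactor G w k v.1 (T v) (μ v)) := rfl
  refine mul_right_cancel₀ hG0 ?_
  rw [h1, mul_right_comm, prefactor_mul_qsum hneg hW hleaf hk, seriesF, Finset.sum_mul,
    Finset.sum_congr rfl fun α hα => by
      rw [mul_assoc, ← tsum_mul_right, (hasSum_term_mul_qsum hW hleaf hk ht hα).tsum_eq,
        ← qsum_mul_left],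
    ← qsum_sum, ← qsum_mul_left]
  refine qsum_congr fun μ => ?_
  set f : V2 G → ℚ → ℂ := fun v α => e ((μ v : ℂ) * α / k) * cexp (-T v * α) *
    (1 - e ((μ v : ℂ) / k) * cexp (-T v)) ^ ((2 : ℤ) - G.degree v.1) with hf
  have h2 : ∀ v : V2 G, ∑ α ∈ calSv G w v.1, (epsv G w v.1 α : ℂ) * f v α =
      (-1) ^ G.degree v.1 * vertexFactor G w k v.1 (T v) (μ v) := by
    intro v
    rw [← sum_calSv_exp_mul hW hleaf hk, Finset.sum_mul]
    refine Finset.sum_congr rfl fun α _ => ?_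
    simp only [hf]
    ring
  have h3 := sum_calS_prod (w := w) f
  rw [Finset.prod_congr rfl fun v _ => h2 v, Finset.prod_mul_distrib,
    prod_neg_one_pow_degree] at h3
  rw [Finset.sum_congr rfl fun α _ => mul_left_comm _ _ _, ← Finset.mul_sum]
  change gaussWeight G w k μ * ∑ α ∈ calS G w, (eps G w α : ℂ) * ∏ v, f v (α v) = _
  rw [h3]
  ring

end Series

/-! ### Convergent power series and Bernoulli polynomials -/

section PowerSeries

/-- The formal power series `F` converges to the function `f` near `0`. -/
def ConvergesTo (F : PowerSeries ℂ) (f : ℂ → ℂ) : Prop :=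
  ∀ᶠ z in 𝓝 (0 : ℂ), HasSum (fun n => PowerSeries.coeff n F * z ^ n) (f z)

theorem ConvergesTo.mul {F H : PowerSeries ℂ} {f h : ℂ → ℂ} (hF : ConvergesTo F f)
    (hH : ConvergesTo H h) : ConvergesTo (F * H) (fun z => f z * h z) := by
  filter_upwards [hF, hH] with z h1 h2
  have h3 := summable_norm_sum_mul_antidiagonal_of_summable_norm h1.summable.norm h2.summable.norm
  have h4 := tsum_mul_tsum_eq_tsum_sum_antidiagonal_of_summable_norm h1.summable.norm
    h2.summable.norm
  have h5 : ∀ n, PowerSeries.coeff n (F * H) * z ^ n = ∑ kl ∈ Finset.HasAntidiagonal.antidiagonal n,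
      (PowerSeries.coeff kl.1 F * z ^ kl.1) * (PowerSeries.coeff kl.2 H * z ^ kl.2) := by
    intro n
    rw [PowerSeries.coeff_mul, Finset.sum_mul]
    refine Finset.sum_congr rfl fun kl hkl => ?_
    rw [← Finset.HasAntidiagonal.mem_antidiagonal.1 hkl, pow_add]
    ring
  simp only [h5]
  rw [h1.tsum_eq, h2.tsum_eq] at h4
  rw [h4]
  exact h3.of_norm.hasSum

theorem ConvergesTo.hasFPowerSeriesAt {F : PowerSeries ℂ} {f : ℂ → ℂ} (hF : ConvergesTo F f) :
    HasFPowerSeriesAt f (FormalMultilinearSeries.ofScalars ℂ fun n => PowerSeries.coeff n F) 0 := by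
  rw [hasFPowerSeriesAt_iff]
  filter_upwards [hF] with z hz
  simp only [FormalMultilinearSeries.coeff_ofScalars, smul_eq_mul, zero_add]
  exact hz.congr_fun fun n => mul_comm _ _

theorem ConvergesTo.unique {F H : PowerSeries ℂ} {f : ℂ → ℂ} (hF : ConvergesTo F f)
    (hH : ConvergesTo H f) : F = H := by
  have h := hF.hasFPowerSeriesAt.eq_formalMultilinearSeries hH.hasFPowerSeriesAt
  ext n
  have := congrArg (fun p => FormalMultilinearSeries.coeff p n) h
  simpa only [FormalMultilinearSeries.coeff_ofScalars] using this

theorem convergesTo_rescale_exp (x : ℂ) :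
    ConvergesTo (PowerSeries.rescale x (PowerSeries.exp ℂ)) (fun z => cexp (x * z)) := by
  refine Eventually.of_forall fun z => ?_
  have h := NormedSpace.expSeries_div_hasSum_exp (x * z)
  rw [← Complex.exp_eq_exp_ℂ] at h
  refine h.congr_fun fun n => ?_
  rw [PowerSeries.coeff_rescale, PowerSeries.coeff_exp, mul_pow]
  simp
  ring

theorem convergesTo_X : ConvergesTo PowerSeries.X (fun z => z) := by
  refine Eventually.of_forall fun z => ?_
  have := hasSum_ite_eq (1 : ℕ) z
  refine this.congr_fun fun n => ?_
  rw [PowerSeries.coeff_X]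
  split_ifs with h
  · rw [h, pow_one, one_mul]
  · rw [zero_mul]

theorem convergesTo_exp_sub_one :
    ConvergesTo (PowerSeries.exp ℂ - 1) (fun z => cexp z - 1) := by
  have h := convergesTo_rescale_exp 1
  filter_upwards [h] with z hz
  rw [one_mul] at hz
  have h1 := hasSum_ite_eq (0 : ℕ) (1 : ℂ)
  refine (hz.sub h1).congr_fun fun n => ?_
  rw [map_sub, PowerSeries.coeff_one, PowerSeries.coeff_rescale, one_pow, one_mul, sub_mul]
  congr 1
  split_ifs with h
  · rw [h, pow_zero, one_mul]
  · rw [zero_mul]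

/-- The generating function of the Bernoulli polynomials converges near `0`. -/
theorem exists_hasSum_bernoulli (x : ℚ) : ∃ R > 0, ∀ z : ℂ, 0 < ‖z‖ → ‖z‖ < R → cexp z ≠ 1 ∧
    HasSum (fun n : ℕ => (((Polynomial.bernoulli n).eval x / n.factorial : ℚ) : ℂ) * z ^ n)
      (z * cexp (x * z) / (cexp z - 1)) := by
  have hexp : AnalyticAt ℂ (fun z : ℂ => cexp z - 1) 0 := by fun_prop
  obtain ⟨h, hh, hh0, hhz⟩ := exists_analytic_factor hexp (by simp)
  have h0 : h 0 ≠ 0 := by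
    have h1 : HasDerivAt (fun z : ℂ => cexp z - 1) 1 0 := by
      simpa using (Complex.hasDerivAt_exp 0).sub_const 1
    rw [hh0, h1.deriv]
    exact one_ne_zero
  have hne : ∀ᶠ z in 𝓝 (0 : ℂ), h z ≠ 0 := hh.continuousAt.eventually_ne h0
  have hg : AnalyticAt ℂ (fun z => cexp (x * z) * (h z)⁻¹) 0 :=
    AnalyticAt.mul (by fun_prop) (hh.inv h0)
  obtain ⟨p, hp⟩ := hg
  set A : PowerSeries ℂ := PowerSeries.mk p.coeff with hA
  have hAg : ConvergesTo A (fun z => cexp (x * z) * (h z)⁻¹) := by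
    rw [hasFPowerSeriesAt_iff] at hp
    filter_upwards [hp] with z hz
    simp only [zero_add, smul_eq_mul] at hz
    refine hz.congr_fun fun n => ?_
    rw [hA, PowerSeries.coeff_mk, mul_comm]
  have h1 : ConvergesTo (A * (PowerSeries.exp ℂ - 1)) (fun z => z * cexp (x * z)) := by
    filter_upwards [hAg.mul convergesTo_exp_sub_one, hne] with z hz hz0
    convert hz using 1
    rw [hhz]
    field_simp
  have h2 := h1.unique (convergesTo_X.mul (convergesTo_rescale_exp x))
  rw [← Polynomial.bernoulli_generating_function] at h2
  have h3 : (PowerSeries.exp ℂ - 1) ≠ 0 := by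
    intro h
    have := congrArg (PowerSeries.coeff 1) h
    simp [PowerSeries.coeff_exp, PowerSeries.coeff_one] at this
  have h4 := mul_right_cancel₀ h3 h2
  rw [ConvergesTo, h4] at hAg
  obtain ⟨R, hR, hRz⟩ := Metric.eventually_nhds_iff.1 (hAg.and hne)
  refine ⟨R, hR, fun z hz hzR => ?_⟩
  obtain ⟨hs, hz0⟩ := hRz (y := z) (by simpa using hzR)
  have hz' : z ≠ 0 := norm_pos_iff.1 hz
  have h5 : cexp z - 1 ≠ 0 := by rw [hhz]; exact mul_ne_zero hz' hz0
  refine ⟨sub_ne_zero.1 h5, ?_⟩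
  have h6 : z * cexp (x * z) / (cexp z - 1) = cexp (x * z) * (h z)⁻¹ := by
    rw [hhz]; field_simp
  rw [h6]
  refine hs.congr_fun fun n => ?_
  rw [PowerSeries.coeff_mk]
  congr 1
  have h7 : Polynomial.aeval (x : ℂ) ((1 / n.factorial : ℚ) • Polynomial.bernoulli n) =
      (((1 / n.factorial : ℚ) • Polynomial.bernoulli n).eval x : ℚ) := by
    have := Polynomial.aeval_algebraMap_apply ℂ x ((1 / n.factorial : ℚ) • Polynomial.bernoulli n)
    simpa using this
  rw [h7, Polynomial.eval_smul, smul_eq_mul]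
  push_cast
  ring

end PowerSeries

/-! ### Laurent expansions at `0` of functions of a positive variable -/

section Laurent

/-- The function `f` of a small positive real number `s` is the sum of the Laurent series with
coefficients `c` and finite principal part, evaluated at `-s`. -/
def HasLaurent (f : ℝ → ℂ) (c : ℤ → ℂ) : Prop :=
  (∃ N : ℕ, ∀ n < -(N : ℤ), c n = 0) ∧
    ∀ᶠ s : ℝ in 𝓝[>] (0 : ℝ), HasSum (fun n : ℤ => c n * (-(s : ℂ)) ^ n) (f s)

theorem HasLaurent.congr {f g : ℝ → ℂ} {c : ℤ → ℂ} (hf : HasLaurent f c)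
    (h : ∀ᶠ s : ℝ in 𝓝[>] (0 : ℝ), g s = f s) : HasLaurent g c := by
  refine ⟨hf.1, ?_⟩
  filter_upwards [hf.2, h] with s h1 h2
  rwa [h2]

theorem HasLaurent.const_mul {f : ℝ → ℂ} {c : ℤ → ℂ} (hf : HasLaurent f c) (a : ℂ) :
    HasLaurent (fun s => a * f s) (fun n => a * c n) := by
  obtain ⟨⟨N, hN⟩, h⟩ := hf
  refine ⟨⟨N, fun n hn => by beta_reduce; rw [hN n hn, mul_zero]⟩, ?_⟩
  filter_upwards [h] with s hs
  exact (hs.mul_left a).congr_fun fun n => mul_assoc _ _ _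

theorem HasLaurent.sum {κ : Type*} (S : Finset κ) {f : κ → ℝ → ℂ} {c : κ → ℤ → ℂ}
    (hf : ∀ i ∈ S, HasLaurent (f i) (c i)) :
    HasLaurent (fun s => ∑ i ∈ S, f i s) (fun n => ∑ i ∈ S, c i n) := by
  have h1 : ∀ i, ∃ N : ℕ, i ∈ S → ∀ n < -(N : ℤ), c i n = 0 := by
    intro i
    by_cases hi : i ∈ S
    · obtain ⟨N, hN⟩ := (hf i hi).1
      exact ⟨N, fun _ => hN⟩
    · exact ⟨0, fun h => absurd h hi⟩
  choose N hN using h1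
  refine ⟨⟨S.sup N, fun n hn => Finset.sum_eq_zero fun i hi => hN i hi n ?_⟩, ?_⟩
  · have := Finset.le_sup (f := N) hi
    omega
  · have := (eventually_all_finset S).2 fun i hi => (hf i hi).2
    filter_upwards [this] with s hs
    exact (hasSum_sum hs).congr_fun fun n => Finset.sum_mul _ _ _

theorem tendsto_mul_nhdsGT_zero {k : ℝ} (hk : 0 < k) :
    Tendsto (fun s : ℝ => k * s) (𝓝[>] 0) (𝓝[>] 0) := by
  refine tendsto_nhdsWithin_iff.2 ⟨?_, ?_⟩
  · exact ((continuous_const.mul continuous_id).tendsto' _ _ (by simp)).mono_left nhdsWithin_le_nhds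
  · filter_upwards [self_mem_nhdsWithin] with s hs
    exact mul_pos hk hs

theorem HasLaurent.comp_mul {f : ℝ → ℂ} {c : ℤ → ℂ} (hf : HasLaurent f c) {k : ℕ} (hk : 0 < k) :
    HasLaurent (fun s => f (k * s)) (fun n => (k : ℂ) ^ n * c n) := by
  obtain ⟨⟨N, hN⟩, h⟩ := hf
  refine ⟨⟨N, fun n hn => by beta_reduce; rw [hN n hn, mul_zero]⟩, ?_⟩
  filter_upwards [(tendsto_mul_nhdsGT_zero (by exact_mod_cast hk : (0 : ℝ) < k)).eventually h]
    with s hs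
  refine hs.congr_fun fun n => ?_
  push_cast
  rw [← mul_neg, mul_zpow]
  ring

/-- The values at a sequence of negative numbers tending to zero determine a power series. -/
theorem eq_zero_of_hasSum_zero {d : ℕ → ℂ}
    (h : ∀ᶠ s : ℝ in 𝓝[>] (0 : ℝ), HasSum (fun n : ℕ => d n * (-(s : ℂ)) ^ n) 0) : d = 0 := by
  set p := FormalMultilinearSeries.ofScalars ℂ d with hp
  obtain ⟨s₀, hs₀, hs₀'⟩ := (h.and self_mem_nhdsWithin).exists
  have hs₀pos : 0 < s₀ := hs₀'
  have hrad : 0 < p.radius := by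
    have h1 : Summable fun n => ‖p n‖ * ((⟨s₀, hs₀pos.le⟩ : NNReal) : ℝ) ^ n := by
      refine hs₀.summable.norm.congr fun n => ?_
      rw [hp, FormalMultilinearSeries.ofScalars_norm, norm_mul, norm_pow, norm_neg,
        Complex.norm_real, Real.norm_of_nonneg hs₀pos.le]
    refine lt_of_lt_of_le ?_ (p.le_radius_of_summable_norm h1)
    exact ENNReal.coe_pos.2 hs₀pos
  have hb := p.hasFPowerSeriesOnBall hrad
  have hsum : ∀ z, p.sum z = ∑' n, d n * z ^ n := fun z => by
    exact FormalMultilinearSeries.ofScalars_sum_eq (E := ℂ) d z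
  have hfreq : ∃ᶠ z in 𝓝[≠] (0 : ℂ), p.sum z = 0 := by
    have ht : Tendsto (fun s : ℝ => -(s : ℂ)) (𝓝[>] 0) (𝓝[≠] 0) := by
      refine tendsto_nhdsWithin_iff.2 ⟨?_, ?_⟩
      · exact (Complex.continuous_ofReal.neg.tendsto' _ _ (by simp)).mono_left nhdsWithin_le_nhds
      · filter_upwards [self_mem_nhdsWithin] with s hs
        have : (s : ℝ) ≠ 0 := (ne_of_gt hs)
        simpa using this
    refine ht.frequently (Eventually.frequently ?_)
    filter_upwards [h] with s hs
    rw [hsum, hs.tsum_eq]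
  have hz := (hb.analyticAt.frequently_zero_iff_eventually_zero).1 hfreq
  have := (hb.hasFPowerSeriesAt.locally_zero_iff).1 hz
  exact (FormalMultilinearSeries.ofScalars_series_eq_zero ℂ).1 this

/-- Laurent coefficients are unique: after multiplication by a power of `-s` this is the identity
theorem for power series. -/
theorem HasLaurent.unique {f : ℝ → ℂ} {c c' : ℤ → ℂ} (h : HasLaurent f c) (h' : HasLaurent f c') :
    c = c' := by
  obtain ⟨⟨N, hN⟩, h⟩ := h
  obtain ⟨⟨N', hN'⟩, h'⟩ := h'
  set M : ℕ := max N N' with hM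
  have hd : ∀ n : ℤ, n < -(M : ℤ) → c n - c' n = 0 := by
    intro n hn
    rw [hN n (by omega), hN' n (by omega), sub_zero]
  have hinj : Function.Injective fun m : ℕ => (m : ℤ) - M := fun a b hab => by
    simp only at hab
    omega
  have hzero : (fun m : ℕ => c (m - M) - c' (m - M)) = 0 := by
    refine eq_zero_of_hasSum_zero ?_
    filter_upwards [h, h', self_mem_nhdsWithin] with s h1 h2 hs
    have hs0 : -(s : ℂ) ≠ 0 := by
      have : s ≠ 0 := ne_of_gt hs
      simpa using this
    have h3 := (h1.sub h2).mul_left ((-(s : ℂ)) ^ M)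
    rw [sub_self, mul_zero] at h3
    rw [← hinj.hasSum_iff] at h3
    · refine h3.congr_fun fun m => ?_
      simp only [Function.comp]
      rw [zpow_sub₀ hs0, zpow_natCast, zpow_natCast]
      field_simp
    · intro n hn
      have : n < -(M : ℤ) := by
        by_contra! hn'
        exact hn ⟨(n + M).toNat, by simp only; omega⟩
      rw [← sub_mul, hd n this, zero_mul, mul_zero]
  funext n
  by_cases hn : n < -(M : ℤ)
  · exact sub_eq_zero.1 (hd n hn)
  · have := congrFun hzero (n + M).toNat
    simp only [Pi.zero_apply] at this
    rw [show (((n + M).toNat : ℕ) : ℤ) - M = n by omega] at this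
    exact sub_eq_zero.1 this

theorem hasLaurent_of_analyticAt {K : ℂ → ℂ} (hK : AnalyticAt ℂ K 0) :
    ∃ c : ℤ → ℂ, HasLaurent (fun s => K s) c ∧ (∀ n < 0, c n = 0) ∧ c 0 = K 0 := by
  have hK' : AnalyticAt ℂ (fun z => K (-z)) 0 := by
    refine AnalyticAt.fun_comp (g := K) (f := fun z : ℂ => -z) (by simpa using hK) ?_
    fun_prop
  obtain ⟨p, hp⟩ := hK'
  have hp1 := hasFPowerSeriesAt_iff.1 hp
  simp only [zero_add, smul_eq_mul] at hp1
  refine ⟨fun n => if 0 ≤ n then p.coeff n.toNat else 0, ⟨⟨0, fun n hn => ?_⟩, ?_⟩,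
    fun n hn => ?_, ?_⟩
  · exact if_neg (by omega)
  · have ht : Tendsto (fun s : ℝ => -(s : ℂ)) (𝓝[>] 0) (𝓝 0) :=
      (Complex.continuous_ofReal.neg.tendsto' _ _ (by simp)).mono_left nhdsWithin_le_nhds
    filter_upwards [ht.eventually hp1] with s hs
    rw [neg_neg] at hs
    have hinj : Function.Injective fun m : ℕ => (m : ℤ) := Nat.cast_injective
    rw [← hinj.hasSum_iff]
    · refine hs.congr_fun fun m => ?_
      simp [mul_comm]
    · intro n hn
      rw [if_neg, zero_mul]
      intro h
      exact hn ⟨n.toNat, by simp only; omega⟩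
  · exact if_neg (by omega)
  · have h0 := hp1.self_of_nhds
    have h1 := hasSum_single (f := fun n : ℕ => (0 : ℂ) ^ n * p.coeff n) 0 fun n hn => by simp [hn]
    have := h1.unique h0
    simpa using this

end Laurent

/-! ### Laurent expansions with coefficients `𝔹_{m,n}` -/

section EulerMaclaurin

/-- Termwise differentiation of a locally dominated series of holomorphic functions. -/
theorem hasSum_deriv_of_locally_dominated {ι : Type*} {F : ι → ℂ → ℂ} {f : ℂ → ℂ} {U : Set ℂ}
    (hU : IsOpen U) (hF : ∀ z ∈ U, HasSum (fun i => F i z) (f z))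
    (hd : ∀ i, DifferentiableOn ℂ (F i) U) {z : ℂ} (hz : z ∈ U) {u : ι → ℝ} (hu : Summable u)
    (hb : ∀ i, ∀ w ∈ U, ‖F i w‖ ≤ u i) : HasSum (fun i => deriv (F i) z) (deriv f z) := by
  have h1 := hasSum_deriv_of_summable_norm hu hd hU hb hz
  have h2 : f =ᶠ[𝓝 z] fun w => ∑' i, F i w := by
    filter_upwards [hU.mem_nhds hz] with w hw
    exact (hF w hw).tsum_eq.symm
  rwa [h2.deriv_eq]

/-- A Laurent series may be differentiated termwise on a punctured disc. -/
theorem hasSum_laurent_deriv {c : ℤ → ℂ} {f : ℂ → ℂ} {R : ℝ}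
    (h : ∀ z : ℂ, 0 < ‖z‖ → ‖z‖ < R → HasSum (fun n : ℤ => c n * z ^ n) (f z)) {z : ℂ}
    (hz : 0 < ‖z‖) (hzR : ‖z‖ < R) :
    HasSum (fun n : ℤ => (n + 1) * c (n + 1) * z ^ n) (deriv f z) := by
  set r₁ := ‖z‖ / 2 with hr₁
  set r₂ := (‖z‖ + R) / 2 with hr₂
  have h1 : 0 < r₁ := by positivity
  have h2 : r₁ < ‖z‖ := by rw [hr₁]; linarith
  have h3 : ‖z‖ < r₂ := by rw [hr₂]; linarith
  have h4 : r₂ < R := by rw [hr₂]; linarith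
  have hsum : ∀ r : ℝ, 0 < r → r < R → Summable fun n : ℤ => ‖c n‖ * r ^ n := by
    intro r hr hrR
    have hn : ‖(r : ℂ)‖ = r := by rw [Complex.norm_real, Real.norm_of_nonneg hr.le]
    refine (h r (by rwa [hn]) (by rwa [hn])).summable.norm.congr fun n => ?_
    rw [norm_mul, norm_zpow, hn]
  set U : Set ℂ := {w | r₁ < ‖w‖ ∧ ‖w‖ < r₂} with hU
  have hUo : IsOpen U :=
    (isOpen_lt continuous_const continuous_norm).inter (isOpen_lt continuous_norm continuous_const)
  have key := hasSum_deriv_of_locally_dominated (F := fun (n : ℤ) w => c n * w ^ n) (f := f)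
    (u := fun n => ‖c n‖ * r₁ ^ n + ‖c n‖ * r₂ ^ n) hUo
    (fun w hw => h w (h1.trans hw.1) (hw.2.trans h4)) (fun n w hw => ?_) (z := z) ⟨h2, h3⟩
    ((hsum r₁ h1 (h2.trans hzR)).add (hsum r₂ (hz.trans h3) h4)) (fun n w hw => ?_)
  · rw [← (Equiv.addRight (1 : ℤ)).hasSum_iff] at key
    refine key.congr_fun fun n => ?_
    simp only [Function.comp, Equiv.coe_addRight]
    rw [deriv_const_mul_field, deriv_zpow]
    push_cast
    rw [add_sub_cancel_right]
    ring
  · have hw0 : w ≠ 0 := norm_pos_iff.1 (h1.trans hw.1)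
    exact ((differentiableAt_zpow.2 (Or.inl hw0)).const_mul _).differentiableWithinAt
  · rw [norm_mul, norm_zpow, ← mul_add]
    refine mul_le_mul_of_nonneg_left ?_ (norm_nonneg _)
    have h5 : 0 < ‖w‖ := h1.trans hw.1
    rcases le_or_gt 0 n with hn | hn
    · exact (zpow_le_zpow_left₀ hn h5.le hw.2.le).trans (le_add_of_nonneg_left (by positivity))
    · refine le_trans ?_ (le_add_of_nonneg_right (zpow_nonneg (h5.trans hw.2).le n))
      have h6 := zpow_le_zpow_left₀ (n := -n) (by omega) h1.le hw.1.le
      rw [zpow_neg, zpow_neg] at h6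
      exact (inv_le_inv₀ (by positivity) (by positivity)).1 h6

/-- A series of exponentials may be differentiated termwise on the left half plane. -/
theorem hasSum_exp_deriv {c X : ℕ → ℝ} {f : ℂ → ℂ}
    (h : ∀ z : ℂ, z.re < 0 → HasSum (fun r : ℕ => c r * cexp (z * X r)) (f z)) {z : ℂ}
    (hz : z.re < 0) : HasSum (fun r : ℕ => (c r * X r : ℝ) * cexp (z * X r)) (deriv f z) := by
  have hsum : ∀ a : ℝ, a < 0 → Summable fun r : ℕ => |c r| * Real.exp (a * X r) := by
    intro a ha
    refine (h a (by simpa using ha)).summable.norm.congr fun r => ?_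
    rw [norm_mul, Complex.norm_real, Real.norm_eq_abs, Complex.norm_exp]
    simp
  set U : Set ℂ := {w | 2 * z.re < w.re ∧ w.re < z.re / 2} with hU
  have hUo : IsOpen U := (isOpen_lt continuous_const Complex.continuous_re).inter
    (isOpen_lt Complex.continuous_re continuous_const)
  have hder : ∀ r w, HasDerivAt (fun w : ℂ => (c r : ℂ) * cexp (w * X r))
      ((c r * X r : ℝ) * cexp (w * X r)) w := by
    intro r w
    have := (((hasDerivAt_id w).mul_const (X r : ℂ)).cexp).const_mul (c r : ℂ)
    refine this.congr_deriv ?_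
    push_cast
    simp only [id]
    ring
  have key := hasSum_deriv_of_locally_dominated (F := fun (r : ℕ) w => (c r : ℂ) * cexp (w * X r))
    (f := f)
    (u := fun r => |c r| * Real.exp (2 * z.re * X r) + |c r| * Real.exp (z.re / 2 * X r)) hUo
    (fun w hw => h w (by have := hw.2; linarith))
    (fun r w hw => (hder r w).differentiableAt.differentiableWithinAt) (z := z)
    ⟨by linarith, by linarith⟩
    ((hsum _ (by linarith)).add (hsum _ (by linarith))) (fun r w hw => ?_)
  · exact key.congr_fun fun r => ((hder r z).deriv).symm
  · rw [norm_mul, Complex.norm_real, Real.norm_eq_abs, Complex.norm_exp, ← mul_add]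
    refine mul_le_mul_of_nonneg_left ?_ (abs_nonneg _)
    have h1 : (w * (X r : ℂ)).re = w.re * X r := by simp
    rw [h1]
    rcases le_total 0 (X r) with hX | hX
    · refine le_trans (Real.exp_le_exp.2 ?_) (le_add_of_nonneg_left (Real.exp_pos _).le)
      exact mul_le_mul_of_nonneg_right hw.2.le hX
    · refine le_trans (Real.exp_le_exp.2 ?_) (le_add_of_nonneg_right (Real.exp_pos _).le)
      exact mul_le_mul_of_nonpos_right hw.1.le hX

/-- The Laurent coefficients at `z = 0` of the `j`-th derivative of `exp(x z) / (1 - exp z)`. -/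
def lcoef (x : ℚ) (j : ℕ) (n : ℤ) : ℚ :=
  if 0 ≤ n + j + 1 then
    -((Polynomial.bernoulli (n + j + 1).toNat).eval x / ((n + j + 1).toNat.factorial : ℚ)) *
      (j.factorial * (Ring.choose (n + j) j : ℤ))
  else 0

theorem factorial_mul_choose_succ (m : ℤ) (j : ℕ) :
    ((j + 1).factorial : ℤ) * Ring.choose m (j + 1) =
      (j.factorial * Ring.choose m j) * (m - j) := by
  have h1 := Ring.descPochhammer_eq_factorial_smul_choose m (j + 1)
  have h2 := Ring.descPochhammer_eq_factorial_smul_choose m j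
  rw [nsmul_eq_mul] at h1 h2
  rw [← h1, ← h2, ← Polynomial.eval_eq_smeval, ← Polynomial.eval_eq_smeval,
    descPochhammer_succ_right, Polynomial.eval_mul]
  simp

theorem lcoef_succ (x : ℚ) (j : ℕ) (n : ℤ) :
    lcoef x (j + 1) n = (n + 1) * lcoef x j (n + 1) := by
  have h1 : n + ((j + 1 : ℕ) : ℤ) = n + 1 + j := by push_cast; ring
  rw [lcoef, lcoef, h1]
  split_ifs
  · have h2 := factorial_mul_choose_succ (n + 1 + j) j
    rw [add_sub_cancel_right] at h2
    have h3 : ((j + 1).factorial : ℚ) * (Ring.choose (n + 1 + j) (j + 1) : ℤ) =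
        (j.factorial * (Ring.choose (n + 1 + j) j : ℤ)) * (n + 1) := by exact_mod_cast h2
    rw [h3]
    ring
  · rw [mul_zero]

/-- The function `exp(x z) / (1 - exp z)` and its derivatives. -/
def expQuot (x : ℚ) (j : ℕ) : ℂ → ℂ := deriv^[j] fun z => cexp (x * z) / (1 - cexp z)

theorem expQuot_succ (x : ℚ) (j : ℕ) : expQuot x (j + 1) = deriv (expQuot x j) :=
  Function.iterate_succ_apply' _ _ _

/-- The Laurent expansion for `j = 0` is the generating series of the Bernoulli polynomials; the
others follow by differentiation. The disc does not depend on `j`. -/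
theorem exists_hasSum_expQuot (x : ℚ) : ∃ R > 0, ∀ j : ℕ, ∀ z : ℂ, 0 < ‖z‖ → ‖z‖ < R →
    HasSum (fun n : ℤ => (lcoef x j n : ℂ) * z ^ n) (expQuot x j z) := by
  obtain ⟨R, hR, h⟩ := exists_hasSum_bernoulli x
  refine ⟨R, hR, fun j => ?_⟩
  induction j with
  | zero =>
    intro z hz hzR
    obtain ⟨h1, h2⟩ := h z hz hzR
    have hz0 : z ≠ 0 := norm_pos_iff.1 hz
    have hinj : Function.Injective fun m : ℕ => (m : ℤ) - 1 := fun a b hab => by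
      simp only at hab
      omega
    rw [← hinj.hasSum_iff]
    · have h3 := h2.mul_left (-z⁻¹)
      have h4 : -z⁻¹ * (z * cexp (x * z) / (cexp z - 1)) = expQuot x 0 z := by
        have h5 : cexp z - 1 ≠ 0 := sub_ne_zero.2 h1
        have h6 : 1 - cexp z ≠ 0 := sub_ne_zero.2 (Ne.symm h1)
        rw [expQuot, Function.iterate_zero, id]
        field_simp
        ring
      rw [h4] at h3
      refine h3.congr_fun fun m => ?_
      simp only [Function.comp]
      have h7 : (m : ℤ) - 1 + ((0 : ℕ) : ℤ) + 1 = m := by push_cast; ring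
      rw [lcoef, h7, if_pos (by omega), zpow_sub₀ hz0, zpow_natCast, zpow_one, Int.toNat_natCast]
      simp
      ring
    · intro n hn
      rw [lcoef, if_neg]
      · simp
      · intro h0
        exact hn ⟨(n + 1).toNat, by simp only; omega⟩
  | succ j ih =>
    intro z hz hzR
    rw [expQuot_succ]
    refine (hasSum_laurent_deriv ih hz hzR).congr_fun fun n => ?_
    rw [lcoef_succ]
    push_cast
    rfl

/-- The `j`-th derivative of the geometric series `∑_r exp(z (x + r))`. -/
theorem hasSum_expQuot (x : ℚ) (j : ℕ) : ∀ z : ℂ, z.re < 0 →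
    HasSum (fun r : ℕ => (((x + r : ℝ) ^ j : ℝ) : ℂ) * cexp (z * (x + r : ℝ))) (expQuot x j z) := by
  induction j with
  | zero =>
    intro z hz
    have h1 : ‖cexp z‖ < 1 := by rw [Complex.norm_exp]; simpa using hz
    have h2 := (hasSum_geometric_of_norm_lt_one h1).mul_left (cexp (x * z))
    rw [← div_eq_mul_inv] at h2
    refine h2.congr_fun fun r => ?_
    rw [← Complex.exp_nat_mul, ← Complex.exp_add, pow_zero]
    push_cast
    rw [one_mul]
    congr 1
    ring
  | succ j ih =>
    intro z hz
    rw [expQuot_succ]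
    exact (hasSum_exp_deriv ih hz).congr_fun fun r => by rw [pow_succ]

/-- The series `∑_r (b + r)^m exp(-s (a + b + r))` has the Laurent coefficients `-𝔹_{m,n}(a, b)`
in `-s`: expand `(b + r)^m = ((a + b + r) - a)^m`. -/
theorem exists_hasLaurent_bbB (m : ℕ) (a b : ℚ) : ∃ f : ℝ → ℂ,
    HasLaurent f (fun n => ((-bbB m n a b : ℚ) : ℂ)) ∧
    ∀ s : ℝ, 0 < s →
      HasSum (fun r : ℕ => (((b + r) ^ m : ℚ) : ℂ) * cexp (-s * (a + b + r))) (f s) := by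
  set g : ℕ → ℂ := fun j => (((m.choose j : ℚ) * (-a) ^ (m - j) : ℚ) : ℂ) with hg
  refine ⟨fun s => ∑ j ∈ Finset.range (m + 1), g j * expQuot (a + b) j (-s), ?_, fun s hs => ?_⟩
  · have h1 : ∀ j ∈ Finset.range (m + 1), HasLaurent (fun s => g j * expQuot (a + b) j (-s))
        (fun n => g j * (lcoef (a + b) j n : ℂ)) := by
      intro j _
      refine HasLaurent.const_mul ⟨⟨j + 1, fun n hn => ?_⟩, ?_⟩ _
      · rw [lcoef, if_neg (by push_cast at hn; omega), Rat.cast_zero]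
      · obtain ⟨R, hR, h⟩ := exists_hasSum_expQuot (a + b)
        filter_upwards [Ioo_mem_nhdsGT hR] with s hs
        have hn : ‖-(s : ℂ)‖ = s := by
          rw [norm_neg, Complex.norm_real, Real.norm_of_nonneg hs.1.le]
        exact h j _ (by rw [hn]; exact hs.1) (by rw [hn]; exact hs.2)
    have h2 := HasLaurent.sum _ h1
    convert h2 using 1
    funext n
    simp only [hg]
    rw [bbB, Finset.mul_sum, ← Finset.sum_neg_distrib]
    push_cast
    refine Finset.sum_congr rfl fun j hj => ?_
    have hjm : j ≤ m := Nat.lt_succ_iff.1 (Finset.mem_range.1 hj)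
    have h3 : (m.factorial : ℂ) = m.choose j * j.factorial * (m - j).factorial := by
      exact_mod_cast (Nat.choose_mul_factorial_mul_factorial hjm).symm
    have h4 : ((m - j).factorial : ℂ) ≠ 0 := by exact_mod_cast (m - j).factorial_ne_zero
    rw [lcoef, h3]
    split_ifs
    · push_cast
      field_simp
    · simp
  · have h1 : HasSum (fun r : ℕ => ∑ j ∈ Finset.range (m + 1), g j *
        (((((a + b : ℚ) : ℝ) + r : ℝ) ^ j : ℝ) * cexp (-s * (((a + b : ℚ) : ℝ) + r : ℝ))))
        (∑ j ∈ Finset.range (m + 1), g j * expQuot (a + b) j (-s)) :=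
      hasSum_sum fun j _ => (hasSum_expQuot (a + b) j (-s) (by simpa using hs)).mul_left _
    refine h1.congr_fun fun r => ?_
    have h2 : (b + r : ℚ) ^ m = ∑ j ∈ Finset.range (m + 1),
        ((m.choose j : ℚ) * (-a) ^ (m - j)) * (a + b + r) ^ j := by
      rw [show b + (r : ℚ) = (a + b + r) + -a by ring, add_pow]
      exact Finset.sum_congr rfl fun j _ => by ring
    rw [h2, Rat.cast_sum, Finset.sum_mul]
    refine Finset.sum_congr rfl fun j _ => ?_
    simp only [hg]
    push_cast
    ring

/-- The same for a polynomial in place of a power, along a residue class modulo `k`. -/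
theorem exists_hasLaurent_poly (p : Polynomial ℚ) {k : ℕ} (hk : 0 < k) (α : ℚ) (l : ℕ) :
    ∃ f : ℝ → ℂ,
      HasLaurent f (fun n => ∑ j ∈ p.support, (p.coeff j : ℂ) *
        ((k : ℂ) ^ ((j : ℤ) + n) * ((-bbB j n (α / k) (l / k) : ℚ) : ℂ))) ∧
      ∀ s : ℝ, 0 < s → HasSum (fun r : ℕ => ((p.eval ((l + k * r : ℕ) : ℚ) : ℚ) : ℂ) *
        cexp (-s * (α + (l + k * r : ℕ)))) (f s) := by
  have hk' : (k : ℂ) ≠ 0 := by exact_mod_cast hk.ne'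
  have hkq : (k : ℚ) ≠ 0 := by exact_mod_cast hk.ne'
  choose f hf hfs using fun j => exists_hasLaurent_bbB j (α / k) (l / k)
  refine ⟨fun s => ∑ j ∈ p.support, ((p.coeff j : ℂ) * (k : ℂ) ^ j) * f j (k * s), ?_,
    fun s hs => ?_⟩
  · have h1 := HasLaurent.sum p.support fun j _ =>
      ((hf j).comp_mul hk).const_mul ((p.coeff j : ℂ) * (k : ℂ) ^ j)
    convert h1 using 1
    funext n
    refine Finset.sum_congr rfl fun j _ => ?_
    rw [zpow_add₀ hk', zpow_natCast]
    ring
  · have h1 : HasSum (fun r : ℕ => ∑ j ∈ p.support, ((p.coeff j : ℂ) * (k : ℂ) ^ j) *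
        (((((l : ℚ) / k + r) ^ j : ℚ) : ℂ) *
          cexp (-((k * s : ℝ) : ℂ) * ((α / k : ℚ) + ((l : ℚ) / k : ℚ) + r))))
        (∑ j ∈ p.support, ((p.coeff j : ℂ) * (k : ℂ) ^ j) * f j (k * s)) :=
      hasSum_sum fun j _ => (hfs j (k * s) (by positivity)).mul_left _
    refine h1.congr_fun fun r => ?_
    rw [Polynomial.eval_eq_sum, Polynomial.sum, Rat.cast_sum, Finset.sum_mul]
    refine Finset.sum_congr rfl fun j _ => ?_
    have h2 : (((l + k * r : ℕ) : ℚ)) = k * ((l : ℚ) / k + r) := by push_cast; field_simp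
    have h3 : -((k * s : ℝ) : ℂ) * ((α / k : ℚ) + ((l : ℚ) / k : ℚ) + r) =
        -s * (α + (l + k * r : ℕ)) := by push_cast; field_simp; ring
    rw [h2, h3, mul_pow]
    push_cast
    ring

end EulerMaclaurin

/-! ### The coefficients `c_n` -/

section Coefficients

/-- The value on a product of polynomials in separate variables of a linear functional that is
multiplicative on monomials. -/
theorem sum_support_prod_aeval {ι : Type*} [Fintype ι] [DecidableEq ι] (q : ι → Polynomial ℚ)
    (B : ι → ℕ → ℂ) :
    ∑ m ∈ (∏ v, Polynomial.aeval (MvPolynomial.X v) (q v) : MvPolynomial ι ℚ).support,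
      (((∏ v, Polynomial.aeval (MvPolynomial.X v) (q v) : MvPolynomial ι ℚ).coeff m : ℚ) : ℂ) *
        ∏ v, B v (m v) = ∏ v, ∑ j ∈ (q v).support, ((q v).coeff j : ℂ) * B v j := by
  set P : MvPolynomial ι ℚ := ∏ v, Polynomial.aeval (MvPolynomial.X v) (q v) with hP
  let Φ : MvPolynomial ι ℚ →ₗ[ℚ] ℂ :=
    (MvPolynomial.basisMonomials ι ℚ).constr ℚ fun m => ∏ v, B v (m v)
  have hΦ : ∀ (m : ι →₀ ℕ) (a : ℚ), Φ (MvPolynomial.monomial m a) = (a : ℂ) * ∏ v, B v (m v) := by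
    intro m a
    have h1 : MvPolynomial.monomial m a = a • MvPolynomial.basisMonomials ι ℚ m := by
      rw [MvPolynomial.coe_basisMonomials, MvPolynomial.smul_monomial, smul_eq_mul, mul_one]
    rw [h1, map_smul, Module.Basis.constr_basis, Rat.smul_def]
  have h1 : Φ P = ∑ m ∈ P.support, ((P.coeff m : ℚ) : ℂ) * ∏ v, B v (m v) := by
    conv_lhs => rw [← P.support_sum_monomial_coeff]
    rw [map_sum]
    exact Finset.sum_congr rfl fun m _ => hΦ m _
  rw [← h1]
  have h2 : P = ∑ f ∈ Fintype.piFinset fun v => (q v).support,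
      MvPolynomial.monomial (Finsupp.equivFunOnFinite.symm f) (∏ v, (q v).coeff (f v)) := by
    have h3 : ∀ v, Polynomial.aeval (MvPolynomial.X v : MvPolynomial ι ℚ) (q v) =
        ∑ j ∈ (q v).support, MvPolynomial.C ((q v).coeff j) * MvPolynomial.X v ^ j := by
      intro v
      rw [Polynomial.aeval_eq_sum_range' (n := (q v).natDegree + 1) (Nat.lt_succ_self _)]
      rw [Finset.sum_subset Polynomial.supp_subset_range_natDegree_succ]
      · exact Finset.sum_congr rfl fun j _ => MvPolynomial.smul_eq_C_mul _ _
      · intro j _ hj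
        rw [Polynomial.notMem_support_iff.1 hj, map_zero, zero_mul]
    rw [hP, Finset.prod_congr rfl fun v _ => h3 v, Finset.prod_univ_sum]
    refine Finset.sum_congr rfl fun f _ => ?_
    rw [MvPolynomial.monomial_eq, Finset.prod_mul_distrib, map_prod, Finsupp.prod_fintype]
    · rfl
    · intro i; exact pow_zero _
  rw [h2, map_sum, Finset.prod_univ_sum]
  refine Finset.sum_congr rfl fun f _ => ?_
  rw [hΦ, Finset.prod_mul_distrib]
  push_cast
  rfl

variable {V : Type*} [Fintype V] [DecidableEq V] {G : SimpleGraph V} [DecidableRel G.Adj]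
  {w : V → ℤ}

/-- The factor at `v`, for the character with parameter `a`, of the coefficient `c_n`. -/
def vertexCoeff (G : SimpleGraph V) [DecidableRel G.Adj] (w : V → ℤ) (k : ℕ) (v : V) (n a : ℤ) :
    ℂ :=
  ∑ α ∈ calSv G w v, (epsv G w v α : ℂ) * (e ((a : ℂ) * α / k) *
    ∑ l : Fin k, e ((a : ℂ) / k) ^ (l : ℕ) *
      ∑ j ∈ (vertexPoly (G.degree v)).support, ((vertexPoly (G.degree v)).coeff j : ℂ) *
      ((k : ℂ) ^ ((j : ℤ) + n) * ((-bbB j n (α / k) (((l : ℕ) : ℚ) / k) : ℚ) : ℂ)))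

/-- The numbers `vertexCoeff` are the Laurent coefficients of the factor of `F(f₁; t)` at `v`. -/
theorem hasLaurent_vertexFactor (hW : IsUnit (linkingMatrix G w).det)
    (hleaf : ∀ i, G.degree i = 1 → w i ≤ -2) {k : ℕ} (hk : 0 < k) {v : V} (hv : 3 ≤ G.degree v)
    (a : ℤ) : HasLaurent (fun s => (-1) ^ G.degree v * vertexFactor G w k v s a)
      (fun n => vertexCoeff G w k v n a) := by
  have : NeZero k := ⟨hk.ne'⟩
  have hk' : (k : ℂ) ≠ 0 := by exact_mod_cast hk.ne'
  set p := vertexPoly (G.degree v) with hp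
  choose f hf hfs using fun (α : ℚ) (l : ℕ) => exists_hasLaurent_poly p hk α l
  have hpow : ∀ l r : ℕ, e ((a : ℂ) / k) ^ (l + k * r) = e ((a : ℂ) / k) ^ l := by
    intro l r
    have h1 : e ((a : ℂ) / k) ^ k = 1 := by
      rw [← zpow_natCast, e_zpow, Int.cast_natCast, mul_div_cancel₀ _ hk', e_int]
    rw [pow_add, pow_mul, h1, one_pow, mul_one]
  have hL : HasLaurent (fun s => ∑ α ∈ calSv G w v, (epsv G w v α : ℂ) * (e ((a : ℂ) * α / k) *
      ∑ l : Fin k, e ((a : ℂ) / k) ^ (l : ℕ) * f α l s)) (fun n => vertexCoeff G w k v n a) :=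
    HasLaurent.sum _ fun α _ => ((HasLaurent.sum _ fun (l : Fin k) _ =>
      (hf α l).const_mul _).const_mul _).const_mul _
  refine hL.congr ?_
  filter_upwards [self_mem_nhdsWithin] with s hs
  have hs0 : 0 < s := hs
  rw [← sum_calSv_exp_mul hW hleaf hk, Finset.sum_mul]
  refine Finset.sum_congr rfl fun α _ => ?_
  rw [mul_assoc, mul_assoc]
  congr 2
  have hy : ‖e ((a : ℂ) / k) * cexp (-(s : ℂ))‖ < 1 := by
    have h1 := norm_e_ratCast ((a : ℚ) / k)
    push_cast at h1
    rw [norm_mul, h1, one_mul, Complex.norm_exp]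
    simpa using hs0
  have h1 := (hasSum_vertexPoly hv hy).mul_left (cexp (-s * α))
  -- split the summation variable into residue classes modulo `k`
  rw [← (Nat.divModEquiv k).symm.hasSum_iff, ← (Equiv.prodComm (Fin k) ℕ).hasSum_iff] at h1
  have h2 : ∀ l : Fin k, HasSum (fun r : ℕ => ((((fun n : ℕ => cexp (-s * α) *
      ((((vertexPoly (G.degree v)).eval (n : ℚ) : ℚ) : ℂ) *
        (e ((a : ℂ) / k) * cexp (-(s : ℂ))) ^ n)) ∘ (Nat.divModEquiv k).symm) ∘
          (Equiv.prodComm (Fin k) ℕ)) (l, r))) (e ((a : ℂ) / k) ^ (l : ℕ) * f α l s) := by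
    intro l
    refine ((hfs α l s hs0).mul_left (e ((a : ℂ) / k) ^ (l : ℕ))).congr_fun fun r => ?_
    have h3 : (Nat.divModEquiv k).symm (r, l) = (l : ℕ) + k * r := by
      simp [Nat.divModEquiv]
      ring
    have h4 : cexp (-s * (α + ((l : ℕ) + k * r : ℕ))) =
        cexp (-s * α) * cexp (-(s : ℂ)) ^ ((l : ℕ) + k * r) := by
      rw [← Complex.exp_nat_mul, ← Complex.exp_add]
      congr 1
      ring
    simp only [Function.comp, Equiv.prodComm_apply, Prod.swap_prod_mk]
    rw [h3, h4, mul_pow, hpow, hp]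
    ring
  exact (h1.prod_fiberwise h2).unique (hasSum_fintype _)

/-- The periodicity of the function passes to its Laurent coefficients, by uniqueness. -/
theorem vertexCoeff_periodic (hW : IsUnit (linkingMatrix G w).det)
    (hleaf : ∀ i, G.degree i = 1 → w i ≤ -2) {k : ℕ} (hk : 0 < k) {v : V} (hv : 3 ≤ G.degree v)
    (n a : ℤ) : vertexCoeff G w k v n (a + 2 * k * M G w v) = vertexCoeff G w k v n a := by
  have h1 := hasLaurent_vertexFactor hW hleaf hk hv (a + 2 * k * M G w v)
  simp only [vertexFactor_periodic hleaf hk] at h1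
  exact congrFun (h1.unique (hasLaurent_vertexFactor hW hleaf hk hv a)) n

/-- Since the singularity of the local function at `v` is removable, the local sums of the Laurent
coefficients vanish in negative degree. -/
theorem localSum_vertexCoeff (hW : IsUnit (linkingMatrix G w).det)
    (hleaf : ∀ i, G.degree i = 1 → w i ≤ -2) {k : ℕ} (hk : 0 < k) {v : V} (hv : 3 ≤ G.degree v)
    (hpos : 0 < ((leaves G v).card : ℤ) + 2 - G.degree v) (b : ℤ) :
    (∀ n < 0, localSum G w k v (vertexCoeff G w k v n) b = 0) ∧
      localSum G w k v (vertexCoeff G w k v 0) b = (-1) ^ G.degree v * localK G w k v b 0 := by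
  obtain ⟨K, hK, hKs, hK0⟩ := exists_analyticAt_localK hleaf hk hv hpos b
  obtain ⟨c, hc, hcneg, hc0⟩ := hasLaurent_of_analyticAt hK
  have h1 : HasLaurent (fun s => ∑ j ∈ Finset.range (M G w v).natAbs,
      leafWeight G w k v (b + 2 * k * j) *
        ((-1) ^ G.degree v * vertexFactor G w k v s (b + 2 * k * j)))
      (fun n => localSum G w k v (vertexCoeff G w k v n) b) :=
    HasLaurent.sum _ fun j _ => (hasLaurent_vertexFactor hW hleaf hk hv _).const_mul _
  have ht : Tendsto (fun s : ℝ => (s : ℂ)) (𝓝[>] 0) (𝓝[≠] 0) := by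
    refine tendsto_nhdsWithin_iff.2 ⟨?_, ?_⟩
    · exact (Complex.continuous_ofReal.tendsto' _ _ (by simp)).mono_left nhdsWithin_le_nhds
    · filter_upwards [self_mem_nhdsWithin] with s hs
      have : (s : ℝ) ≠ 0 := ne_of_gt hs
      simpa using this
  have h2 : HasLaurent (fun s => ∑ j ∈ Finset.range (M G w v).natAbs,
      leafWeight G w k v (b + 2 * k * j) *
        ((-1) ^ G.degree v * vertexFactor G w k v s (b + 2 * k * j)))
      (fun n => (-1) ^ G.degree v * c n) := by
    refine (hc.const_mul _).congr ?_
    filter_upwards [ht.eventually hKs] with s hs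
    rw [← hs, ← localSum_vertexFactor hW hleaf hk, localSum, Finset.mul_sum]
    exact Finset.sum_congr rfl fun j _ => mul_left_comm _ _ _
  have h3 := fun n => congrFun (h1.unique h2) n
  refine ⟨fun n hn => ?_, ?_⟩
  · rw [h3, hcneg n hn, mul_zero]
  · rw [h3, hc0, hK0]

/-- The factor of `c_n` at a vertex of degree at least two. -/
def coeffFactor (G : SimpleGraph V) [DecidableRel G.Adj] (w : V → ℤ) (k : ℕ) (n : V3 G → ℤ)
    (v : V2 G) (a : ℤ) : ℂ :=
  if 3 ≤ G.degree v.1 then vertexCoeff G w k v.1 (ext0 G n v) a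
  else (-1) ^ G.degree v.1 * vertexFactor G w k v.1 0 a

/-- The coefficient `c_n`, multiplied by the Gauss sum, as a Gauss sum weighted by products of local
coefficients: `e(Q(λ + α) / k)` is expanded into characters, and the sums over `m`, `α` and `λ` are
distributed over the vertices. -/
theorem coeff_mul_qsum (hW : IsUnit (linkingMatrix G w).det)
    (hleaf : ∀ i, G.degree i = 1 → w i ≤ -2) {k : ℕ} (hk : 0 < k) (n : V3 G → ℤ) :
    coeff G w k n * qsum (lattice G w k) (gaussWeight G w k) =
      qsum (lattice G w k) fun μ => gaussWeight G w k μ * ∏ v, coeffFactor G w k n v (μ v) := by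
  have hfin := finite_quotient_lattice hW hleaf hk
  -- the factor at `v` for fixed `α`
  set B : V3 G → ℤ → ℚ → ℕ → ℕ → ℂ := fun v a α l j => e ((a : ℂ) / k) ^ l *
    ((k : ℂ) ^ ((j : ℤ) + n v) * ((-bbB j (n v) (α / k) ((l : ℚ) / k) : ℚ) : ℂ)) with hB
  set Y : V2 G → ℤ → ℚ → ℂ := fun v a α => if h : 3 ≤ G.degree v.1 then
    ∑ l : Fin k, ∑ j ∈ (vertexPoly (G.degree v.1)).support,
      ((vertexPoly (G.degree v.1)).coeff j : ℂ) * B ⟨v.1, h⟩ a α l j else 1 with hY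
  have hfactor : ∀ v a, coeffFactor G w k n v a =
      ∑ α ∈ calSv G w v.1, (epsv G w v.1 α : ℂ) * (e ((a : ℂ) * α / k) * Y v a α) := by
    intro v a
    rw [coeffFactor]
    split_ifs with h
    · rw [vertexCoeff]
      refine Finset.sum_congr rfl fun α _ => ?_
      simp only [hY, dif_pos h, hB, ext0]
      congr 2
      refine Finset.sum_congr rfl fun l _ => ?_
      rw [Finset.mul_sum]
      exact Finset.sum_congr rfl fun j _ => mul_left_comm _ _ _
    · have h2 : (2 : ℤ) - G.degree v.1 = 0 := by have := v.2; omega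
      rw [← sum_calSv_exp_mul hW hleaf hk, h2, zpow_zero, mul_one]
      refine Finset.sum_congr rfl fun α _ => ?_
      simp only [hY, dif_neg h, neg_zero, zero_mul, Complex.exp_zero]
  have hinner : ∀ (μ : V2 G → ℤ) (α : V2 G → ℚ), ∑ m ∈ (P G).support, (((P G).coeff m : ℚ) : ℂ) *
      ∑ l : V3 G → Fin k, ∏ v : V3 G, B v (μ (V3.toV2 G v)) (α (V3.toV2 G v)) (l v) (m v) =
      ∏ v : V2 G, Y v (μ v) (α v) := by
    intro μ α
    rw [prod_V2_eq_prod_V3 (g := fun v => Y v (μ v) (α v)) (fun v hv => dif_neg hv)]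
    have h1 : ∀ v : V3 G, Y (V3.toV2 G v) (μ (V3.toV2 G v)) (α (V3.toV2 G v)) =
        ∑ l : Fin k, ∑ j ∈ (vertexPoly (G.degree v.1)).support,
          ((vertexPoly (G.degree v.1)).coeff j : ℂ) *
            B v (μ (V3.toV2 G v)) (α (V3.toV2 G v)) l j := fun v => dif_pos v.2
    rw [Finset.prod_congr rfl fun v _ => h1 v, Finset.prod_univ_sum, Fintype.piFinset_univ]
    simp only [Finset.mul_sum]
    rw [Finset.sum_comm]
    refine Finset.sum_congr rfl fun l _ => ?_
    rw [P_eq_prod]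
    exact sum_support_prod_aeval (fun v : V3 G => vertexPoly (G.degree v.1))
      (fun v j => B v (μ (V3.toV2 G v)) (α (V3.toV2 G v)) (l v) j)
  have hprod : ∀ μ : V2 G → ℤ, ∏ v, coeffFactor G w k n v (μ v) =
      ∑ m ∈ (P G).support, ∑ α ∈ calS G w, ∑ l : V3 G → Fin k,
        (((P G).coeff m : ℚ) : ℂ) * ((eps G w α : ℂ) * ((∏ v : V2 G, e ((μ v : ℂ) * α v / k)) *
          ∏ v : V3 G, B v (μ (V3.toV2 G v)) (α (V3.toV2 G v)) (l v) (m v))) := by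
    intro μ
    rw [Finset.prod_congr rfl fun v _ => hfactor v (μ v),
      ← sum_calS_prod (fun v α => e ((μ v : ℂ) * α / k) * Y v (μ v) α), Finset.sum_comm]
    refine Finset.sum_congr rfl fun α _ => ?_
    rw [Finset.prod_mul_distrib, ← hinner, Finset.mul_sum, Finset.mul_sum]
    refine Finset.sum_congr rfl fun m _ => ?_
    simp only [Finset.mul_sum]
    refine Finset.sum_congr rfl fun l _ => ?_
    ring
  have hgw : ∀ μ : V2 G → ℤ, gaussWeight G w k μ * ∏ v, coeffFactor G w k n v (μ v) =
      ∑ m ∈ (P G).support, ∑ α ∈ calS G w, ∑ l : V3 G → Fin k, gaussWeight G w k μ *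
        ((((P G).coeff m : ℚ) : ℂ) * ((eps G w α : ℂ) * ((∏ v : V2 G, e ((μ v : ℂ) * α v / k)) *
          ∏ v : V3 G, B v (μ (V3.toV2 G v)) (α (V3.toV2 G v)) (l v) (m v)))) := by
    intro μ
    rw [hprod μ]
    simp only [Finset.mul_sum]
  rw [qsum_congr hgw, qsum_sum, coeff, Finset.sum_mul]
  refine Finset.sum_congr rfl fun m _ => ?_
  rw [qsum_sum, mul_assoc, Finset.sum_mul, Finset.mul_sum]
  refine Finset.sum_congr rfl fun α hα => ?_
  rw [qsum_sum, Finset.mul_sum, Finset.sum_mul, Finset.mul_sum]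
  refine Finset.sum_congr rfl fun l _ => ?_
  have h1 := e_Q_ext0_mul_qsum hW hleaf hk hα (fun v => (l v : ℕ))
  have h2 : ∀ E g0 p K ε b : ℂ, (p * K) * (ε * (E * b) * g0) = (p * K * ε * b) * (E * g0) := by
    intros; ring
  rw [h2, h1, ← qsum_mul_left]
  refine qsum_congr fun μ => ?_
  simp only [hB, Finset.prod_mul_distrib]
  ring

theorem coeffFactor_periodic (hW : IsUnit (linkingMatrix G w).det)
    (hleaf : ∀ i, G.degree i = 1 → w i ≤ -2) {k : ℕ} (hk : 0 < k) (n : V3 G → ℤ) (v : V2 G)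
    (a : ℤ) : coeffFactor G w k n v (a + 2 * k * M G w v.1) = coeffFactor G w k n v a := by
  rw [coeffFactor, coeffFactor]
  split_ifs with h
  · exact vertexCoeff_periodic hW hleaf hk h _ _
  · rw [vertexFactor_periodic hleaf hk]

/-- The coefficient `c_n` as a sum modulo `2 k`. -/
theorem coeff_mul_qsum_eq (hW : IsUnit (linkingMatrix G w).det)
    (hleaf : ∀ i, G.degree i = 1 → w i ≤ -2) {k : ℕ} (hk : 0 < k) (n : V3 G → ℤ) :
    coeff G w k n * qsum (lattice G w k) (gaussWeight G w k) =
      qsum (boxLattice fun _ : V2 G => (2 * k : ℤ)) fun b => edgeWeight G w k b *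
        ∏ v : V2 G, localSum G w k v.1 (coeffFactor G w k n v) (b v) := by
  rw [coeff_mul_qsum hW hleaf hk, qsum_gaussWeight_mul_prod hW hleaf hk _
    (coeffFactor_periodic hW hleaf hk n)]

/-- The local coefficient at a vertex with `n_v ≤ -1` vanishes. -/
theorem coeff_eq_zero (hneg : (-(linkingMatrix G w).map (Int.cast : ℤ → ℝ)).PosDef)
    (hW : IsUnit (linkingMatrix G w).det) (hleaf : ∀ i, G.degree i = 1 → w i ≤ -2)
    {k : ℕ} (hk : 0 < k)
    (hpos : ∀ v : V3 G, 0 < ((leaves G v.1).card : ℤ) + 2 - G.degree v.1) {n : V3 G → ℤ}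
    {v : V3 G} (hn : n v ≤ -1) : coeff G w k n = 0 := by
  have hfin := finite_quotient_two_mul (G := G) hk
  have h1 := coeff_mul_qsum_eq hW hleaf hk n
  have h3 : ∀ b : V2 G → ℤ, edgeWeight G w k b *
      ∏ u : V2 G, localSum G w k u.1 (coeffFactor G w k n u) (b u) = 0 := by
    intro b
    rw [Finset.prod_eq_zero (Finset.mem_univ (V3.toV2 G v)), mul_zero]
    have h2 : coeffFactor G w k n (V3.toV2 G v) = vertexCoeff G w k v.1 (n v) := by
      funext a
      rw [coeffFactor, ext0_toV2]
      exact if_pos v.2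
    rw [h2]
    exact (localSum_vertexCoeff hW hleaf hk v.2 (hpos v) _).1 _ (by omega)
  rw [qsum_congr h3, qsum_const, mul_zero] at h1
  exact (mul_eq_zero.1 h1).resolve_right (qsum_gaussWeight_ne_zero hneg hW hleaf hk)

/-- Both sides reduce to the same sum modulo `2k` of products of values of the local functions. -/
theorem coeff_zero_eq (hG : G.IsTree)
    (hneg : (-(linkingMatrix G w).map (Int.cast : ℤ → ℝ)).PosDef)
    (hW : IsUnit (linkingMatrix G w).det) (hleaf : ∀ i, G.degree i = 1 → w i ≤ -2)
    {k : ℕ} (hk : 0 < k)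
    (hpos : ∀ v : V3 G, 0 < ((leaves G v.1).card : ℤ) + 2 - G.degree v.1) :
    coeff G w k 0 = weightedGaussSum G w k := by
  have hfin := finite_quotient_two_mul (G := G) hk
  refine mul_right_cancel₀ (qsum_gaussWeight_ne_zero hneg hW hleaf hk) ?_
  rw [coeff_mul_qsum_eq hW hleaf hk, weightedGaussSum_eq hG hW hleaf hk, mul_right_comm,
    prefactor_mul_qsum hneg hW hleaf hk, ← qsum_mul_left]
  refine qsum_congr fun b => ?_
  have h1 : ∀ v : V2 G, localSum G w k v.1 (coeffFactor G w k 0 v) (b v) =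
      (-1) ^ G.degree v.1 * localK G w k v.1 (b v) 0 := by
    intro v
    by_cases h : 3 ≤ G.degree v.1
    · have h2 : coeffFactor G w k 0 v = vertexCoeff G w k v.1 0 := by
        funext a
        rw [coeffFactor, if_pos h, ext0, dif_pos h]
        rfl
      rw [h2]
      exact (localSum_vertexCoeff hW hleaf hk h (hpos ⟨v.1, h⟩) _).2
    · rw [← localSum_vertexFactor hW hleaf hk, localSum, localSum, Finset.mul_sum]
      refine Finset.sum_congr rfl fun j _ => ?_
      rw [coeffFactor, if_neg h, mul_left_comm]
  rw [Finset.prod_congr rfl fun v _ => h1 v, Finset.prod_mul_distrib, prod_neg_one_pow_degree]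
  ring

end Coefficients

end Plumbing

end

theorem mainTheorem2 {V : Type*} [Fintype V] [DecidableEq V]
    (G : SimpleGraph V) [DecidableRel G.Adj] (w : V → ℤ)
    (hG : G.IsTree)
    (hneg : (-(Plumbing.linkingMatrix G w).map (Int.cast : ℤ → ℝ)).PosDef)
    (hdet : (Plumbing.linkingMatrix G w).det = 1 ∨ (Plumbing.linkingMatrix G w).det = -1)
    (hleaf : ∀ i, G.degree i = 1 → w i ≤ -2)
    (k : ℕ) (hk : 0 < k) :
    -- `ratF` is the function given by the convergent series `F(f₁; t)` for positive `t`
    (∀ t : Plumbing.V3 G → ℝ, (∀ v, 0 < t v) →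
      (∀ α ∈ Plumbing.calS G w, Summable (Plumbing.term G w k (Plumbing.f1 G) t α)) ∧
      Plumbing.seriesF G w k (Plumbing.f1 G) t = Plumbing.ratF G w k (fun v => (t v : ℂ))) ∧
    -- the order at `t_v = 0`, the other variables being kept away from their poles
    (∀ v : Plumbing.V3 G, ∀ t : Plumbing.V3 G → ℂ,
      (∀ u, u ≠ v → Complex.exp (k * t u) ≠ 1) →
      MeromorphicAt (fun s : ℂ => Plumbing.ratF G w k (Function.update t v s)) 0 ∧
      ((min 0 (((Plumbing.leaves G v.1).card : ℤ) + 2 - G.degree v.1) : ℤ) : WithTop ℤ) ≤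
        meromorphicOrderAt
          (fun s : ℂ => Plumbing.ratF G w k (Function.update t v s)) 0) ∧
    -- holomorphy at `t = 0`, the value there, and the vanishing of the negative coefficients
    ((∀ v : Plumbing.V3 G,
        0 < ((Plumbing.leaves G v.1).card : ℤ) + 2 - G.degree v.1) →
      (∃ H : (Plumbing.V3 G → ℂ) → ℂ, AnalyticAt ℂ H 0 ∧
        (∀ᶠ t in 𝓝 (0 : Plumbing.V3 G → ℂ), (∀ v, t v ≠ 0) → Plumbing.ratF G w k t = H t) ∧
        H 0 = Plumbing.coeff G w k 0) ∧
      Plumbing.coeff G w k 0 = Plumbing.weightedGaussSum G w k ∧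
      (∀ n : Plumbing.V3 G → ℤ, (∃ v, n v ≤ -1) → Plumbing.coeff G w k n = 0)) := by
  have hW : IsUnit (Plumbing.linkingMatrix G w).det := by
    rcases hdet with h | h <;> rw [h]
    · exact isUnit_one
    · exact isUnit_one.neg
  refine ⟨fun t ht => ⟨fun α hα => Plumbing.summable_term hneg hW hleaf hk ht hα,
    Plumbing.seriesF_eq_ratF hneg hW hleaf hk ht⟩,
    fun v t _ => Plumbing.meromorphicOrderAt_ratF hW hleaf hk v t, fun hpos => ?_⟩
  have h0 := Plumbing.coeff_zero_eq hG hneg hW hleaf hk hpos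
  obtain ⟨H, hH, hHt, hH0⟩ := Plumbing.exists_analyticAt_ratF hG hW hleaf hk hpos
  exact ⟨⟨H, hH, hHt, hH0.trans h0.symm⟩, h0,
    fun n ⟨_, hn⟩ => Plumbing.coeff_eq_zero hneg hW hleaf hk hpos hn⟩
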